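/- Let $n\in\mathbb{N}$ and let $B_n=[n]\times\mathbb{Q}$ be the partially ordered set consisting of $n$ disjoint copies of $(\mathbb{Q},<)$, i.e. $(a,q)<(b,r)$ if and only if $a=b$ and $q<r$. Give $\mathsf{Aut}(B_n)$ the topology of pointwise convergence ($B_n$ discrete). For $\rho\in\mathsf{Aut}(B_n)$ let $\mathcal{C}_\rho$ be the closure of the conjugacy class of $\rho$ in $\mathsf{Aut}(B_n)$, and let $\mathcal{P}_\rho$ be the set of all finite partial isomorphisms of $B_n$ which extend to an automorphism from $\mathcal{C}_\rho$, ordered by extension of maps; $\mathsf{Aut}(B_n)$ acts on it by $\alpha(p)=\alpha p\alpha^{-1}$. Every $\gamma\in\mathsf{Aut}(B_n)$ induces a permutation $\sigma_\gamma$ of $[n]$. Call $p\in\mathcal{P}_\rho$ symmetric if it extends to some $\gamma\in\mathcal{C}_\rho$ such that every orbit of $\sigma_\gamma$ can be listed as $a_1,\dots,a_k$ ($k$ its size) with $\sigma_\gamma(a_j)=a_{j+1}$ for $j<k$ and $\sigma_\gamma(a_k)=a_1$, so that for every $0\le i<k$ the map $p^i$ defines an order isomorphism from $(\mathsf{Dom}(p)\cup\mathsf{Rng}(p))\cap(\{a_1\}\times\mathbb{Q})$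 onto $(\mathsf{Dom}(p)\cup\mathsf{Rng}(p))\cap(\{a_{i+1}\}\times\mathbb{Q})$ which preserves the partial action of $p^{k}$. Let $\mathcal{P}^{sym}_\rho$ be the set of symmetric elements of $\mathcal{P}_\rho$. Theorem. For every $\rho\in\mathsf{Aut}(B_n)$: 1. $\mathcal{C}_\rho$ contains a generic automorphism, i.e. there is $\gamma\in\mathcal{C}_\rho$ whose conjugacy class in $\mathsf{Aut}(B_n)$ is comeagre in the subspace $\mathcal{C}_\rho$. 2. There is a family $\mathcal{F}\subseteq\mathcal{P}^{sym}_\rho$, invariant under the action of $\mathsf{Aut}(B_n)$, which is cofinal in $\mathcal{P}_\rho$ (every $p\in\mathcal{P}_\rho$ is extended by some $q\in\mathcal{F}$) and has the amalgamation property: whenever $p_0,p_1,p_2\in\mathcal{F}$, $p_0\subseteq p_1$ and $p_0\subseteq p_2$, there are $p_3\in\mathcal{F}$ and $\alpha\in\mathsf{Aut}(B_n)$ fixing $\mathsf{Dom}(p_0)\cup\mathsf{Rng}(p_0)$ pointwise such that $p_1\subseteq p_3$ and $\alpha(p_2)\subseteq p_3$. -/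

import Mathlib

/-- The disjoint union of `n` copies of `(ℚ, <)`. The order that Mathlib puts on a sigma type is the
disjoint sum of the orders: `⟨a, q⟩ ≤ ⟨b, r⟩` iff `a = b` and `q ≤ r`. -/
abbrev CopiesQ (n : ℕ) : Type := Σ _ : Fin n, ℚ

/-- The ordering of `CopiesQ n`, spelled out. -/
theorem copiesQ_lt_iff {n : ℕ} (x y : CopiesQ n) : x < y ↔ x.1 = y.1 ∧ x.2 < y.2 := by
  obtain ⟨a, q⟩ := x
  obtain ⟨b, r⟩ := y
  constructor
  · rintro ⟨_, _, _, h⟩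
    exact ⟨rfl, h⟩
  · rintro ⟨h1, h2⟩
    dsimp only at h1 h2
    subst h1
    exact Sigma.mk_lt_mk_iff.2 h2

namespace PosetAut

section General

variable {M : Type} [PartialOrder M]

/-- The topology of pointwise convergence on the automorphism group, with `M` discrete. -/
instance pointwiseTopology : TopologicalSpace (M ≃o M) :=
  TopologicalSpace.induced (fun f : M ≃o M => (f : M → M))
    (@Pi.topologicalSpace M (fun _ => M) (fun _ => ⊥))

/-- `C_ρ`: the closure of the conjugacy class of `ρ` in the automorphism group. -/
def conjClosure (ρ : M ≃o M) : Set (M ≃o M) := closure (conjugatesOf ρ)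

/-- `γ` is generic in `C`: its conjugacy class is comeagre in the subspace `C`. -/
def IsGenericIn (γ : M ≃o M) (C : Set (M ≃o M)) : Prop :=
  {δ : C | (δ : M ≃o M) ∈ conjugatesOf γ} ∈ residual C

/-- A finite set of pairs is (the graph of) a finite partial isomorphism. By antisymmetry of `≤`
such a set is automatically the graph of an injective partial function. -/
def IsPartialIso (p : Finset (M × M)) : Prop :=
  ∀ x ∈ p, ∀ y ∈ p, x.1 ≤ y.1 ↔ x.2 ≤ y.2

/-- The automorphism `γ` extends `p`. -/
def Extends (γ : M ≃o M) (p : Finset (M × M)) : Prop :=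
  ∀ x ∈ p, γ x.1 = x.2

/-- `P_ρ`: the finite partial isomorphisms which extend to an automorphism from `C_ρ`. -/
def partialIsos (ρ : M ≃o M) : Set (Finset (M × M)) :=
  {p | IsPartialIso p ∧ ∃ γ ∈ conjClosure ρ, Extends γ p}

/-- `Dom p ∪ Rng p`. -/
def support (p : Finset (M × M)) : Set M :=
  {x | (∃ y, (x, y) ∈ p) ∨ ∃ y, (y, x) ∈ p}

/-- The action of automorphisms on finite partial isomorphisms: `α (p) = α ∘ p ∘ α⁻¹`. -/
def translate (α : M ≃o M) (p : Finset (M × M)) : Finset (M × M) :=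
  p.map (α.toEquiv.prodCongr α.toEquiv).toEmbedding

/-- The family `F` is invariant under the action of the automorphism group. -/
def IsInvariant (F : Set (Finset (M × M))) : Prop :=
  ∀ p ∈ F, ∀ α : M ≃o M, translate α p ∈ F

/-- `F` is a cofinal subfamily of `G`, with respect to extension of maps. -/
def IsCofinalIn (F G : Set (Finset (M × M))) : Prop :=
  F ⊆ G ∧ ∀ p ∈ G, ∃ q ∈ F, p ⊆ q

/-- The amalgamation property of a family of finite partial isomorphisms. -/
def HasAmalgamation (F : Set (Finset (M × M))) : Prop :=
  ∀ p₀ ∈ F, ∀ p₁ ∈ F, ∀ p₂ ∈ F, p₀ ⊆ p₁ → p₀ ⊆ p₂ →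
    ∃ p₃ ∈ F, ∃ α : M ≃o M,
      (∀ x ∈ support p₀, α x = x) ∧ p₁ ⊆ p₃ ∧ translate α p₂ ⊆ p₃

/-- The graph of the `i`-th iterate of the partial map `p`: `iter p i x y` says that `p ^ i` is
defined at `x` with value `y`. -/
def iter (p : Finset (M × M)) : ℕ → M → M → Prop
  | 0, x, y => x = y
  | i + 1, x, y => ∃ z, (x, z) ∈ p ∧ iter p i z y

end General

section Copies

variable {n : ℕ}

theorem fst_apply_eq (γ : CopiesQ n ≃o CopiesQ n) {x y : CopiesQ n} (h : x.1 = y.1) :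
    (γ x).1 = (γ y).1 := by
  have key : ∀ {u v : CopiesQ n}, u ≤ v → u.1 = v.1 := by
    rintro _ _ ⟨_, _, _, _⟩
    rfl
  obtain ⟨a, q⟩ := x
  obtain ⟨b, r⟩ := y
  dsimp only at h
  subst h
  rcases le_total q r with hqr | hqr
  · exact key (γ.monotone (Sigma.mk_le_mk_iff.2 hqr))
  · exact (key (γ.monotone (Sigma.mk_le_mk_iff.2 hqr))).symm

/-- `σ_γ`: the permutation of the set of copies induced by the automorphism `γ`. -/
def inducedPerm (γ : CopiesQ n ≃o CopiesQ n) : Equiv.Perm (Fin n) where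
  toFun a := (γ ⟨a, 0⟩).1
  invFun a := (γ.symm ⟨a, 0⟩).1
  left_inv a := by
    have h := fst_apply_eq γ.symm (x := ⟨(γ ⟨a, 0⟩).1, 0⟩) (y := γ ⟨a, 0⟩) rfl
    simpa using h
  right_inv a := by
    have h := fst_apply_eq γ (x := ⟨(γ.symm ⟨a, 0⟩).1, 0⟩) (y := γ.symm ⟨a, 0⟩) rfl
    simpa using h

/-- The part of `Dom p ∪ Rng p` which lies in the copy of `ℚ` with index `a`. -/
def supportAt (p : Finset (CopiesQ n × CopiesQ n)) (a : Fin n) : Set (CopiesQ n) :=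
  {x | x ∈ support p ∧ x.1 = a}

/-- The map `p ^ i` defines an isomorphism from the part of `Dom p ∪ Rng p` in copy `a` onto the
part in copy `b`, and this isomorphism preserves the partial action of `p ^ k`. -/
def IterIsIso (p : Finset (CopiesQ n × CopiesQ n)) (k i : ℕ) (a b : Fin n) : Prop :=
  ∃ φ : supportAt p a ≃o supportAt p b,
    (∀ x : supportAt p a, iter p i (x : CopiesQ n) (φ x : CopiesQ n)) ∧
    ∀ x y : supportAt p a,
      iter p k (x : CopiesQ n) (y : CopiesQ n) ↔ iter p k (φ x : CopiesQ n) (φ y : CopiesQ n)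

/-- `p` is symmetric with respect to the permutation `σ` of the copies: each orbit of `σ` can be
listed as `b, σ b, …, σ ^ (k - 1) b`, where `k` is its size, so that each `p ^ i` with `i < k` defines
an isomorphism from the part of `p` in copy `b` onto the part in copy `σ ^ i b`, preserving the
partial action of `p ^ k`. -/
def IsSymmetricFor (σ : Equiv.Perm (Fin n)) (p : Finset (CopiesQ n × CopiesQ n)) : Prop :=
  ∀ a : Fin n, ∃ b : Fin n, σ.SameCycle a b ∧
    ∀ i < Function.minimalPeriod σ b,
      IterIsIso p (Function.minimalPeriod σ b) i b ((σ ^ i) b)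

/-- The symmetric elements of `P_ρ`. The permutation of the copies which a member of `P_ρ` follows is
that of an extension `γ ∈ C_ρ`; it is conjugate to the permutation induced by `ρ`, and every
conjugate occurs, since `C_ρ` and `P_ρ` are invariant under conjugation. -/
def symmetricPartialIsos (ρ : CopiesQ n ≃o CopiesQ n) : Set (Finset (CopiesQ n × CopiesQ n)) :=
  {p | IsPartialIso p ∧
    ∃ γ ∈ conjClosure ρ, Extends γ p ∧ IsSymmetricFor (inducedPerm γ) p}

end Copies

end PosetAut

/-! Call a finite partial map embeddable in `ρ` if some translate of it is contained in the graph of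
`ρ`. Then `γ ∈ C_ρ` iff all finite parts of `γ` are embeddable in `ρ`, and `P_ρ` consists of the
embeddable maps. The core is that each of them extends to a symmetric amalgamation base
(`exists_symmetric_isBase`): any two embeddable extensions of a base embed in `ρ` with equal values
on the support of the base. The symmetric bases form the family: it is invariant and cofinal, and an
amalgam arises by enlarging the union of two such embedded extensions. A comeagre set of `γ ∈ C_ρ`
is saturated for the family, saturated automorphisms are conjugate by back-and-forth, and Baire
category provides one.

For a single automorphism `g` of ℚ, colour each point by its direction of motion. Colour is constant
on orbit hulls, and any finite configuration of points moved in one direction fits in a single hull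
of that colour (`exists_chain_embedding`). So embeddability depends only on sequences of colours
(`exists_embedding_of_colour_map`). A well-founded induction on the set of colours cuts ℚ into
finitely many pieces, each of at most one point or realizing every word in its colours
(`exists_cutting`). With the least number of pieces, a finite set can be anchored: its colours alone
determine the pieces in which its points lie (`Anchored.map_eq`). A restriction of `g` generated
from an anchored set is a base, since the rest of any extension can be placed by colour and piece
only (`isBase_graphOn`).

For `n` copies, an automorphism is determined up to conjugacy by its permutation of the copies and
the return maps on cycle representatives, up to conjugacy. Bases for the return maps are spread
along the cycles (`cycleExtension`), which makes the result symmetric. An embedding might still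
exchange cycles; the bases are therefore first enlarged so that a cycle can only go to one whose
return map has the same embeddable finite maps (`exists_pinning`, `isBase_cycleExtension`). -/

namespace PosetAut

/-! ### Embeddings of finite partial maps and amalgamation bases -/

section Embeddings

variable {M : Type} [PartialOrder M]

/-- The automorphism `α` carries the finite partial map `p` into the graph of `g`. -/
def EmbedsVia (g α : M ≃o M) (p : Finset (M × M)) : Prop :=
  ∀ x ∈ p, g (α x.1) = α x.2

/-- Some translate of `p` is contained in the graph of `g`. -/
def Embeds (g : M ≃o M) (p : Finset (M × M)) : Prop :=
  ∃ α : M ≃o M, EmbedsVia g α p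

/-- `q` is an amalgamation base for the finite partial maps that embed in `g`. -/
def IsBase (g : M ≃o M) (q : Finset (M × M)) : Prop :=
  ∀ p₁ p₂ : Finset (M × M), Embeds g p₁ → Embeds g p₂ → q ⊆ p₁ → q ⊆ p₂ →
    ∃ α₁ α₂ : M ≃o M, EmbedsVia g α₁ p₁ ∧ EmbedsVia g α₂ p₂ ∧ ∀ x ∈ support q, α₁ x = α₂ x

end Embeddings

/-! ### Automorphisms of ℚ: colours, orbit hulls, embeddings into one hull -/

section Rationals

/-- A strictly monotone map on a finite set of rationals extends to an automorphism. -/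
theorem exists_orderIso_extending (S : Finset ℚ) (β : ℚ → ℚ) (hβ : StrictMonoOn β (S : Set ℚ)) :
    ∃ α : ℚ ≃o ℚ, ∀ x ∈ S, α x = β x := by
  classical
  let p : Order.PartialIso ℚ ℚ := ⟨S.image (fun x => (x, β x)), by
    intro a ha b hb
    simp only [Finset.mem_image] at ha hb
    obtain ⟨x, hx, rfl⟩ := ha
    obtain ⟨y, hy, rfl⟩ := hb
    exact (hβ.cmp_map_eq hx hy).symm⟩
  -- Cantor's back-and-forth, started at the given partial isomorphism `p`.
  let cof : ℚ ⊕ ℚ → Order.Cofinal (Order.PartialIso ℚ ℚ) := fun s =>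
    Sum.recOn s (Order.PartialIso.definedAtLeft ℚ) (Order.PartialIso.definedAtRight ℚ)
  let I : Order.Ideal (Order.PartialIso ℚ ℚ) := Order.idealOfCofinals p cof
  let F a := Order.PartialIso.funOfIdeal a I (Order.cofinal_meets_idealOfCofinals _ cof (Sum.inl a))
  let G b := Order.PartialIso.invOfIdeal b I (Order.cofinal_meets_idealOfCofinals _ cof (Sum.inr b))
  refine ⟨OrderIso.ofCmpEqCmp (fun a ↦ (F a).val) (fun b ↦ (G b).val) fun a b ↦ by
      rcases (F a).prop with ⟨f, hf, ha⟩
      rcases (G b).prop with ⟨g, hg, hb⟩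
      rcases I.directed _ hf _ hg with ⟨m, _, fm, gm⟩
      exact m.prop (a, _) (fm ha) (_, b) (gm hb), ?_⟩
  intro x hx
  change (F x).val = β x
  rcases (F x).prop with ⟨f, hf, ha⟩
  have hp : p ∈ I := Order.mem_idealOfCofinals p cof
  rcases I.directed _ hf _ hp with ⟨m, _, fm, pm⟩
  have h1 := m.prop (x, (F x).val) (fm ha) (x, β x)
    (pm (show (x, β x) ∈ S.image (fun x => (x, β x)) from Finset.mem_image_of_mem _ hx))
  rw [cmp_self_eq_eq] at h1
  exact (cmp_eq_eq_iff _ _).1 h1.symm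

/-- The sign of the displacement of `x` under `g`, as a comparison. -/
def colour (g : ℚ ≃o ℚ) (x : ℚ) : Ordering := cmp x (g x)

/-- `y` lies in the convex hull of the orbit of `x` under `g`. -/
def Hull (g : ℚ ≃o ℚ) (x y : ℚ) : Prop := ∃ i j : ℤ, (g ^ i) x ≤ y ∧ y ≤ (g ^ j) x

theorem zpow_add_apply (g : ℚ ≃o ℚ) (i j : ℤ) (x : ℚ) : (g ^ (i + j)) x = (g ^ i) ((g ^ j) x) := by
  rw [zpow_add]; rfl

theorem zpow_succ_apply (g : ℚ ≃o ℚ) (i : ℤ) (x : ℚ) : (g ^ (i + 1)) x = g ((g ^ i) x) := by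
  rw [add_comm, zpow_add_apply, zpow_one]

theorem zpow_succ_apply' (g : ℚ ≃o ℚ) (i : ℤ) (x : ℚ) : (g ^ (i + 1)) x = (g ^ i) (g x) := by
  rw [zpow_add_apply, zpow_one]

theorem zpow_neg_apply_zpow (g : ℚ ≃o ℚ) (i : ℤ) (x : ℚ) : (g ^ (-i)) ((g ^ i) x) = x := by
  rw [← zpow_add_apply]; simp

theorem zpow_apply_zpow_neg (g : ℚ ≃o ℚ) (i : ℤ) (x : ℚ) : (g ^ i) ((g ^ (-i)) x) = x := by
  rw [← zpow_add_apply]; simp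

theorem colour_zpow (g : ℚ ≃o ℚ) (i : ℤ) (x : ℚ) : colour g ((g ^ i) x) = colour g x := by
  unfold colour
  rw [← zpow_succ_apply, zpow_succ_apply']
  exact (g ^ i).strictMono.cmp_map_eq x (g x)

theorem colour_apply (g : ℚ ≃o ℚ) (x : ℚ) : colour g (g x) = colour g x := by
  simpa using colour_zpow g 1 x

theorem colour_eq_lt {g : ℚ ≃o ℚ} {x : ℚ} : colour g x = .lt ↔ x < g x := cmp_eq_lt_iff _ _
theorem colour_eq_eq {g : ℚ ≃o ℚ} {x : ℚ} : colour g x = .eq ↔ g x = x := by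
  rw [eq_comm (a := g x)]; exact cmp_eq_eq_iff _ _
theorem colour_eq_gt {g : ℚ ≃o ℚ} {x : ℚ} : colour g x = .gt ↔ g x < x := cmp_eq_gt_iff _ _

theorem zpow_apply_of_fixed {g : ℚ ≃o ℚ} {x : ℚ} (h : g x = x) (i : ℤ) : (g ^ i) x = x := by
  induction i with
  | zero => rfl
  | succ i ih => rw [zpow_succ_apply, ih, h]
  | pred i ih =>
    apply g.injective
    rw [← zpow_succ_apply, sub_add_cancel, ih, h]

theorem zpow_strictMono_apply {g : ℚ ≃o ℚ} {x : ℚ} (h : x < g x) :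
    StrictMono fun i : ℤ => (g ^ i) x := by
  apply strictMono_int_of_lt_succ
  intro i
  rw [zpow_succ_apply']
  exact (g ^ i).strictMono h

theorem zpow_inv_apply (g : ℚ ≃o ℚ) (i : ℤ) (x : ℚ) : (g⁻¹ ^ i) x = (g ^ (-i)) x := by
  rw [inv_zpow']

theorem colour_inv (g : ℚ ≃o ℚ) (x : ℚ) : colour g⁻¹ x = (colour g x).swap := by
  have h : colour g⁻¹ x = cmp (g x) x := by
    unfold colour
    rw [← g.strictMono.cmp_map_eq x]
    simp
  rw [h, colour, cmp_swap]

theorem Hull.refl (g : ℚ ≃o ℚ) (x : ℚ) : Hull g x x := ⟨0, 0, le_rfl, le_rfl⟩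

theorem Hull.trans {g : ℚ ≃o ℚ} {x y z : ℚ} (h : Hull g x y) (h' : Hull g y z) : Hull g x z := by
  obtain ⟨i, j, h1, h2⟩ := h
  obtain ⟨k, l, h3, h4⟩ := h'
  refine ⟨k + i, l + j, ?_, ?_⟩
  · rw [zpow_add_apply]; exact ((g ^ k).monotone h1).trans h3
  · rw [zpow_add_apply]; exact h4.trans ((g ^ l).monotone h2)

theorem Hull.symm {g : ℚ ≃o ℚ} {x y : ℚ} (h : Hull g x y) : Hull g y x := by
  obtain ⟨i, j, h1, h2⟩ := h
  refine ⟨-j, -i, ?_, ?_⟩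
  · have := (g ^ (-j)).monotone h2
    rwa [zpow_neg_apply_zpow] at this
  · have := (g ^ (-i)).monotone h1
    rwa [zpow_neg_apply_zpow] at this

theorem Hull.zpow (g : ℚ ≃o ℚ) (x : ℚ) (i : ℤ) : Hull g x ((g ^ i) x) := ⟨i, i, le_rfl, le_rfl⟩

theorem Hull.apply (g : ℚ ≃o ℚ) (x : ℚ) : Hull g x (g x) := by simpa using Hull.zpow g x 1

theorem Hull.convex {g : ℚ ≃o ℚ} {x y z w : ℚ} (h : Hull g x y) (h' : Hull g x z)
    (h1 : y ≤ w) (h2 : w ≤ z) : Hull g x w := by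
  obtain ⟨i, -, h3, -⟩ := h
  obtain ⟨-, l, -, h4⟩ := h'
  exact ⟨i, l, h3.trans h1, h2.trans h4⟩

theorem Hull.inv {g : ℚ ≃o ℚ} {x y : ℚ} (h : Hull g⁻¹ x y) : Hull g x y := by
  obtain ⟨i, j, h1, h2⟩ := h
  exact ⟨-i, -j, by rwa [← zpow_inv_apply], by rwa [← zpow_inv_apply]⟩

theorem Hull.eq_of_fixed {g : ℚ ≃o ℚ} {x y : ℚ} (hx : g x = x) (h : Hull g x y) : y = x := by
  obtain ⟨i, j, h1, h2⟩ := h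
  rw [zpow_apply_of_fixed hx] at h1 h2
  exact le_antisymm h2 h1

/-- Bracket `y` between consecutive orbit points, `g ^ k x ≤ y < g ^ (k + 1) x`, and apply `g` to
the first inequality. -/
theorem Hull.lt_of_lt {g : ℚ ≃o ℚ} {x y : ℚ} (hx : x < g x) (h : Hull g x y) : y < g y := by
  obtain ⟨i, j, h1, h2⟩ := h
  have hb : ∃ b : ℤ, ∀ z : ℤ, (g ^ z) x ≤ y → z ≤ b :=
    ⟨j, fun z hz => (zpow_strictMono_apply hx).le_iff_le.1 (hz.trans h2)⟩
  obtain ⟨k, hk, hk'⟩ := Int.exists_greatest_of_bdd hb ⟨i, h1⟩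
  have h3 : y < (g ^ (k + 1)) x := by
    by_contra h
    have := hk' _ (not_lt.1 h)
    omega
  rw [zpow_succ_apply] at h3
  exact h3.trans_le (g.monotone hk)

/-- The downward case is the upward one for `g⁻¹`, which has the same hulls and the opposite
colours. -/
theorem Hull.colour_eq {g : ℚ ≃o ℚ} {x y : ℚ} (h : Hull g x y) : colour g y = colour g x := by
  rcases hx : colour g x with _ | _ | _
  · exact colour_eq_lt.2 (h.lt_of_lt (colour_eq_lt.1 hx))
  · rw [h.eq_of_fixed (colour_eq_eq.1 hx), hx]
  · have h1 : colour g⁻¹ x = .lt := by rw [colour_inv, hx]; rfl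
    have h2 : Hull g⁻¹ x y := Hull.inv (g := g⁻¹) (by rwa [inv_inv])
    have h3 := colour_eq_lt.2 (h2.lt_of_lt (colour_eq_lt.1 h1))
    rw [colour_inv] at h3
    rcases h4 : colour g y with _ | _ | _ <;> simp_all

/-- Distinct orbit hulls are separated. -/
theorem Hull.lt_of_not_hull {g : ℚ ≃o ℚ} {x x' y y' : ℚ} (hn : ¬ Hull g x x') (hlt : x < x')
    (h : Hull g x y) (h' : Hull g x' y') : y < y' := by
  by_contra hle
  rw [not_lt] at hle
  apply hn
  rcases le_total y' x with h1 | h1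
  · exact (Hull.convex h' (Hull.refl g x') h1 hlt.le).symm
  · exact (Hull.convex (Hull.refl g x) h h1 hle).trans h'.symm

/-- Every point of an orbit hull is a translate of a point of the fundamental interval. -/
theorem Hull.exists_zpow {g : ℚ ≃o ℚ} {x y : ℚ} (h : Hull g x y) :
    ∃ i : ℤ, ∃ u ∈ Set.uIcc x (g x), (g ^ i) u = y := by
  have key : ∀ f : ℚ ≃o ℚ, x < f x → Hull f x y → ∃ i : ℤ, ∃ u ∈ Set.Icc x (f x), (f ^ i) u = y := by
    rintro f hx ⟨i, j, h1, h2⟩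
    have hb : ∃ b : ℤ, ∀ z : ℤ, (f ^ z) x ≤ y → z ≤ b :=
      ⟨j, fun z hz => (zpow_strictMono_apply hx).le_iff_le.1 (hz.trans h2)⟩
    obtain ⟨k, hk, hk'⟩ := Int.exists_greatest_of_bdd hb ⟨i, h1⟩
    have h3 : y < (f ^ (k + 1)) x := by
      by_contra h
      have := hk' _ (not_lt.1 h)
      omega
    refine ⟨k, (f ^ (-k)) y, ⟨?_, ?_⟩, zpow_apply_zpow_neg _ _ _⟩
    · have := (f ^ (-k)).monotone hk
      rwa [zpow_neg_apply_zpow] at this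
    · rw [zpow_succ_apply'] at h3
      have := (f ^ (-k)).monotone h3.le
      rwa [zpow_neg_apply_zpow] at this
  rcases lt_trichotomy x (g x) with hx | hx | hx
  · rw [Set.uIcc_of_le hx.le]
    exact key g hx h
  · exact ⟨0, x, Set.left_mem_uIcc, (h.eq_of_fixed hx.symm).symm⟩
  · have h1 : x < g⁻¹ x := by
      have := g⁻¹.strictMono hx
      simpa using this
    obtain ⟨i, u, hu, hi⟩ := key g⁻¹ h1 (Hull.inv (g := g⁻¹) (by rwa [inv_inv]))
    refine ⟨-i - 1, g u, ?_, ?_⟩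
    · rw [Set.uIcc_of_ge hx.le]
      exact ⟨g.monotone hu.1, by simpa using g.monotone hu.2⟩
    · rw [← zpow_succ_apply', sub_add_cancel, ← zpow_inv_apply, hi]

theorem hull_of_mem_uIcc {g : ℚ ≃o ℚ} {x u : ℚ} (hu : u ∈ Set.uIcc x (g x)) : Hull g x u := by
  rcases Set.mem_uIcc.1 hu with h | h
  · exact Hull.convex (Hull.refl g x) (Hull.apply g x) h.1 h.2
  · exact Hull.convex (Hull.apply g x) (Hull.refl g x) h.1 h.2

/-- A finite set of points moved up by `g₁`, with the relation of `g₁` between them, embeds in the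
orbit hull of any point moved up by `g`. -/
theorem exists_chain_embedding (g₁ g : ℚ ≃o ℚ) {z : ℚ} (hz : z < g z) (S : Finset ℚ)
    (hS : ∀ x ∈ S, x < g₁ x) :
    ∃ β : ℚ → ℚ, StrictMonoOn β (S : Set ℚ) ∧
      (∀ x ∈ S, ∀ y ∈ S, cmp (g (β x)) (β y) = cmp (g₁ x) y) ∧
      ∀ x ∈ S, z ≤ β x ∧ ∃ j : ℤ, β x < (g ^ j) z := by
  classical
  induction S using Finset.induction_on_max with
  | empty => exact ⟨id, fun x hx => by simp at hx, by simp, by simp⟩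
  | insert a S ha ih =>
    obtain ⟨β, h1, h2, h3⟩ := ih fun x hx => hS x (Finset.mem_insert_of_mem hx)
    -- it suffices to choose the value at `a`
    suffices hb : ∃ b, (∀ s ∈ S, β s < b) ∧ (∀ y ∈ S, cmp (g (β y)) b = cmp (g₁ y) a) ∧ z ≤ b ∧
        ∃ j : ℤ, b < (g ^ j) z by
      obtain ⟨b, hb1, hb2, hb3, hb4⟩ := hb
      -- As `b` exceeds every `β s`, the inequality `b < g b` settles all comparisons that involve
      -- `g b`. Only those of `g (β y)` with `b` are real constraints.
      have hbg : b < g b := by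
        obtain ⟨j, hj⟩ := hb4
        exact Hull.lt_of_lt hz ⟨0, j, hb3, hj.le⟩
      have hag := hS a (Finset.mem_insert_self _ _)
      have hold : ∀ s ∈ S, Function.update β a b s = β s := fun s hs =>
        
        Function.update_of_ne (ne_of_lt (ha s hs)) _ _
      refine ⟨Function.update β a b, ?_, ?_, ?_⟩
      · intro x hx y hy hxy
        simp only [Finset.coe_insert, Set.mem_insert_iff, Finset.mem_coe] at hx hy
        rcases hx with rfl | hx <;> rcases hy with rfl | hy
        · exact absurd hxy (lt_irrefl _)
        · exact absurd hxy (ha y hy).not_gt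
        · rw [hold x hx, Function.update_self]; exact hb1 x hx
        · rw [hold x hx, hold y hy]; exact h1 hx hy hxy
      · intro x hx y hy
        rw [Finset.mem_insert] at hx hy
        rcases hx with rfl | hx <;> rcases hy with rfl | hy
        · rw [Function.update_self, hbg.cmp_eq_gt, hag.cmp_eq_gt]
        · rw [Function.update_self, hold y hy, ((hb1 y hy).trans hbg).cmp_eq_gt,
            ((ha y hy).trans hag).cmp_eq_gt]
        · rw [hold x hx, Function.update_self]; exact hb2 x hx
        · rw [hold x hx, hold y hy]; exact h2 x hx y hy
      · intro x hx
        rw [Finset.mem_insert] at hx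
        rcases hx with rfl | hx
        · rw [Function.update_self]; exact ⟨hb3, hb4⟩
        · rw [hold x hx]; exact h3 x hx
    -- If `a` is the image of an earlier point, its value is forced. Otherwise any point of a gap
    -- given by finitely many bounds will do, and density provides one.
    by_cases hy0 : ∃ y₀ ∈ S, g₁ y₀ = a
    · obtain ⟨y₀, hy0, rfl⟩ := hy0
      refine ⟨g (β y₀), ?_, ?_, ?_, ?_⟩
      · intro s hs
        have := h2 y₀ hy0 s hs
        rw [(ha s hs).cmp_eq_gt] at this
        exact (cmp_eq_gt_iff _ _).1 this
      · intro y hy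
        rw [g.strictMono.cmp_map_eq, g₁.strictMono.cmp_map_eq]
        exact h1.cmp_map_eq hy hy0
      · obtain ⟨h4, j, hj⟩ := h3 y₀ hy0
        exact h4.trans (Hull.lt_of_lt hz ⟨0, j, h4, hj.le⟩).le
      · obtain ⟨h4, j, hj⟩ := h3 y₀ hy0
        exact ⟨j + 1, by rw [zpow_succ_apply]; exact g.strictMono hj⟩
    · push Not at hy0
      -- a common upper bound in the orbit of `z`
      have hJ : ∃ J : ℤ, 0 < J ∧ ∀ s ∈ S, g (β s) < (g ^ J) z := by
        choose! j hj using fun x hx => (h3 x hx).2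
        refine ⟨∑ s ∈ S, |j s| + 2, by positivity, fun s hs => ?_⟩
        have h5 : j s + 1 ≤ ∑ s ∈ S, |j s| + 2 := by
          have := Finset.single_le_sum (f := fun s => |j s|) (fun i _ => abs_nonneg (j i)) hs
          have := le_abs_self (j s)
          omega
        refine lt_of_lt_of_le (g.strictMono (hj s hs)) ?_
        rw [← zpow_succ_apply]
        exact (zpow_strictMono_apply hz).monotone h5
      obtain ⟨J, hJ0, hJ⟩ := hJ
      have hβg : ∀ s ∈ S, β s < g (β s) := fun s hs => by
        obtain ⟨h4, j, hj⟩ := h3 s hs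
        exact Hull.lt_of_lt hz ⟨0, j, h4, hj.le⟩
      obtain ⟨b, hb1, hb2⟩ := Order.exists_between_finsets
        (insert z (S.image β ∪ (S.filter (fun y => g₁ y < a)).image (fun y => g (β y))))
        (insert ((g ^ J) z) ((S.filter (fun y => a < g₁ y)).image (fun y => g (β y)))) (by
          intro l hl u hu
          simp only [Finset.mem_insert, Finset.mem_union, Finset.mem_image,
            Finset.mem_filter] at hl hu
          rcases hu with rfl | ⟨y, ⟨hy, hya⟩, rfl⟩
          · rcases hl with rfl | ⟨s, hs, rfl⟩ | ⟨s, ⟨hs, -⟩, rfl⟩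
            · simpa using zpow_strictMono_apply hz hJ0
            · exact (hβg s hs).trans (hJ s hs)
            · exact hJ s hs
          · rcases hl with rfl | ⟨s, hs, rfl⟩ | ⟨s, ⟨hs, hsa⟩, rfl⟩
            · exact (h3 y hy).1.trans_lt (hβg y hy)
            · have := h2 y hy s hs
              rw [((ha s hs).trans hya).cmp_eq_gt] at this
              exact (cmp_eq_gt_iff _ _).1 this
            · exact g.strictMono (h1 hs hy (g₁.lt_iff_lt.1 (hsa.trans hya))))
      refine ⟨b, fun s hs => hb1 _ ?_, fun y hy => ?_, (hb1 z (by simp)).le, J, hb2 _ (by simp)⟩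
      · simp only [Finset.mem_insert, Finset.mem_union, Finset.mem_image]
        exact Or.inr (Or.inl ⟨s, hs, rfl⟩)
      · rcases lt_or_gt_of_ne (hy0 y hy) with h | h
        · rw [h.cmp_eq_lt]
          refine LT.lt.cmp_eq_lt (hb1 _ ?_)
          simp only [Finset.mem_insert, Finset.mem_union, Finset.mem_image, Finset.mem_filter]
          exact Or.inr (Or.inr ⟨y, ⟨hy, h⟩, rfl⟩)
        · rw [h.cmp_eq_gt]
          refine LT.lt.cmp_eq_gt (hb2 _ ?_)
          simp only [Finset.mem_insert, Finset.mem_image, Finset.mem_filter]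
          exact Or.inr ⟨y, ⟨hy, h⟩, rfl⟩

/-- Translation by one. -/
def shift : ℚ ≃o ℚ := OrderIso.addRight (1 : ℚ)

theorem shift_apply (x : ℚ) : shift x = x + 1 := rfl

/-- For chains contained in a finite set: the step from `l` to `l + 1` is available only inside the
window from `-N` to `N`. -/
theorem int_induction_of_abs_le {P : ℤ → Prop} {N : ℤ} (h0 : P 0)
    (h : ∀ l, -N ≤ l → l < N → (P l ↔ P (l + 1))) (l : ℤ) (hl : |l| ≤ N) : P l := by
  rw [abs_le] at hl
  obtain ⟨hl1, hl2⟩ := hl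
  induction l with
  | zero => exact h0
  | succ i ih => exact (h i (by omega) (by omega)).1 (ih (by omega) (by omega))
  | pred i ih =>
    have := h (-(i : ℤ) - 1) (by omega) (by omega)
    rw [sub_add_cancel] at this
    exact this.2 (ih (by omega) (by omega))

/-- The embedding of a set of points moved up by `g₁` can be chosen to respect the common part of `g₁`
and `g` which is generated from the fundamental interval of `z`. -/
theorem exists_chain_embedding_over (g₁ g : ℚ ≃o ℚ) {z : ℚ} (hz : z < g z) (hzz : g₁ z = g z)
    (S : Finset ℚ) (hzS : z ∈ S) (hS : ∀ x ∈ S, x < g₁ x) :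
    ∃ β : ℚ → ℚ, StrictMonoOn β (S : Set ℚ) ∧
      (∀ x ∈ S, ∀ y ∈ S, g₁ x = y → g (β x) = β y) ∧ (∀ x ∈ S, Hull g z (β x)) ∧
      ∀ w ∈ S, (∃ u ∈ Set.Icc z (g z), ∃ i : ℤ, (g₁ ^ i) u = w ∧ (g ^ i) u = w) → β w = w := by
  classical
  have hz₁ : z < g₁ z := hzz ▸ hz
  have hex : ∀ w : ℚ, ∃ u ∈ Set.Icc z (g z), ∃ i : ℤ,
      (∃ u ∈ Set.Icc z (g z), ∃ i : ℤ, (g₁ ^ i) u = w ∧ (g ^ i) u = w) →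
        (g₁ ^ i) u = w ∧ (g ^ i) u = w := by
    intro w
    by_cases h : ∃ u ∈ Set.Icc z (g z), ∃ i : ℤ, (g₁ ^ i) u = w ∧ (g ^ i) u = w
    · obtain ⟨u, hu, i, hi⟩ := h
      exact ⟨u, hu, i, fun _ => hi⟩
    · exact ⟨z, ⟨le_rfl, hz.le⟩, 0, fun h' => absurd h' h⟩
  choose u hu i hi using hex
  -- enlarge `S` by the chains that connect its points to the fundamental interval
  let S' : Finset ℚ := insert (g z) (S ∪ S.biUnion fun w =>
    (Finset.Icc (-|i w|) |i w|).image fun l => (g₁ ^ l) (u w))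
  have hSS' : S ⊆ S' := fun x hx => Finset.mem_insert_of_mem (Finset.mem_union_left _ hx)
  have hchain : ∀ w ∈ S, ∀ l : ℤ, |l| ≤ |i w| → (g₁ ^ l) (u w) ∈ S' := by
    intro w hw l hl
    refine Finset.mem_insert_of_mem (Finset.mem_union_right _ (Finset.mem_biUnion.2 ⟨w, hw, ?_⟩))
    exact Finset.mem_image_of_mem _ (Finset.mem_Icc.2 (abs_le.1 hl))
  have hS' : ∀ x ∈ S', x < g₁ x := by
    intro x hx
    simp only [S', Finset.mem_insert, Finset.mem_union, Finset.mem_biUnion, Finset.mem_image] at hx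
    rcases hx with rfl | hx | ⟨w, hw, l, -, rfl⟩
    · rw [← hzz]; exact g₁.strictMono hz₁
    · exact hS x hx
    · refine Hull.lt_of_lt hz₁ (Hull.trans (hull_of_mem_uIcc ?_) (Hull.zpow g₁ (u w) l))
      rw [hzz, Set.uIcc_of_le hz.le]
      exact hu w
  -- Translation by one serves as a model. On `S'` the map `τ` turns `g₁` into translation, with `τ
  -- z = 0` and `τ (g z) = 1`; the map `θ` below turns translation into `g`.
  obtain ⟨β₀, hmono, hcmp, -⟩ := exists_chain_embedding g₁ shift (z := 0) (by simp [shift_apply]) S' hS'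
  obtain ⟨α, hα⟩ := exists_orderIso_extending S' β₀ hmono
  let τ : ℚ ≃o ℚ := α.trans (OrderIso.addRight (-(α z)))
  have hτz : τ z = 0 := add_neg_cancel _
  have hτ : ∀ x ∈ S', ∀ y ∈ S', g₁ x = y → τ y = τ x + 1 := by
    intro x hx y hy hxy
    have h1 := hcmp x hx y hy
    rw [cmp_eq_eq_iff _ _ |>.2 hxy, cmp_eq_eq_iff, ← hα x hx, ← hα y hy, shift_apply] at h1
    change α y + -(α z) = α x + -(α z) + 1
    rw [← h1]; ring
  have hτgz : τ (g z) = 1 := by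
    rw [hτ z (hSS' hzS) (g z) (Finset.mem_insert_self _ _) hzz, hτz, zero_add]
  -- Inverse to `τ` on the fundamental interval and continued equivariantly. Hence `θ ∘ τ` fixes
  -- that interval, and also every `w` reached from it by equal powers of `g₁` and `g`, because the
  -- chain leading to `w` lies in `S'`.
  let θ : ℚ → ℚ := fun t => (g ^ ⌊t⌋) (τ.symm (Int.fract t))
  have hfr : ∀ t, z ≤ τ.symm (Int.fract t) ∧ τ.symm (Int.fract t) < g z := by
    intro t
    constructor
    · rw [OrderIso.le_symm_apply, hτz]; exact Int.fract_nonneg t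
    · rw [OrderIso.symm_apply_lt, hτgz]; exact Int.fract_lt_one t
  have hθmono : StrictMono θ := by
    intro t t' htt
    rcases (Int.floor_mono htt.le).eq_or_lt with h | h
    · change (g ^ ⌊t⌋) _ < (g ^ ⌊t'⌋) _
      rw [h]
      refine (g ^ _).strictMono (τ.symm.strictMono ?_)
      have h1 := Int.floor_add_fract t
      have h2 := Int.floor_add_fract t'
      rw [h] at h1
      linarith
    · calc θ t < (g ^ ⌊t⌋) (g z) := (g ^ _).strictMono (hfr t).2
        _ = (g ^ (⌊t⌋ + 1)) z := (zpow_succ_apply' _ _ _).symm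
        _ ≤ (g ^ ⌊t'⌋) z := (zpow_strictMono_apply hz).monotone h
        _ ≤ θ t' := (g ^ _).monotone (hfr t').1
  have hθ1 : ∀ t, θ (t + 1) = g (θ t) := by
    intro t
    change (g ^ ⌊t + 1⌋) (τ.symm (Int.fract (t + 1))) = g ((g ^ ⌊t⌋) _)
    rw [Int.floor_add_one, Int.fract_add_one, zpow_succ_apply]
  have hθi : ∀ (t : ℚ) (l : ℤ), θ (t + l) = (g ^ l) (θ t) := by
    intro t l
    change (g ^ ⌊t + l⌋) (τ.symm (Int.fract (t + l))) = (g ^ l) ((g ^ ⌊t⌋) _)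
    rw [Int.floor_add_intCast, Int.fract_add_intCast, add_comm, zpow_add_apply]
  have hθfix : ∀ v ∈ Set.Icc z (g z), θ (τ v) = v := by
    rintro v ⟨hv1, hv2⟩
    rcases hv2.eq_or_lt with rfl | hv2
    · have h0 : θ 0 = z := by
        change (g ^ ⌊(0 : ℚ)⌋) (τ.symm (Int.fract 0)) = z
        rw [Int.floor_zero, Int.fract_zero, zpow_zero, ← hτz, τ.symm_apply_apply]; rfl
      rw [hτgz, ← zero_add (1 : ℚ), hθ1, h0]
    · have h1 : 0 ≤ τ v := hτz ▸ τ.monotone hv1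
      have h2 : τ v < 1 := hτgz ▸ τ.strictMono hv2
      change (g ^ ⌊τ v⌋) (τ.symm (Int.fract (τ v))) = v
      rw [Int.floor_eq_zero_iff.2 ⟨h1, h2⟩, Int.fract_eq_self.2 ⟨h1, h2⟩, zpow_zero,
        τ.symm_apply_apply]; rfl
  refine ⟨fun x => θ (τ x), fun x _ y _ hxy => hθmono (τ.strictMono hxy), ?_, ?_, ?_⟩
  · intro x hx y hy hxy
    change g (θ (τ x)) = θ (τ y)
    rw [hτ x (hSS' hx) y (hSS' hy) hxy, hθ1]
  · intro x _
    refine Hull.trans (Hull.convex (Hull.refl g z) (Hull.apply g z) (hfr (τ x)).1 (hfr (τ x)).2.le)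
      (Hull.zpow g _ _)
  · intro w hw hw'
    obtain ⟨h1, h2⟩ := hi w hw'
    have h3 : τ ((g₁ ^ i w) (u w)) = τ (u w) + i w := by
      refine int_induction_of_abs_le (P := fun l => τ ((g₁ ^ l) (u w)) = τ (u w) + l) (N := |i w|)
        (by simp) ?_ (i w) le_rfl
      intro l hl1 hl2
      rw [hτ _ (hchain w hw l (abs_le.2 ⟨hl1, hl2.le⟩)) _
        (hchain w hw (l + 1) (abs_le.2 ⟨by omega, by omega⟩)) (zpow_succ_apply _ _ _).symm]
      push_cast
      constructor <;> intro h <;> linarith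
    rw [h1] at h3
    change θ (τ w) = w
    rw [h3, hθi, hθfix _ (hu w), h2]

end Rationals

/-! ### Runs of equal colour and the embedding theorem -/

section Rationals

/-- A finite set of points moved in one direction by `g₁` embeds in any orbit hull of `g` with the
same colour, respecting the part generated from a common fundamental interval. -/
theorem exists_block_embedding (g₁ g : ℚ ≃o ℚ) (B : Finset ℚ) {s : Ordering} (hs : s ≠ .eq)
    (hB : ∀ x ∈ B, colour g₁ x = s) {z : ℚ} (hz : colour g z = s) :
    ∃ f : ℚ → ℚ, StrictMonoOn f (↑(B ∪ B.image g₁) : Set ℚ) ∧ (∀ x ∈ B, g (f x) = f (g₁ x)) ∧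
      (∀ w ∈ B ∪ B.image g₁, Hull g z (f w)) ∧
      (z ∈ B → g₁ z = g z → ∀ w ∈ B ∪ B.image g₁,
        (∃ u ∈ Set.uIcc z (g z), ∃ i : ℤ, (g₁ ^ i) u = w ∧ (g ^ i) u = w) → f w = w) := by
  classical
  have hT : ∀ x ∈ B ∪ B.image g₁, colour g₁ x = s := by
    intro x hx
    rcases Finset.mem_union.1 hx with hx | hx
    · exact hB x hx
    · obtain ⟨y, hy, rfl⟩ := Finset.mem_image.1 hx
      rw [colour_apply]; exact hB y hy
  have hl : ∀ x ∈ B, x ∈ B ∪ B.image g₁ := fun x hx => Finset.mem_union_left _ hx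
  have hr : ∀ x ∈ B, g₁ x ∈ B ∪ B.image g₁ := fun x hx =>
    Finset.mem_union_right _ (Finset.mem_image_of_mem _ hx)
  rcases s with _ | _ | _
  · have hz' := colour_eq_lt.1 hz
    have hT' : ∀ x ∈ B ∪ B.image g₁, x < g₁ x := fun x hx => colour_eq_lt.1 (hT x hx)
    by_cases hc : z ∈ B ∧ g₁ z = g z
    · obtain ⟨f, h1, h2, h3, h4⟩ :=
        exists_chain_embedding_over g₁ g hz' hc.2 _ (hl z hc.1) hT'
      refine ⟨f, h1, fun x hx => h2 _ (hl x hx) _ (hr x hx) rfl, h3, fun _ _ w hw h => h4 w hw ?_⟩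
      rwa [Set.uIcc_of_le hz'.le] at h
    · obtain ⟨f, h1, h2, h3⟩ := exists_chain_embedding g₁ g hz' _ hT'
      refine ⟨f, h1, fun x hx => ?_, fun w hw => ?_, fun ha hb => absurd ⟨ha, hb⟩ hc⟩
      · have := h2 _ (hl x hx) _ (hr x hx)
        rwa [cmp_self_eq_eq, cmp_eq_eq_iff] at this
      · obtain ⟨h4, j, hj⟩ := h3 w hw
        exact ⟨0, j, h4, hj.le⟩
  · exact absurd rfl hs
  -- Points moved down are moved up by the inverses. The base point becomes `g z`, so that the
  -- fundamental interval of `g⁻¹` at it is the same interval.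
  · have hz' := colour_eq_gt.1 hz
    have hT' : ∀ x ∈ B ∪ B.image g₁, x < g₁⁻¹ x := fun x hx => by
      rw [← colour_eq_lt, colour_inv, hT x hx]; rfl
    have hzi : ∀ w, Hull g⁻¹ (g z) w → Hull g z w := fun w hw => (Hull.apply g z).trans hw.inv
    have hg₁ : ∀ x, g₁⁻¹ (g₁ x) = x := fun x => g₁.symm_apply_apply x
    have hg : ∀ x, g⁻¹ (g x) = x := fun x => g.symm_apply_apply x
    have hzz : g z < g⁻¹ (g z) := by rwa [hg]
    have hfin : ∀ f : ℚ → ℚ, (∀ x ∈ B, g⁻¹ (f (g₁ x)) = f x) → ∀ x ∈ B, g (f x) = f (g₁ x) := by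
      intro f hf x hx
      rw [← hf x hx]; exact g.apply_symm_apply _
    by_cases hc : z ∈ B ∧ g₁ z = g z
    · obtain ⟨f, h1, h2, h3, h4⟩ :=
        exists_chain_embedding_over g₁⁻¹ g⁻¹ hzz (by rw [hg, ← hc.2, hg₁]) _
          (hc.2 ▸ hr z hc.1) hT'
      refine ⟨f, h1, hfin f fun x hx => h2 _ (hr x hx) _ (hl x hx) (hg₁ x),
        fun w hw => hzi _ (h3 w hw), fun _ _ w hw ⟨u, hu, i, h5, h6⟩ => h4 w hw ?_⟩
      rw [Set.uIcc_of_ge hz'.le] at hu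
      exact ⟨u, by rwa [hg], -i, by rwa [zpow_inv_apply, neg_neg], by rwa [zpow_inv_apply, neg_neg]⟩
    · obtain ⟨f, h1, h2, h3⟩ := exists_chain_embedding g₁⁻¹ g⁻¹ hzz _ hT'
      refine ⟨f, h1, hfin f fun x hx => ?_, fun w hw => hzi _ ?_, fun ha hb => absurd ⟨ha, hb⟩ hc⟩
      · have := h2 _ (hr x hx) _ (hl x hx)
        rwa [hg₁, cmp_self_eq_eq, cmp_eq_eq_iff] at this
      · obtain ⟨h4, j, hj⟩ := h3 w hw
        exact ⟨0, j, h4, hj.le⟩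

/-- `x` and `y` lie in the same run of the finite set `D`: they are equal, or no point of `D` between
them has a different colour, and this colour is not that of a fixed point. -/
def Run (g : ℚ ≃o ℚ) (D : Finset ℚ) (x y : ℚ) : Prop :=
  x = y ∨ (colour g x ≠ .eq ∧ ∀ w ∈ D, w ∈ Set.uIcc x y → colour g w = colour g x)

namespace Run

variable {g : ℚ ≃o ℚ} {D : Finset ℚ} {x y z x' y' : ℚ}

theorem colour_eq (hy : y ∈ D) (h : Run g D x y) : colour g y = colour g x := by
  rcases h with rfl | ⟨-, h⟩
  · rfl
  · exact h y hy Set.right_mem_uIcc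

theorem symm (hy : y ∈ D) (h : Run g D x y) : Run g D y x := by
  have h' := colour_eq hy h
  rcases h with rfl | ⟨h1, h2⟩
  · exact Or.inl rfl
  · refine Or.inr ⟨h' ▸ h1, fun w hw hw' => ?_⟩
    rw [h']; exact h2 w hw (Set.uIcc_comm x y ▸ hw')

theorem trans (hy : y ∈ D) (h : Run g D x y) (h' : Run g D y z) : Run g D x z := by
  have hc := colour_eq hy h
  rcases h with rfl | ⟨h1, h2⟩
  · exact h'
  rcases h' with rfl | ⟨h3, h4⟩
  · exact Or.inr ⟨h1, h2⟩
  · refine Or.inr ⟨h1, fun w hw hw' => ?_⟩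
    rcases Set.uIcc_subset_uIcc_union_uIcc (b := y) hw' with h | h
    · exact h2 w hw h
    · rw [h4 w hw h, hc]

/-- Colour is constant on a hull and hulls are convex, so a hull never crosses from one run to
another, whatever `D` is. -/
theorem of_hull (h : Hull g x y) : Run g D x y := by
  by_cases hx : colour g x = .eq
  · exact Or.inl (h.eq_of_fixed (colour_eq_eq.1 hx)).symm
  · refine Or.inr ⟨hx, fun w _ hw => Hull.colour_eq ?_⟩
    rcases Set.mem_uIcc.1 hw with hw | hw
    · exact Hull.convex (Hull.refl g x) h hw.1 hw.2
    · exact Hull.convex h (Hull.refl g x) hw.1 hw.2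

/-- Runs are convex, hence linearly ordered. -/
theorem lt_of_not_run (hx : x ∈ D) (hy : y ∈ D)
    (hn : ¬ Run g D x x') (hlt : x < x') (h : Run g D x y) (h' : Run g D x' y') : y < y' := by
  by_contra hle
  rw [not_lt] at hle
  apply hn
  rcases h with rfl | ⟨h1, h2⟩
  · rcases h' with rfl | ⟨h3, h4⟩
    · exact absurd hlt hle.not_gt
    · have h5 := h4 x hx (Set.mem_uIcc.2 (Or.inr ⟨hle, hlt.le⟩))
      refine Or.inr ⟨h5 ▸ h3, fun w hw hw' => ?_⟩
      rw [Set.uIcc_of_le hlt.le] at hw'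
      rw [h5]
      exact h4 w hw (Set.mem_uIcc.2 (Or.inr ⟨hle.trans hw'.1, hw'.2⟩))
  · rcases le_or_gt x' y with hy' | hy'
    · refine Or.inr ⟨h1, fun w hw hw' => h2 w hw ?_⟩
      rw [Set.uIcc_of_le hlt.le] at hw'
      exact Set.mem_uIcc.2 (Or.inl ⟨hw'.1, hw'.2.trans hy'⟩)
    · rcases h' with rfl | ⟨h3, h4⟩
      · exact absurd hy' hle.not_gt
      · have h5 := h4 y hy (Set.mem_uIcc.2 (Or.inr ⟨hle, hy'.le⟩))
        have h6 := h2 y hy Set.right_mem_uIcc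
        refine Or.inr ⟨h1, fun w hw hw' => ?_⟩
        rw [Set.uIcc_of_le hlt.le] at hw'
        rcases le_or_gt w y with hwy | hwy
        · exact h2 w hw (Set.mem_uIcc.2 (Or.inl ⟨hw'.1, hwy⟩))
        · rw [← h6, h5]
          exact h4 w hw (Set.mem_uIcc.2 (Or.inr ⟨hle.trans hwy.le, hw'.2⟩))

end Run

/-- The embedding theorem: a colour preserving weakly monotone map `e` from the finite set `D` guides
an embedding of the graph of `g₁` on `D` in the graph of `g`. A part `K` of `D` on which `g₁` and `g`
agree, generated from the fundamental intervals of the points of `Z`, can be kept fixed. -/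
theorem exists_embedding_of_colour_map (g₁ g : ℚ ≃o ℚ) (D K Z : Finset ℚ) (e : ℚ → ℚ)
    (hmono : ∀ x ∈ D, ∀ y ∈ D, x < y → e x ≤ e y)
    (hcol : ∀ x ∈ D, colour g (e x) = colour g₁ x)
    (hfix : ∀ x ∈ D, ∀ y ∈ D, x < y → colour g₁ x = .eq → colour g₁ y = .eq → e x < e y)
    (hK : K ⊆ D) (hZ : Z ⊆ K) (hagree : ∀ z ∈ Z, g₁ z = g z)
    (hlink : ∀ d ∈ K, ∃ z ∈ Z, ∃ u ∈ Set.uIcc z (g z), ∃ i : ℤ, (g₁ ^ i) u = d ∧ (g ^ i) u = d)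
    (hred : ∀ z ∈ Z, ∀ z' ∈ Z, z < z' → colour g₁ z' = colour g₁ z → colour g₁ z ≠ .eq →
      ∃ w ∈ Z, z < w ∧ w < z' ∧ colour g₁ w ≠ colour g₁ z)
    (he : ∀ z ∈ Z, Hull g z (e z)) :
    ∃ β : ℚ → ℚ, StrictMonoOn β (↑(D ∪ D.image g₁) : Set ℚ) ∧ (∀ x ∈ D, g (β x) = β (g₁ x)) ∧
      (∀ d ∈ K, β d = d) ∧ ∀ x ∈ D, ∃ b ∈ D, Run g₁ D x b ∧ Hull g (e b) (β x) := by
  classical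
  -- points in different runs have images with separated orbit hulls
  have hsep : ∀ b ∈ D, ∀ b' ∈ D, b < b' → ¬ Run g₁ D b b' →
      e b < e b' ∧ ¬ Hull g (e b) (e b') := by
    intro b hb b' hb' hlt hn
    suffices h : ¬ Hull g (e b) (e b') from
      ⟨(hmono b hb b' hb' hlt).lt_of_ne fun h' => h (h' ▸ Hull.refl g _), h⟩
    intro hh
    by_cases hbe : colour g₁ b = .eq
    · by_cases hbe' : colour g₁ b' = .eq
      · have := hh.eq_of_fixed (colour_eq_eq.1 ((hcol b hb).trans hbe))
        exact absurd this (hfix b hb b' hb' hlt hbe hbe').ne'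
      · have := hh.colour_eq
        rw [hcol b hb, hcol b' hb', hbe] at this
        exact hbe' this
    -- A point of `D` of another colour lies between `b` and `b'`. If the images of `b` and `b'`
    -- shared a hull, its image would lie in that hull too, with the wrong colour.
    · have : ∃ w ∈ D, w ∈ Set.uIcc b b' ∧ colour g₁ w ≠ colour g₁ b := by
        by_contra hc
        push Not at hc
        exact hn (Or.inr ⟨hbe, hc⟩)
      obtain ⟨w, hw, hwb, hwc⟩ := this
      rw [Set.uIcc_of_le hlt.le] at hwb
      have hle : ∀ x ∈ D, ∀ y ∈ D, x ≤ y → e x ≤ e y := fun x hx y hy hxy => by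
        rcases hxy.eq_or_lt with rfl | h
        · exact le_rfl
        · exact hmono x hx y hy h
      have := (Hull.convex (Hull.refl g _) hh (hle b hb w hw hwb.1) (hle w hw b' hb' hwb.2)).colour_eq
      rw [hcol w hw, hcol b hb] at this
      exact hwc this
  -- A run may meet several hulls of `g₁`, yet it is sent into a single hull of `g`: only the
  -- direction of motion matters there. The runs are embedded separately, and `hsep` keeps their
  -- images in order.
  let B : ℚ → Finset ℚ := fun x => D.filter (Run g₁ D x)
  have hB : ∀ x y, y ∈ B x ↔ y ∈ D ∧ Run g₁ D x y := fun x y => Finset.mem_filter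
  have hBeq : ∀ x ∈ D, ∀ y ∈ D, Run g₁ D x y → B x = B y := by
    intro x hx y hy hxy
    ext w
    rw [hB, hB]
    exact ⟨fun h => ⟨h.1, Run.trans hx (hxy.symm hy) h.2⟩, fun h => ⟨h.1, hxy.trans hy h.2⟩⟩
  have hZrun : ∀ z ∈ Z, ∀ z' ∈ Z, Run g₁ D z z' → z = z' := by
    have key : ∀ z ∈ Z, ∀ z' ∈ Z, Run g₁ D z z' → ¬ z < z' := by
      intro z hz z' hz' hr hlt
      have hc := hr.colour_eq (hK (hZ hz'))
      rcases hr with rfl | ⟨h1, h2⟩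
      · exact lt_irrefl _ hlt
      · obtain ⟨w, hw, h3, h4, h5⟩ := hred z hz z' hz' hlt hc h1
        exact h5 (h2 w (hK (hZ hw)) (Set.mem_uIcc.2 (Or.inl ⟨h3.le, h4.le⟩)))
    intro z hz z' hz' hr
    exact le_antisymm (not_lt.1 (key z' hz' z hz (hr.symm (hK (hZ hz'))))) (not_lt.1 (key z hz z' hz' hr))
  have hhull : ∀ z ∈ Z, ∀ u ∈ Set.uIcc z (g z), ∀ i : ℤ, Hull g₁ z ((g₁ ^ i) u) := by
    intro z hz u hu i
    rw [← hagree z hz] at hu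
    exact (hull_of_mem_uIcc hu).trans (Hull.zpow g₁ u i)
  -- the embedding of a single run
  have hblock : ∀ A : Finset ℚ, ∃ f : ℚ → ℚ, (∃ x ∈ D, A = B x) → ∃ b ∈ A,
      StrictMonoOn f (↑(A ∪ A.image g₁) : Set ℚ) ∧ (∀ x ∈ A, g (f x) = f (g₁ x)) ∧
      (∀ w ∈ A ∪ A.image g₁, Hull g (e b) (f w)) ∧ ∀ d ∈ K, d ∈ A → f d = d := by
    intro A
    by_cases hA : ∃ x ∈ D, A = B x
    swap
    · exact ⟨id, fun h => absurd h hA⟩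
    obtain ⟨x, hx, rfl⟩ := hA
    have hxB : x ∈ B x := (hB x x).2 ⟨hx, Or.inl rfl⟩
    have hcB : ∀ y ∈ B x, colour g₁ y = colour g₁ x := fun y hy =>
      ((hB x y).1 hy).2.colour_eq ((hB x y).1 hy).1
    by_cases hs : colour g₁ x = .eq
    · have hxf := colour_eq_eq.1 hs
      have hBx : B x = {x} := by
        ext y
        rw [hB, Finset.mem_singleton]
        refine ⟨fun h => ?_, fun h => by rw [h]; exact ⟨hx, Or.inl rfl⟩⟩
        rcases h.2 with h' | h'
        · exact h'.symm
        · exact absurd hs h'.1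
      have hef : g (e x) = e x := colour_eq_eq.1 ((hcol x hx).trans hs)
      refine ⟨fun _ => e x, fun _ => ⟨x, hxB, ?_, fun _ _ => hef, fun _ _ => Hull.refl _ _, ?_⟩⟩
      · rw [hBx, Finset.image_singleton, hxf, Finset.union_idempotent, Finset.coe_singleton]
        exact Set.strictMonoOn_singleton _
      · intro d hd hdB
        rw [hBx, Finset.mem_singleton] at hdB
        subst hdB
        obtain ⟨z, hz, u, hu, i, h1, h2⟩ := hlink d hd
        have h3 := (hhull z hz u hu i)
        rw [h1] at h3
        have h4 : z = d := (h3.symm).eq_of_fixed hxf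
        subst h4
        exact (((he z hz).symm).eq_of_fixed hef).symm
    -- A run through `z ∈ Z` goes into the hull of `z`, which by `he` is also that of `e z`, and
    -- there its part in `K` can stay fixed. A run without a point of `Z` contains no point of `K`,
    -- since links stay inside hulls.
    · by_cases hz : ∃ z ∈ Z, z ∈ B x
      · obtain ⟨z, hz, hzB⟩ := hz
        have hzD := ((hB x z).1 hzB).1
        have hzc : colour g z = colour g₁ x := by
          rw [← hcB z hzB, colour, colour, hagree z hz]
        obtain ⟨f, h1, h2, h3, h4⟩ := exists_block_embedding g₁ g (B x) hs hcB hzc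
        refine ⟨f, fun _ => ⟨z, hzB, h1, h2, fun w hw => (he z hz).symm.trans (h3 w hw), ?_⟩⟩
        intro d hd hdB
        obtain ⟨z', hz', u, hu, i, h5, h6⟩ := hlink d hd
        have h7 := hhull z' hz' u hu i
        rw [h5] at h7
        have hzz : z = z' := hZrun z hz z' hz' ((((hB x z).1 hzB).2.symm hzD).trans hx
          (((hB x d).1 hdB).2.trans (hK hd) (Run.of_hull h7.symm)))
        subst hzz
        exact h4 hzB (hagree z hz) d (Finset.mem_union_left _ hdB) ⟨u, hu, i, h5, h6⟩
      · obtain ⟨f, h1, h2, h3, -⟩ := exists_block_embedding g₁ g (B x) hs hcB (z := e x) (hcol x hx)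
        refine ⟨f, fun _ => ⟨x, hxB, h1, h2, h3, fun d hd hdB => absurd ?_ hz⟩⟩
        obtain ⟨z', hz', u, hu, i, h5, h6⟩ := hlink d hd
        have h7 := hhull z' hz' u hu i
        rw [h5] at h7
        exact ⟨z', hz', (hB x z').2 ⟨hK (hZ hz'),
          ((hB x d).1 hdB).2.trans (hK hd) (Run.of_hull h7.symm)⟩⟩
  -- The choice depends on the run as a set, so all points of a run receive the same embedding.
  choose blk hblk using hblock
  -- the run to which a point of the domain or the range belongs
  let X : ℚ → ℚ := fun w => if w ∈ D then w else g₁⁻¹ w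
  have hX : ∀ w ∈ D ∪ D.image g₁, X w ∈ D ∧ (w = X w ∨ w = g₁ (X w)) := by
    intro w hw
    by_cases hwD : w ∈ D
    · simp [X, hwD]
    · rcases Finset.mem_union.1 hw with h | h
      · exact absurd h hwD
      · obtain ⟨y, hy, rfl⟩ := Finset.mem_image.1 h
        simp [X, hwD, hy]
  have hXD : ∀ w ∈ D, X w = w := fun w hw => by simp [X, hw]
  have hmem : ∀ x ∈ D, ∀ w, w = x ∨ w = g₁ x → w ∈ B x ∪ (B x).image g₁ := by
    rintro x hx w (rfl | rfl)
    · exact Finset.mem_union_left _ ((hB w w).2 ⟨hx, Or.inl rfl⟩)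
    · exact Finset.mem_union_right _ (Finset.mem_image_of_mem _ ((hB x x).2 ⟨hx, Or.inl rfl⟩))
  refine ⟨fun w => blk (B (X w)) w, ?_, ?_, ?_, ?_⟩
  · intro w hw w' hw' hlt
    obtain ⟨hx, hxw⟩ := hX w hw
    obtain ⟨hx', hxw'⟩ := hX w' hw'
    obtain ⟨b, hb, h1, -, h3, -⟩ := hblk (B (X w)) ⟨_, hx, rfl⟩
    obtain ⟨b', hb', -, -, h3', -⟩ := hblk (B (X w')) ⟨_, hx', rfl⟩
    change blk (B (X w)) w < blk (B (X w')) w'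
    by_cases hr : Run g₁ D (X w) (X w')
    · have heq := hBeq _ hx _ hx' hr
      rw [← heq]
      refine h1 (hmem _ hx w hxw) ?_ hlt
      rw [heq]
      exact hmem _ hx' w' hxw'
    · have hxx : X w < X w' := by
        by_contra hle
        rcases (not_lt.1 hle).eq_or_lt with h | h
        · exact hr (Or.inl h.symm)
        · have hr' : ¬ Hull g₁ (X w') (X w) := fun h' => hr ((Run.of_hull h').symm hx)
          have hh : ∀ v x, v = x ∨ v = g₁ x → Hull g₁ x v := by
            rintro v x (rfl | rfl)
            · exact Hull.refl _ _
            · exact Hull.apply _ _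
          exact absurd hlt (Hull.lt_of_not_hull hr' h (hh _ _ hxw') (hh _ _ hxw)).not_gt
      rw [hB] at hb hb'
      have hbb := Run.lt_of_not_run hx hb.1 hr hxx hb.2 hb'.2
      have hnb : ¬ Run g₁ D b b' := fun h =>
        hr ((hb.2.trans hb.1 h).trans hb'.1 (hb'.2.symm hb'.1))
      obtain ⟨h5, h6⟩ := hsep b hb.1 b' hb'.1 hbb hnb
      exact Hull.lt_of_not_hull h6 h5 (h3 w (hmem _ hx w hxw)) (h3' w' (hmem _ hx' w' hxw'))
  · intro x hx
    change g (blk (B (X x)) x) = blk (B (X (g₁ x))) (g₁ x)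
    have heq : B (X (g₁ x)) = B x := by
      by_cases hgx : g₁ x ∈ D
      · rw [hXD _ hgx]
        exact (hBeq x hx _ hgx (Run.of_hull (Hull.apply g₁ x))).symm
      · simp [X, hgx]
    obtain ⟨b, hb, -, h2, -⟩ := hblk (B x) ⟨_, hx, rfl⟩
    rw [heq, hXD x hx]
    exact h2 x ((hB x x).2 ⟨hx, Or.inl rfl⟩)
  · intro d hd
    change blk (B (X d)) d = d
    have hdD := hK hd
    obtain ⟨b, hb, -, -, -, h4⟩ := hblk (B d) ⟨_, hdD, rfl⟩
    rw [hXD d hdD]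
    exact h4 d hd ((hB d d).2 ⟨hdD, Or.inl rfl⟩)
  · intro x hx
    change ∃ b ∈ D, Run g₁ D x b ∧ Hull g (e b) (blk (B (X x)) x)
    obtain ⟨b, hb, -, -, h3, -⟩ := hblk (B x) ⟨_, hx, rfl⟩
    rw [hXD x hx]
    exact ⟨b, ((hB x b).1 hb).1, ((hB x b).1 hb).2, h3 x (hmem x hx x (Or.inl rfl))⟩

end Rationals

/-! ### Colour words: cutting ℚ into homogeneous pieces -/

section Words

variable {κ : Type}

/-- The word `w` is read off along some strictly increasing sequence in `X`. -/
def Realizes (c : ℚ → κ) : Set ℚ → List κ → Prop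
  | _, [] => True
  | X, a :: w => ∃ x ∈ X, c x = a ∧ Realizes c (X ∩ Set.Ioi x) w

/-- Every word in the colours of `X` is realized in `X`. -/
def Homogeneous (c : ℚ → κ) (X : Set ℚ) : Prop :=
  ∀ w : List κ, (∀ a ∈ w, a ∈ c '' X) → Realizes c X w

/-- A piece is a set which has at most one point or is homogeneous. -/
def IsPiece (c : ℚ → κ) (X : Set ℚ) : Prop := X.Subsingleton ∨ Homogeneous c X

/-- `t` cuts `X` in at most `m` pieces. -/
def CutsInto (c : ℚ → κ) (X : Set ℚ) (m : ℕ) (t : ℚ → ℕ) : Prop :=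
  MonotoneOn t X ∧ (∀ x ∈ X, t x < m) ∧ ∀ i < m, IsPiece c (X ∩ t ⁻¹' {i})

/-- `X` can be cut in finitely many pieces. -/
def Cuttable (c : ℚ → κ) (X : Set ℚ) : Prop := ∃ m t, CutsInto c X m t

theorem Realizes.mono {c : ℚ → κ} {w : List κ} : ∀ {X Y : Set ℚ}, X ⊆ Y → Realizes c X w →
    Realizes c Y w := by
  induction w with
  | nil => intros; trivial
  | cons a w ih =>
    rintro X Y h ⟨x, hx, hc, hw⟩
    exact ⟨x, h hx, hc, ih (Set.inter_subset_inter_left _ h) hw⟩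

/-- Lets successive blocks of a long word be found in successive parts of the set. -/
theorem Realizes.append {c : ℚ → κ} {v w : List κ} : ∀ {X : Set ℚ}, Realizes c X (v ++ w) →
    ∃ b, Realizes c (X ∩ Set.Iic b) v ∧ Realizes c (X ∩ Set.Ioi b) w := by
  induction v with
  | nil =>
    intro X h
    cases w with
    | nil => exact ⟨0, trivial, trivial⟩
    | cons a w =>
      obtain ⟨x, hx, hc, hw⟩ := h
      refine ⟨x - 1, trivial, x, ⟨hx, by simp⟩, hc, hw.mono ?_⟩
      rintro y ⟨hy, hxy⟩
      have : x < y := hxy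
      exact ⟨⟨hy, show x - 1 < y by linarith⟩, hxy⟩
  | cons a v ih =>
    rintro X ⟨x, hx, hc, hw⟩
    obtain ⟨b, h1, h2⟩ := ih hw
    rcases le_or_gt x b with hxb | hxb
    · exact ⟨b, ⟨x, ⟨hx, hxb⟩, hc, h1.mono fun y hy => ⟨⟨hy.1.1, hy.2⟩, hy.1.2⟩⟩,
        h2.mono fun y hy => ⟨hy.1.1, hy.2⟩⟩
    · refine ⟨x, ⟨x, ⟨hx, Set.mem_Iic.2 le_rfl⟩, hc, h1.mono fun y hy => ?_⟩,
        h2.mono fun y hy => ⟨hy.1.1, hy.1.2⟩⟩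
      exact absurd (lt_of_lt_of_le hy.1.2 hy.2) hxb.not_gt

theorem Realizes.exists_of_mem {c : ℚ → κ} {w : List κ} : ∀ {X : Set ℚ}, Realizes c X w →
    ∀ a ∈ w, ∃ x ∈ X, c x = a := by
  induction w with
  | nil => simp
  | cons b w ih =>
    rintro X ⟨x, hx, hc, hw⟩ a ha
    rcases List.mem_cons.1 ha with rfl | ha
    · exact ⟨x, hx, hc⟩
    · obtain ⟨y, hy, hyc⟩ := ih hw a ha
      exact ⟨y, hy.1, hyc⟩

/-- No new words arise, so `X` already realizes them all. This is the criterion for merging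
neighbouring pieces. -/
theorem Homogeneous.union {c : ℚ → κ} {X Y : Set ℚ} (hX : Homogeneous c X) (h : c '' Y ⊆ c '' X) :
    Homogeneous c (X ∪ Y) := by
  intro w hw
  refine (hX w fun a ha => ?_).mono Set.subset_union_left
  have := hw a ha
  rw [Set.image_union, Set.union_eq_left.2 h] at this
  exact this

theorem cuttable_of_isPiece {c : ℚ → κ} {X : Set ℚ} (h : IsPiece c X) : Cuttable c X := by
  refine ⟨1, fun _ => 0, fun _ _ _ _ _ => le_rfl, fun _ _ => one_pos, fun i hi => ?_⟩
  have : X ∩ (fun _ : ℚ => 0) ⁻¹' {i} = X := by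
    ext x; simp; omega
  rwa [this]

theorem Cuttable.union {c : ℚ → κ} {X Y : Set ℚ} (h : ∀ x ∈ X, ∀ y ∈ Y, x < y)
    (hX : Cuttable c X) (hY : Cuttable c Y) : Cuttable c (X ∪ Y) := by
  classical
  obtain ⟨m, t, h1, h2, h3⟩ := hX
  obtain ⟨n, s, h4, h5, h6⟩ := hY
  have hYX : ∀ y ∈ Y, y ∉ X := fun y hy hyX => lt_irrefl y (h y hyX y hy)
  refine ⟨m + n, fun x => if x ∈ X then t x else m + s x, ?_, ?_, ?_⟩
  · rintro x (hx | hx) y (hy | hy) hxy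
    · simpa [hx, hy] using h1 hx hy hxy
    · simp only [hx, hYX y hy, if_true, if_false]
      have := h2 x hx
      omega
    · exact absurd (h y hy x hx) hxy.not_gt
    · simpa [hYX x hx, hYX y hy] using h4 hx hy hxy
  · rintro x (hx | hx)
    · simp only [hx, if_true]
      have := h2 x hx
      omega
    · simp only [hYX x hx, if_false]
      have := h5 x hx
      omega
  · intro i hi
    rcases lt_or_ge i m with him | him
    · convert h3 i him using 1
      ext x
      simp only [Set.mem_inter_iff, Set.mem_union, Set.mem_preimage, Set.mem_singleton_iff]
      by_cases hx : x ∈ X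
      · simp [hx]
      · simp only [hx, if_false, false_or, false_and, iff_false, not_and]
        intro _; omega
    · convert h6 (i - m) (by omega) using 1
      ext x
      simp only [Set.mem_inter_iff, Set.mem_union, Set.mem_preimage, Set.mem_singleton_iff]
      by_cases hx : x ∈ X
      · have h7 : x ∉ Y := fun hy => hYX x hy hx
        have := h2 x hx
        simp only [hx, h7, if_true, true_or, true_and, false_and, iff_false]
        omega
      · simp only [hx, if_false, false_or]
        constructor <;> rintro ⟨h7, h8⟩ <;> exact ⟨h7, by omega⟩

/-- A set which omits a word can be cut in pieces, if all sets with fewer colours can. -/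
theorem cuttable_of_not_realizes {c : ℚ → κ} {A : Set κ}
    (ih : ∀ A' ⊂ A, ∀ Y : Set ℚ, c '' Y ⊆ A' → Cuttable c Y) (w : List κ) :
    ∀ X : Set ℚ, c '' X ⊆ A → (∀ a ∈ w, a ∈ A) → ¬ Realizes c X w → Cuttable c X := by
  induction w with
  | nil => exact fun X _ _ h => absurd trivial h
  | cons a w ihw =>
    intro X hX hw hn
    have haA := hw a List.mem_cons_self
    have hwA : ∀ b ∈ w, b ∈ A := fun b hb => hw b (List.mem_cons_of_mem _ hb)
    have hsub : A \ {a} ⊂ A := by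
      refine ⟨Set.sdiff_subset, fun h => ?_⟩
      exact (h haA).2 rfl
    -- The part before any occurrence of `a`, which has fewer colours; the rest `X₂` is handled by
    -- the shorter word.
    let X₁ : Set ℚ := {x ∈ X | ∀ y ∈ X, y ≤ x → c y ≠ a}
    have h1 : Cuttable c X₁ := by
      refine ih _ hsub X₁ ?_
      rintro _ ⟨x, hx, rfl⟩
      exact ⟨hX ⟨x, hx.1, rfl⟩, hx.2 x hx.1 le_rfl⟩
    let X₂ : Set ℚ := {x ∈ X | ∃ y ∈ X, y ≤ x ∧ c y = a}
    have hXX : X₁ ∪ X₂ = X := by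
      ext x
      constructor
      · rintro (h | h) <;> exact h.1
      · intro hx
        by_cases h : ∃ y ∈ X, y ≤ x ∧ c y = a
        · exact Or.inr ⟨hx, h⟩
        · push Not at h
          exact Or.inl ⟨hx, h⟩
    have hlt : ∀ x ∈ X₁, ∀ y ∈ X₂, x < y := by
      rintro x ⟨-, hx⟩ y ⟨-, z, hz, hzy, hza⟩
      by_contra h
      exact hx z hz (hzy.trans (not_lt.1 h)) hza
    rw [← hXX]
    refine h1.union hlt ?_
    -- A least point of colour `a` is split off as a piece of its own; what lies above it omits `w`.
    by_cases hmin : ∃ x₀ ∈ X, c x₀ = a ∧ ∀ y ∈ X, c y = a → x₀ ≤ y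
    · obtain ⟨x₀, hx₀, hc, hle⟩ := hmin
      have hX₂ : X₂ = {x₀} ∪ X ∩ Set.Ioi x₀ := by
        ext x
        constructor
        · rintro ⟨hx, y, hy, hyx, hya⟩
          rcases ((hle y hy hya).trans hyx).eq_or_lt with h | h
          · exact Or.inl h.symm
          · exact Or.inr ⟨hx, h⟩
        · rintro (h | ⟨hx, h⟩)
          · rw [Set.mem_singleton_iff] at h
            subst h
            exact ⟨hx₀, x, hx₀, le_rfl, hc⟩
          · exact ⟨hx, x₀, hx₀, le_of_lt h, hc⟩
      rw [hX₂]
      refine (cuttable_of_isPiece (Or.inl Set.subsingleton_singleton)).union ?_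
        (ihw _ ((Set.image_mono Set.inter_subset_left).trans hX) hwA
          fun h => hn ⟨x₀, hx₀, hc, h⟩)
      rintro x hx y hy
      rw [Set.mem_singleton_iff] at hx
      subst hx
      exact hy.2
    -- Without a least occurrence, every point of `X₂` has a point of colour `a` strictly below it,
    -- so realizing `w` in `X₂` would realize `a :: w` in `X`.
    · push Not at hmin
      rcases X₂.eq_empty_or_nonempty with he | ⟨x, hx⟩
      · rw [he]
        exact cuttable_of_isPiece (Or.inl Set.subsingleton_empty)
      refine ihw _ ((Set.image_mono fun y hy => hy.1).trans hX) hwA fun h => hn ?_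
      have hlow : ∀ x ∈ X₂, ∃ y ∈ X, c y = a ∧ y < x := by
        rintro x ⟨-, y, hy, hyx, hya⟩
        obtain ⟨z, hz, hza, hzy⟩ := hmin y hy hya
        exact ⟨z, hz, hza, hzy.trans_le hyx⟩
      cases w with
      | nil =>
        obtain ⟨y, hy, hya, -⟩ := hlow x hx
        exact ⟨y, hy, hya, trivial⟩
      | cons b w =>
        obtain ⟨x, hx, hc, h⟩ := h
        obtain ⟨y, hy, hya, hyx⟩ := hlow x hx
        exact ⟨y, hy, hya, x, ⟨hx.1, hyx⟩, hc, h.mono fun z hz => ⟨⟨hz.1.1, hyx.trans hz.2⟩, hz.2⟩⟩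

/-- Every finitely coloured set of rationals can be cut in finitely many pieces. -/
theorem cuttable_of_image_subset [Finite κ] (c : ℚ → κ) (A : Set κ) :
    ∀ X : Set ℚ, c '' X ⊆ A → Cuttable c X := by
  induction A using WellFoundedLT.induction with
  | ind A ih =>
    intro X hX
    by_cases h : Homogeneous c X
    · exact cuttable_of_isPiece (Or.inr h)
    · unfold Homogeneous at h
      push Not at h
      obtain ⟨w, hw, hn⟩ := h
      exact cuttable_of_not_realizes ih w X hX (fun a ha => hX (hw a ha)) hn

/-- A cutting of the rationals in finitely many pieces, none of which can be merged with its
neighbour. -/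
structure Cutting (c : ℚ → κ) (m : ℕ) (t : ℚ → ℕ) : Prop where
  mono : Monotone t
  lt : ∀ x, t x < m
  piece : ∀ i < m, IsPiece c (t ⁻¹' {i})
  nonempty : ∀ i < m, ∃ x, t x = i
  left : ∀ i, i + 1 < m → (t ⁻¹' {i}).Subsingleton ∨ ∃ x, t x = i + 1 ∧ c x ∉ c '' (t ⁻¹' {i})
  right : ∀ i, i + 1 < m →
    (t ⁻¹' {i + 1}).Subsingleton ∨ ∃ x, t x = i ∧ c x ∉ c '' (t ⁻¹' {i + 1})

/-- Take the least number of pieces. Then no two neighbours can be merged: no piece is empty, and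
beside a homogeneous piece some point has a colour that the piece lacks, by `Homogeneous.union`. -/
theorem exists_cutting [Finite κ] (c : ℚ → κ) : ∃ m t, Cutting c m t := by
  classical
  have hex : ∃ m t, CutsInto c Set.univ m t :=
    cuttable_of_image_subset c Set.univ Set.univ (Set.subset_univ _)
  obtain ⟨t, h1, h2, h3⟩ := Nat.find_spec hex
  have hmin := fun k => Nat.find_min hex (m := k)
  set m := Nat.find hex with hm
  have hmono : Monotone t := fun x y hxy => h1 (Set.mem_univ x) (Set.mem_univ y) hxy
  have hlt : ∀ x, t x < m := fun x => h2 x (Set.mem_univ x)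
  have hpiece : ∀ i < m, IsPiece c (t ⁻¹' {i}) := fun i hi => by
    simpa using h3 i hi
  have hmerge : ∀ i, i + 1 < m → ¬ IsPiece c (t ⁻¹' {i} ∪ t ⁻¹' {i + 1}) := by
    intro i hi hp
    refine hmin (m - 1) (by omega) ⟨fun x => if t x ≤ i then t x else t x - 1, ?_, ?_, ?_⟩
    · intro x _ y _ hxy
      have := hmono hxy
      dsimp only
      split_ifs <;> omega
    · intro x _
      have := hlt x
      dsimp only
      split_ifs <;> omega
    · intro k hk
      rw [Set.univ_inter]
      rcases lt_trichotomy k i with hki | hki | hki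
      · convert hpiece k (by omega) using 1
        ext x
        simp only [Set.mem_preimage, Set.mem_singleton_iff]
        split_ifs <;> omega
      · convert hp using 1
        ext x
        simp only [Set.mem_preimage, Set.mem_singleton_iff, Set.mem_union]
        split_ifs <;> omega
      · convert hpiece (k + 1) (by omega) using 1
        ext x
        simp only [Set.mem_preimage, Set.mem_singleton_iff]
        split_ifs <;> omega
  refine ⟨m, t, hmono, hlt, hpiece, ?_, ?_, ?_⟩
  · intro i hi
    by_contra hne
    push Not at hne
    have he : t ⁻¹' {i} = ∅ := Set.eq_empty_of_forall_notMem fun x hx => hne x hx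
    rcases lt_or_ge (i + 1) m with h | h
    · refine hmerge i h ?_
      rw [he, Set.empty_union]
      exact hpiece _ h
    · cases i with
      | zero =>
        have h4 := hlt 0
        have h5 := hne 0
        omega
      | succ i =>
        refine hmerge i hi ?_
        rw [he, Set.union_empty]
        exact hpiece _ (by omega)
  · intro i hi
    rcases hpiece i (by omega) with h | h
    · exact Or.inl h
    · refine Or.inr ?_
      by_contra hc
      push Not at hc
      refine hmerge i hi (Or.inr (h.union ?_))
      rintro _ ⟨x, hx, rfl⟩
      exact hc x hx
  · intro i hi
    rcases hpiece (i + 1) hi with h | h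
    · exact Or.inl h
    · refine Or.inr ?_
      by_contra hc
      push Not at hc
      refine hmerge i hi (Or.inr ?_)
      rw [Set.union_comm]
      refine h.union ?_
      rintro _ ⟨x, hx, rfl⟩
      exact hc x hx

/-- In a homogeneous set every colour can be found at each of finitely many successive places. -/
theorem Homogeneous.exists_spread [Finite κ] {c : ℚ → κ} {X : Set ℚ} (hX : Homogeneous c X)
    (D : Finset ℚ) :
    ∃ u : ℚ → κ → ℚ, (∀ y ∈ D, ∀ a ∈ c '' X, u y a ∈ X ∧ c (u y a) = a) ∧
      ∀ y ∈ D, ∀ y' ∈ D, y < y' → ∀ a ∈ c '' X, ∀ a' ∈ c '' X, u y a < u y' a' := by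
  classical
  -- The word lists all colours of `X` once for each point of `D`; the block belonging to `y`
  -- provides the values `u y a`.
  let l : List κ := (Set.toFinite (c '' X)).toFinset.toList
  have hl : ∀ a, a ∈ l ↔ a ∈ c '' X := by intro a; simp [l]
  have key : ∀ Y : Set ℚ, Realizes c Y (List.replicate D.card l).flatten →
      ∃ u : ℚ → κ → ℚ, (∀ y ∈ D, ∀ a ∈ c '' X, u y a ∈ Y ∧ c (u y a) = a) ∧
      ∀ y ∈ D, ∀ y' ∈ D, y < y' → ∀ a ∈ c '' X, ∀ a' ∈ c '' X, u y a < u y' a' := by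
    induction D using Finset.induction_on_max with
    | empty => exact fun _ _ => ⟨fun _ _ => 0, by simp, by simp⟩
    | insert x D hx ih =>
      intro Y hY
      have hxD : x ∉ D := fun h => lt_irrefl _ (hx x h)
      rw [Finset.card_insert_of_notMem hxD, List.replicate_succ', List.flatten_append] at hY
      obtain ⟨b, hb1, hb2⟩ := hY.append
      obtain ⟨u, h1, h2⟩ := ih _ hb1
      have hb3 : ∀ a, ∃ v, a ∈ c '' X → v ∈ Y ∩ Set.Ioi b ∧ c v = a := by
        intro a
        by_cases ha : a ∈ c '' X
        · obtain ⟨v, hv, hva⟩ := hb2.exists_of_mem a (by simpa using (hl a).2 ha)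
          exact ⟨v, fun _ => ⟨hv, hva⟩⟩
        · exact ⟨0, fun h => absurd h ha⟩
      choose v hv using hb3
      have hold : ∀ y ∈ D, Function.update u x v y = u y := fun y hy =>
        Function.update_of_ne (ne_of_lt (hx y hy)) _ _
      refine ⟨Function.update u x v, ?_, ?_⟩
      · intro y hy a ha
        rcases Finset.mem_insert.1 hy with rfl | hy
        · rw [Function.update_self]
          exact ⟨(hv a ha).1.1, (hv a ha).2⟩
        · rw [hold y hy]
          exact ⟨(h1 y hy a ha).1.1, (h1 y hy a ha).2⟩
      · intro y hy y' hy' hlt a ha a' ha'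
        rcases Finset.mem_insert.1 hy with rfl | hyD <;> rcases Finset.mem_insert.1 hy' with rfl | hyD'
        · exact absurd hlt (lt_irrefl _)
        · exact absurd hlt (hx y' hyD').not_gt
        · rw [hold y hyD, Function.update_self]
          exact lt_of_le_of_lt (h1 y hyD a ha).1.2 (hv a' ha').1.2
        · rw [hold y hyD, hold y' hyD']
          exact h2 y hyD y' hyD' hlt a ha a' ha'
  refine key X (hX _ ?_)
  intro a ha
  rw [List.mem_flatten] at ha
  obtain ⟨l', hl', ha⟩ := ha
  rw [List.eq_of_mem_replicate hl'] at ha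
  exact (hl a).1 ha

/-- In a one-point piece all slots coincide, hence the weak inequality in general and the strict one
for the other pieces. -/
theorem Cutting.exists_spread [Finite κ] {c : ℚ → κ} {m : ℕ} {t : ℚ → ℕ} (h : Cutting c m t)
    (D : Finset ℚ) :
    ∃ u : ℕ → ℚ → κ → ℚ,
      (∀ i < m, ∀ y ∈ D, ∀ a ∈ c '' (t ⁻¹' {i}), t (u i y a) = i ∧ c (u i y a) = a) ∧
      (∀ i < m, ∀ y ∈ D, ∀ y' ∈ D, y < y' → ∀ a ∈ c '' (t ⁻¹' {i}), ∀ a' ∈ c '' (t ⁻¹' {i}),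
        u i y a ≤ u i y' a') ∧
      (∀ i < m, ¬ (t ⁻¹' {i}).Subsingleton → ∀ y ∈ D, ∀ y' ∈ D, y < y' →
        ∀ a ∈ c '' (t ⁻¹' {i}), ∀ a' ∈ c '' (t ⁻¹' {i}), u i y a < u i y' a') := by
  have key : ∀ i, ∃ u : ℚ → κ → ℚ, i < m →
      (∀ y ∈ D, ∀ a ∈ c '' (t ⁻¹' {i}), t (u y a) = i ∧ c (u y a) = a) ∧
      (∀ y ∈ D, ∀ y' ∈ D, y < y' → ∀ a ∈ c '' (t ⁻¹' {i}), ∀ a' ∈ c '' (t ⁻¹' {i}),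
        u y a ≤ u y' a') ∧
      (¬ (t ⁻¹' {i}).Subsingleton → ∀ y ∈ D, ∀ y' ∈ D, y < y' →
        ∀ a ∈ c '' (t ⁻¹' {i}), ∀ a' ∈ c '' (t ⁻¹' {i}), u y a < u y' a') := by
    intro i
    by_cases hi : i < m
    swap
    · exact ⟨fun _ _ => 0, fun h => absurd h hi⟩
    rcases h.piece i hi with hs | hs
    · obtain ⟨x, hx⟩ := h.nonempty i hi
      refine ⟨fun _ _ => x, fun _ => ⟨?_, fun _ _ _ _ _ _ _ _ _ => le_rfl, fun hn => absurd hs hn⟩⟩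
      rintro y - _ ⟨x', hx', rfl⟩
      exact ⟨hx, congrArg c (hs hx hx')⟩
    · obtain ⟨u, h1, h2⟩ := hs.exists_spread D
      exact ⟨u, fun _ => ⟨h1, fun y hy y' hy' hlt a ha a' ha' => (h2 y hy y' hy' hlt a ha a' ha').le,
        fun _ => h2⟩⟩
  choose u hu using key
  exact ⟨u, fun i hi => (hu i hi).1, fun i hi => (hu i hi).2.1, fun i hi => (hu i hi).2.2⟩

/-- The extreme points of `Z` in each piece have colours that do not occur in the neighbouring piece,
unless the latter has only one point. -/
structure Anchored (c : ℚ → κ) (m : ℕ) (t : ℚ → ℕ) (Z : Finset ℚ) : Prop where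
  first : ∀ i < m, ∃ z ∈ Z, t z = i ∧ (∀ z' ∈ Z, t z' = i → z ≤ z') ∧
    ∀ j, j + 1 = i → (t ⁻¹' {j}).Subsingleton ∨ c z ∉ c '' (t ⁻¹' {j})
  last : ∀ i < m, ∃ z ∈ Z, t z = i ∧ (∀ z' ∈ Z, t z' = i → z' ≤ z) ∧
    (i + 1 < m → (t ⁻¹' {i + 1}).Subsingleton ∨ c z ∉ c '' (t ⁻¹' {i + 1}))

/-- An automorphism that preserves the colours of an anchored set preserves its distribution over the
pieces. -/
theorem Anchored.map_eq {c : ℚ → κ} {m : ℕ} {t : ℚ → ℕ} (h : Cutting c m t) {Z : Finset ℚ}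
    (hZ : Anchored c m t Z) (α : ℚ ≃o ℚ) (hα : ∀ z ∈ Z, c (α z) = c z) {z : ℚ} (hz : z ∈ Z) :
    t (α z) = t z := by
  have hlow : ∀ i, ∀ z ∈ Z, i ≤ t z → i ≤ t (α z) := by
    intro i
    induction i with
    | zero => exact fun _ _ _ => Nat.zero_le _
    | succ i ih =>
      intro z hz hi
      -- It suffices to treat the first point `z₀` of `Z` in piece `i + 1`. It cannot drop to piece
      -- `i`: either its colour is missing there, or that piece is one point, to which `α` would
      -- have to send two points of `Z`.
      obtain ⟨z₀, hz₀, ht₀, hle, hc⟩ := hZ.first (i + 1) (lt_of_le_of_lt hi (h.lt z))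
      have hz₀z : z₀ ≤ z := by
        rcases hi.eq_or_lt with h' | h'
        · exact hle z hz h'.symm
        · exact (h.mono.reflect_lt (by omega)).le
      refine le_trans ?_ (h.mono (α.monotone hz₀z))
      have h1 := ih z₀ hz₀ (by omega)
      rcases h1.eq_or_lt with h2 | h2
      · exfalso
        rcases hc i rfl with hc | hc
        · obtain ⟨z₁, hz₁, ht₁, -⟩ := hZ.first i (by have := h.lt z; omega)
          have h3 : z₁ ≤ z₀ := (h.mono.reflect_lt (by omega)).le
          have h4 := ih z₁ hz₁ ht₁.ge
          have h5 := h.mono (α.monotone h3)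
          have h6 : α z₁ = α z₀ := hc (show t (α z₁) = i by omega) (show t (α z₀) = i by omega)
          rw [α.injective h6] at ht₁
          omega
        · exact hc ⟨α z₀, h2.symm, hα z₀ hz₀⟩
      · exact h2
  -- The mirror image, by induction on the number `d` of pieces above piece `i`.
  have hhigh : ∀ d i, i + d + 1 = m → ∀ z ∈ Z, t z ≤ i → t (α z) ≤ i := by
    intro d
    induction d with
    | zero =>
      intro i hi z _ _
      have := h.lt (α z)
      omega
    | succ d ih =>
      intro i hi z hz hiz
      obtain ⟨z₀, hz₀, ht₀, hle, hc⟩ := hZ.last i (by omega)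
      have hz₀z : z ≤ z₀ := by
        rcases hiz.eq_or_lt with h' | h'
        · exact hle z hz h'
        · exact (h.mono.reflect_lt (by omega)).le
      refine (h.mono (α.monotone hz₀z)).trans ?_
      have h1 := ih (i + 1) (by omega) z₀ hz₀ (by omega)
      rcases h1.eq_or_lt with h2 | h2
      · exfalso
        rcases hc (by omega) with hc | hc
        · obtain ⟨z₁, hz₁, ht₁, -⟩ := hZ.first (i + 1) (by omega)
          have h3 : z₀ ≤ z₁ := (h.mono.reflect_lt (by omega)).le
          have h4 := ih (i + 1) (by omega) z₁ hz₁ ht₁.le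
          have h5 := h.mono (α.monotone h3)
          have h6 : α z₁ = α z₀ :=
            hc (show t (α z₁) = i + 1 by omega) (show t (α z₀) = i + 1 by omega)
          rw [α.injective h6] at ht₁
          omega
        · exact hc ⟨α z₀, h2, hα z₀ hz₀⟩
      · omega
  refine le_antisymm ?_ (hlow _ z hz le_rfl)
  have := h.lt z
  exact hhigh (m - 1 - t z) (t z) (by omega) z hz le_rfl

end Words

/-! ### Translates of finite partial maps -/

section Embeddings

variable {M : Type} [PartialOrder M]

theorem mem_translate {α : M ≃o M} {p : Finset (M × M)} {y : M × M} :
    y ∈ translate α p ↔ ∃ x ∈ p, (α x.1, α x.2) = y := by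
  unfold translate
  rw [Finset.mem_map]
  rfl

theorem map_mem_translate {α : M ≃o M} {p : Finset (M × M)} {x : M × M} (hx : x ∈ p) :
    (α x.1, α x.2) ∈ translate α p := mem_translate.2 ⟨x, hx, rfl⟩

theorem translate_mul (α β : M ≃o M) (p : Finset (M × M)) :
    translate (α * β) p = translate α (translate β p) := by
  ext y
  rw [mem_translate, mem_translate]
  constructor
  · rintro ⟨x, hx, rfl⟩
    exact ⟨_, map_mem_translate hx, rfl⟩
  · rintro ⟨x, hx, rfl⟩
    obtain ⟨w, hw, rfl⟩ := mem_translate.1 hx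
    exact ⟨w, hw, rfl⟩

theorem translate_one (p : Finset (M × M)) : translate (1 : M ≃o M) p = p := by
  ext y
  rw [mem_translate]
  exact ⟨by rintro ⟨x, hx, rfl⟩; exact hx, fun h => ⟨y, h, rfl⟩⟩

theorem translate_mono (α : M ≃o M) {p q : Finset (M × M)} (h : p ⊆ q) :
    translate α p ⊆ translate α q := Finset.map_subset_map.2 h

theorem translate_subset_iff {α : M ≃o M} {p q : Finset (M × M)} :
    translate α p ⊆ q ↔ p ⊆ translate α⁻¹ q := by
  constructor
  · intro h
    have := translate_mono α⁻¹ h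
    rwa [← translate_mul, inv_mul_cancel, translate_one] at this
  · intro h
    have := translate_mono α h
    rwa [← translate_mul, mul_inv_cancel, translate_one] at this

theorem mem_support_translate {α : M ≃o M} {p : Finset (M × M)} {x : M} :
    α x ∈ support (translate α p) ↔ x ∈ support p := by
  constructor
  · rintro (⟨y, hy⟩ | ⟨y, hy⟩)
    · obtain ⟨w, hw, h⟩ := mem_translate.1 hy
      rw [Prod.mk.injEq, α.injective.eq_iff] at h
      exact Or.inl ⟨w.2, h.1 ▸ hw⟩
    · obtain ⟨w, hw, h⟩ := mem_translate.1 hy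
      rw [Prod.mk.injEq, α.injective.eq_iff] at h
      exact Or.inr ⟨w.1, h.2 ▸ hw⟩
  · rintro (⟨y, hy⟩ | ⟨y, hy⟩)
    · exact Or.inl ⟨_, map_mem_translate hy⟩
    · exact Or.inr ⟨_, map_mem_translate hy⟩

theorem embedsVia_translate {g α β : M ≃o M} {p : Finset (M × M)} :
    EmbedsVia g β (translate α p) ↔ EmbedsVia g (β * α) p := by
  constructor
  · intro h x hx
    exact h _ (map_mem_translate hx)
  · intro h y hy
    obtain ⟨x, hx, rfl⟩ := mem_translate.1 hy
    exact h x hx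

theorem Embeds.translate {g : M ≃o M} {p : Finset (M × M)} (h : Embeds g p) (α : M ≃o M) :
    Embeds g (translate α p) := by
  obtain ⟨β, hβ⟩ := h
  exact ⟨β * α⁻¹, by rwa [embedsVia_translate, inv_mul_cancel_right]⟩

theorem Embeds.mono {g : M ≃o M} {p q : Finset (M × M)} (h : Embeds g q) (hpq : p ⊆ q) :
    Embeds g p := by
  obtain ⟨β, hβ⟩ := h
  exact ⟨β, fun x hx => hβ x (hpq hx)⟩

theorem IsBase.translate {g : M ≃o M} {q : Finset (M × M)} (h : IsBase g q) (α : M ≃o M) :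
    IsBase g (translate α q) := by
  intro p₁ p₂ h₁ h₂ hs₁ hs₂
  obtain ⟨β₁, β₂, hβ₁, hβ₂, hβ⟩ := h _ _ (h₁.translate α⁻¹) (h₂.translate α⁻¹)
    (translate_subset_iff.1 hs₁) (translate_subset_iff.1 hs₂)
  refine ⟨β₁ * α⁻¹, β₂ * α⁻¹, embedsVia_translate.1 hβ₁, embedsVia_translate.1 hβ₂, ?_⟩
  intro x hx
  refine hβ (α⁻¹ x) ((mem_support_translate (α := α)).1 ?_)
  rwa [show α (α⁻¹ x) = x from α.apply_symm_apply x]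

/-- The conjugate of an automorphism which contains the maps that `α` carries into it. -/
theorem EmbedsVia.conj_apply {g α : M ≃o M} {p : Finset (M × M)} (h : EmbedsVia g α p)
    {x : M × M} (hx : x ∈ p) : (α⁻¹ * g * α) x.1 = x.2 := by
  change α.symm (g (α x.1)) = x.2
  rw [h x hx, α.symm_apply_apply]

end Embeddings

/-! ### Anchored reduced sets -/

section Rationals

theorem conj_zpow_apply (g α : ℚ ≃o ℚ) (i : ℤ) (x : ℚ) :
    ((α⁻¹ * g * α) ^ i) x = α⁻¹ ((g ^ i) (α x)) := by
  have := conj_zpow (i := i) (a := α⁻¹) (b := g)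
  rw [inv_inv] at this
  rw [this]; rfl

theorem colour_conj (g α : ℚ ≃o ℚ) (x : ℚ) : colour (α⁻¹ * g * α) x = colour g (α x) := by
  unfold colour
  rw [← α.strictMono.cmp_map_eq x]
  congr 1
  exact α.apply_symm_apply _

theorem hull_conj {g α : ℚ ≃o ℚ} {x y : ℚ} : Hull (α⁻¹ * g * α) x y ↔ Hull g (α x) (α y) := by
  have h1 : ∀ a b : ℚ, α⁻¹ a ≤ b ↔ a ≤ α b := fun a b => α.symm_apply_le
  have h2 : ∀ a b : ℚ, a ≤ α⁻¹ b ↔ α a ≤ b := fun a b => α.le_symm_apply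
  simp only [Hull, conj_zpow_apply, h1, h2]

/-- Two points of `Z` with the same colour, not that of a fixed point, are separated in `Z` by a point
of another colour. -/
def Reduced (g : ℚ ≃o ℚ) (Z : Finset ℚ) : Prop :=
  ∀ z ∈ Z, ∀ z' ∈ Z, z < z' → colour g z' = colour g z → colour g z ≠ .eq →
    ∃ w ∈ Z, z < w ∧ w < z' ∧ colour g w ≠ colour g z

theorem Reduced.eq_of_run {g : ℚ ≃o ℚ} {Z D : Finset ℚ} (h : Reduced g Z) (hZ : Z ⊆ D) {z z' : ℚ}
    (hz : z ∈ Z) (hz' : z' ∈ Z) (hr : Run g D z z') : z = z' := by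
  have key : ∀ z ∈ Z, ∀ z' ∈ Z, Run g D z z' → ¬ z < z' := by
    intro z hz z' hz' hr hlt
    have hc := hr.colour_eq (hZ hz')
    rcases hr with rfl | ⟨h1, h2⟩
    · exact lt_irrefl _ hlt
    · obtain ⟨w, hw, h3, h4, h5⟩ := h z hz z' hz' hlt hc h1
      exact h5 (h2 w (hZ hw) (Set.mem_uIcc.2 (Or.inl ⟨h3.le, h4.le⟩)))
  exact le_antisymm (not_lt.1 (key z' hz' z hz (hr.symm (hZ hz')))) (not_lt.1 (key z hz z' hz' hr))

theorem Reduced.eq_of_hull {g : ℚ ≃o ℚ} {Z : Finset ℚ} (h : Reduced g Z) {z z' : ℚ}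
    (hz : z ∈ Z) (hz' : z' ∈ Z) (hh : Hull g z z') : z = z' :=
  h.eq_of_run subset_rfl hz hz' (Run.of_hull hh)

/-- The hull of a moved point extends beyond it on the right; so a moved point is never isolated in
its colour, which matters next to one-point pieces. -/
theorem exists_lt_hull {g : ℚ ≃o ℚ} {x : ℚ} (hx : colour g x ≠ .eq) : ∃ y, x < y ∧ Hull g x y := by
  rcases h : colour g x with _ | _ | _
  · exact ⟨g x, colour_eq_lt.1 h, Hull.apply g x⟩
  · exact absurd h hx
  · refine ⟨g⁻¹ x, ?_, by simpa using Hull.zpow g x (-1)⟩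
    rw [← colour_eq_lt, colour_inv, h]; rfl

/-- Every finite set of points admits a colour preserving map to an anchored reduced set. -/
theorem exists_anchored_reduced (g : ℚ ≃o ℚ) {m : ℕ} {t : ℚ → ℕ} (h : Cutting (colour g) m t)
    (D : Finset ℚ) : ∃ (Z : Finset ℚ) (e : ℚ → ℚ), Anchored (colour g) m t Z ∧ Reduced g Z ∧
      (∀ x ∈ D, e x ∈ Z) ∧ (∀ x ∈ D, ∀ y ∈ D, x < y → e x ≤ e y) ∧
      (∀ x ∈ D, colour g (e x) = colour g x) ∧
      (∀ x ∈ D, ∀ y ∈ D, x < y → colour g x = .eq → colour g y = .eq → e x < e y) := by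
  classical
  let P : Finset ℚ → Prop := fun Z => ∃ e : ℚ → ℚ, Anchored (colour g) m t Z ∧
      (∀ x ∈ D, e x ∈ Z) ∧ (∀ x ∈ D, ∀ y ∈ D, x < y → e x ≤ e y) ∧
      (∀ x ∈ D, colour g (e x) = colour g x) ∧
      (∀ x ∈ D, ∀ y ∈ D, x < y → colour g x = .eq → colour g y = .eq → e x < e y)
  have hP : ∃ Z, P Z := by
    have hcol : ∀ x, colour g x ∈ colour g '' (t ⁻¹' {t x}) := fun x => ⟨x, rfl, rfl⟩
    -- Two extra slots, below and above `D`. In each piece they carry the anchoring colours `a i`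
    -- and `b i`, whose points come first and last in that piece.
    obtain ⟨lo, -, hlo⟩ := Order.exists_between_finsets ∅ D (by simp)
    obtain ⟨hi, hhi, -⟩ := Order.exists_between_finsets (insert lo D) ∅ (by simp)
    obtain ⟨u, h1, h2, h3⟩ := h.exists_spread (insert lo (insert hi D))
    have hloi : lo ∈ insert lo (insert hi D) := by simp
    have hhii : hi ∈ insert lo (insert hi D) := by simp
    have hDi : ∀ y ∈ D, y ∈ insert lo (insert hi D) := fun y hy => by simp [hy]
    have ha : ∀ i, ∃ a, i < m → a ∈ colour g '' (t ⁻¹' {i}) ∧ ∀ j, j + 1 = i →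
        (t ⁻¹' {j}).Subsingleton ∨ a ∉ colour g '' (t ⁻¹' {j}) := by
      intro i
      by_cases hi : i < m
      swap
      · exact ⟨.eq, fun h => absurd h hi⟩
      cases i with
      | zero =>
        obtain ⟨x, hx⟩ := h.nonempty 0 hi
        exact ⟨colour g x, fun _ => ⟨⟨x, hx, rfl⟩, fun j hj => by omega⟩⟩
      | succ i =>
        rcases h.left i hi with hs | ⟨x, hx, hc⟩
        · obtain ⟨x, hx⟩ := h.nonempty _ hi
          exact ⟨colour g x, fun _ => ⟨⟨x, hx, rfl⟩, fun j hj => by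
            obtain rfl : j = i := by omega
            exact Or.inl hs⟩⟩
        · exact ⟨colour g x, fun _ => ⟨⟨x, hx, rfl⟩, fun j hj => by
            obtain rfl : j = i := by omega
            exact Or.inr hc⟩⟩
    have hb : ∀ i, ∃ b, i < m → b ∈ colour g '' (t ⁻¹' {i}) ∧ (i + 1 < m →
        (t ⁻¹' {i + 1}).Subsingleton ∨ b ∉ colour g '' (t ⁻¹' {i + 1})) := by
      intro i
      by_cases hi : i < m
      swap
      · exact ⟨.eq, fun h => absurd h hi⟩
      by_cases hi' : i + 1 < m
      · rcases h.right i hi' with hs | ⟨x, hx, hc⟩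
        · obtain ⟨x, hx⟩ := h.nonempty _ hi
          exact ⟨colour g x, fun _ => ⟨⟨x, hx, rfl⟩, fun _ => Or.inl hs⟩⟩
        · exact ⟨colour g x, fun _ => ⟨⟨x, hx, rfl⟩, fun _ => Or.inr hc⟩⟩
      · obtain ⟨x, hx⟩ := h.nonempty _ hi
        exact ⟨colour g x, fun _ => ⟨⟨x, hx, rfl⟩, fun h => absurd h hi'⟩⟩
    choose a ha using ha
    choose b hb using hb
    let e : ℚ → ℚ := fun y => u (t y) y (colour g y)
    have het : ∀ y ∈ D, t (e y) = t y ∧ colour g (e y) = colour g y := fun y hy =>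
      h1 (t y) (h.lt y) y (hDi y hy) _ (hcol y)
    have hemono : ∀ x ∈ D, ∀ y ∈ D, x < y → e x < e y := by
      intro x hx y hy hxy
      rcases (h.mono hxy.le).eq_or_lt with ht | ht
      · have hns : ¬ (t ⁻¹' {t y}).Subsingleton := fun hs => hxy.ne (hs ht rfl)
        have := h3 (t y) (h.lt y) hns x (hDi x hx) y (hDi y hy) hxy (colour g x)
          (ht ▸ hcol x) (colour g y) (hcol y)
        change u (t x) x _ < _
        rwa [ht]
      · refine h.mono.reflect_lt ?_
        rwa [(het x hx).1, (het y hy).1]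
    have hlohi : lo < hi := hhi lo (by simp)
    refine ⟨D.image e ∪ ((Finset.range m).image (fun i => u i lo (a i)) ∪
      (Finset.range m).image (fun i => u i hi (b i))), e, ⟨?_, ?_⟩, ?_, ?_, ?_, ?_⟩
    · intro i hi
      have h4 := h1 i hi lo hloi (a i) (ha i hi).1
      refine ⟨u i lo (a i), ?_, h4.1, ?_, fun j hj => ?_⟩
      · simp only [Finset.mem_union, Finset.mem_image, Finset.mem_range]
        exact Or.inr (Or.inl ⟨i, hi, rfl⟩)
      · intro z hz hzi
        simp only [Finset.mem_union, Finset.mem_image, Finset.mem_range] at hz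
        rcases hz with ⟨y, hy, rfl⟩ | ⟨j, hj, rfl⟩ | ⟨j, hj, rfl⟩
        · rw [(het y hy).1] at hzi
          subst hzi
          exact h2 _ hi lo hloi y (hDi y hy) (hlo y hy) _ (ha _ hi).1 _ (hcol y)
        · rw [(h1 j hj lo hloi _ (ha j hj).1).1] at hzi
          rw [hzi]
        · rw [(h1 j hj _ hhii _ (hb j hj).1).1] at hzi
          subst hzi
          exact h2 _ hi lo hloi _ hhii hlohi _ (ha _ hi).1 _ (hb _ hi).1
      · rw [h4.2]; exact (ha i hi).2 j hj
    · intro i hi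
      have h4 := h1 i hi _ hhii (b i) (hb i hi).1
      refine ⟨u i _ (b i), ?_, h4.1, ?_, fun hi' => ?_⟩
      · simp only [Finset.mem_union, Finset.mem_image, Finset.mem_range]
        exact Or.inr (Or.inr ⟨i, hi, rfl⟩)
      · intro z hz hzi
        simp only [Finset.mem_union, Finset.mem_image, Finset.mem_range] at hz
        rcases hz with ⟨y, hy, rfl⟩ | ⟨j, hj, rfl⟩ | ⟨j, hj, rfl⟩
        · rw [(het y hy).1] at hzi
          subst hzi
          exact h2 _ hi y (hDi y hy) _ hhii (hhi y (by simp [hy])) _ (hcol y) _ (hb _ hi).1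
        · rw [(h1 j hj lo hloi _ (ha j hj).1).1] at hzi
          subst hzi
          exact h2 _ hi lo hloi _ hhii hlohi _ (ha _ hi).1 _ (hb _ hi).1
        · rw [(h1 j hj _ hhii _ (hb j hj).1).1] at hzi
          rw [hzi]
      · rw [h4.2]; exact (hb i hi).2 hi'
    · exact fun x hx => Finset.mem_union_left _ (Finset.mem_image_of_mem _ hx)
    · exact fun x hx y hy hxy => (hemono x hx y hy hxy).le
    · exact fun x hx => (het x hx).2
    · exact fun x hx y hy hxy _ _ => hemono x hx y hy hxy
  -- a set of least cardinality is reduced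
  have hcard : ∃ n, ∃ Z, P Z ∧ Z.card = n := ⟨_, _, hP.choose_spec, rfl⟩
  obtain ⟨Z, hPZ, hZn⟩ := Nat.find_spec hcard
  have hmin : ∀ Z', P Z' → Z.card ≤ Z'.card := fun Z' h' =>
    hZn ▸ Nat.find_min' hcard ⟨Z', h', rfl⟩
  obtain ⟨e, hA, heZ, hmono, hcol, hfix⟩ := hPZ
  refine ⟨Z, e, hA, ?_, heZ, hmono, hcol, hfix⟩
  intro z hz z' hz' hlt hc hne
  by_contra hno
  push Not at hno
  -- the predecessor `v` of `z'` in `Z` has the same colour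
  obtain ⟨v, hv, hvmax⟩ := Finset.exists_max_image (Z.filter (· < z')) id
    ⟨z, Finset.mem_filter.2 ⟨hz, hlt⟩⟩
  rw [Finset.mem_filter] at hv
  obtain ⟨hvZ, hvz'⟩ := hv
  have hpred : ∀ w ∈ Z, w < z' → w ≤ v := fun w hw hwz =>
    hvmax w (Finset.mem_filter.2 ⟨hw, hwz⟩)
  have hvc : colour g v = colour g z' := by
    rcases (hpred z hz hlt).eq_or_lt with h' | h'
    · rw [← h', hc]
    · rw [hno v hvZ h' hvz', hc]
  have hvne : colour g v ≠ .eq := by rw [hvc, hc]; exact hne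
  -- Otherwise `z'` comes first in its piece, so its colour is missing from the piece of `v`, which
  -- is absurd, or that piece is `{v}`. In the latter case the points just above `v` share its hull
  -- and colour but lie in the piece of `z'`, contrary to `Cutting.right`.
  have htv : t v = t z' := by
    by_contra hne'
    have htlt : t v < t z' := lt_of_le_of_ne (h.mono hvz'.le) hne'
    obtain ⟨f, hf, hft, hfle, hfc⟩ := hA.first (t z') (h.lt z')
    have hfz : f = z' := by
      rcases (hfle z' hz' rfl).eq_or_lt with h' | h'
      · exact h'
      · have := h.mono (hpred f hf h')
        omega
    subst hfz
    obtain ⟨j, hj⟩ : ∃ j, j + 1 = t f := ⟨t f - 1, by omega⟩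
    obtain ⟨l, hl, hlt', -, -⟩ := hA.last j (by have := h.lt f; omega)
    have hlv := h.mono (hpred l hl (h.mono.reflect_lt (by omega)))
    have hvj : t v = j := by omega
    rcases hfc j hj with hs | hs
    · obtain ⟨y, hy, hyh⟩ := exists_lt_hull hvne
      obtain ⟨w, hw1, hw2⟩ := exists_between (lt_min hy hvz')
      rw [lt_min_iff] at hw2
      have hwt : t w = j + 1 := by
        have h1 := h.mono hw1.le
        have h2 := h.mono hw2.2.le
        by_contra hcon
        exact hw1.ne (hs hvj (show t w = j by omega))
      rcases h.right j (by have := h.lt f; omega) with hr | ⟨x, hx, hxc⟩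
      · exact hw2.2.ne (hr hwt hj.symm)
      · have hxv : x = v := hs hx hvj
        rw [hxv] at hxc
        exact hxc ⟨w, hwt, (Hull.convex (Hull.refl g v) hyh hw1.le hw2.1.le).colour_eq⟩
    · exact hs ⟨v, hvj, hvc⟩
  -- Redirecting to `v` whatever is sent to `z'` gives a smaller set with the same properties; `v`
  -- replaces `z'` as an anchor if `z'` was last in its piece.
  have hcardlt : (Z.erase z').card < Z.card := Finset.card_erase_lt_of_mem hz'
  refine absurd (hmin (Z.erase z') ⟨fun y => if e y = z' then v else e y, ⟨?_, ?_⟩, ?_, ?_, ?_, ?_⟩)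
    hcardlt.not_ge
  · intro i hi
    obtain ⟨f, hf, hft, hfle, hfc⟩ := hA.first i hi
    refine ⟨f, Finset.mem_erase.2 ⟨?_, hf⟩, hft,
      fun w hw hwi => hfle w (Finset.mem_of_mem_erase hw) hwi, hfc⟩
    rintro rfl
    exact absurd (hfle v hvZ (htv.trans hft)) hvz'.not_ge
  · intro i hi
    obtain ⟨l, hl, hlt', hle, hlc⟩ := hA.last i hi
    by_cases hlz : l = z'
    · refine ⟨v, Finset.mem_erase.2 ⟨hvz'.ne, hvZ⟩, by rw [htv, ← hlz, hlt'], ?_, ?_⟩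
      · intro w hw hwi
        rw [Finset.mem_erase] at hw
        exact hpred w hw.2 (lt_of_le_of_ne (hlz ▸ hle w hw.2 hwi) hw.1)
      · rw [hvc, ← hlz]; exact hlc
    · exact ⟨l, Finset.mem_erase.2 ⟨hlz, hl⟩, hlt',
        fun w hw hwi => hle w (Finset.mem_of_mem_erase hw) hwi, hlc⟩
  · intro x hx
    dsimp only
    split_ifs with h'
    · exact Finset.mem_erase.2 ⟨hvz'.ne, hvZ⟩
    · exact Finset.mem_erase.2 ⟨h', heZ x hx⟩
  · intro x hx y hy hxy
    have := hmono x hx y hy hxy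
    dsimp only
    split_ifs with h1 h2 h2
    · exact le_rfl
    · exact hvz'.le.trans (h1 ▸ this)
    · exact hpred _ (heZ x hx) (lt_of_le_of_ne (h2 ▸ this) h1)
    · exact this
  · intro x hx
    dsimp only
    split_ifs with h'
    · rw [hvc, ← h', hcol x hx]
    · exact hcol x hx
  · intro x hx y hy hxy hxe hye
    have hn : ∀ x ∈ D, colour g x = .eq → e x ≠ z' := by
      intro x hx hxe h'
      exact hvne (by rw [hvc, ← h', hcol x hx, hxe])
    dsimp only
    rw [if_neg (hn x hx hxe), if_neg (hn y hy hye)]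
    exact hfix x hx y hy hxy hxe hye

end Rationals

/-! ### Amalgamation bases for automorphisms of ℚ -/

section Rationals

/-- The restriction of `g` to the finite set `K`. -/
def graphOn (g : ℚ ≃o ℚ) (K : Finset ℚ) : Finset (ℚ × ℚ) := K.image fun d => (d, g d)

theorem mem_graphOn {g : ℚ ≃o ℚ} {K : Finset ℚ} {x : ℚ × ℚ} :
    x ∈ graphOn g K ↔ x.1 ∈ K ∧ g x.1 = x.2 := by
  unfold graphOn
  rw [Finset.mem_image]
  constructor
  · rintro ⟨d, hd, rfl⟩
    exact ⟨hd, rfl⟩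
  · rintro ⟨h1, h2⟩
    exact ⟨x.1, h1, by rw [h2]⟩

/-- A finite restriction of `g` which is generated from the fundamental intervals of an anchored
reduced set is an amalgamation base. -/
theorem isBase_graphOn (g : ℚ ≃o ℚ) {m : ℕ} {t : ℚ → ℕ} (h : Cutting (colour g) m t)
    {Z K : Finset ℚ} (hA : Anchored (colour g) m t Z) (hR : Reduced g Z) (hZK : Z ⊆ K)
    (hlink : ∀ d ∈ K, ∃ z ∈ Z, ∃ u ∈ Set.uIcc z (g z), ∃ i : ℤ,
      ∀ f : ℚ ≃o ℚ, (∀ k ∈ K, f k = g k) → (f ^ i) u = d) :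
    IsBase g (graphOn g K) := by
  classical
  intro p₁ p₂ ⟨α₁, hα₁⟩ ⟨α₂, hα₂⟩ hs₁ hs₂
  -- Both extensions use the slots of one common set, so the points of `Z` get the same slots in
  -- both.
  let D : Finset ℚ := K ∪ (p₁.image Prod.fst ∪ p₂.image Prod.fst)
  have hKD : K ⊆ D := Finset.subset_union_left
  obtain ⟨u, h1, -, h3⟩ := h.exists_spread D
  have hcol : ∀ x, colour g x ∈ colour g '' (t ⁻¹' {t x}) := fun x => ⟨x, rfl, rfl⟩
  -- the guide of an automorphism `α`
  let E : (ℚ ≃o ℚ) → ℚ → ℚ := fun α y => u (t (α y)) y (colour g (α y))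
  have hE : ∀ α, ∀ y ∈ D, t (E α y) = t (α y) ∧ colour g (E α y) = colour g (α y) := fun α y hy =>
    h1 _ (h.lt _) y hy _ (hcol _)
  have hEmono : ∀ α, ∀ x ∈ D, ∀ y ∈ D, x < y → E α x < E α y := by
    intro α x hx y hy hxy
    have hα := α.strictMono hxy
    rcases (h.mono hα.le).eq_or_lt with ht | ht
    · have hns : ¬ (t ⁻¹' {t (α y)}).Subsingleton := fun hs => hα.ne (hs ht rfl)
      have := h3 _ (h.lt _) hns x hx y hy hxy (colour g (α x)) (ht ▸ hcol _) (colour g (α y)) (hcol _)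
      change u (t (α x)) x _ < _
      rwa [ht]
    · refine h.mono.reflect_lt ?_
      rwa [(hE α x hx).1, (hE α y hy).1]
  -- The guide depends on `α` only through the piece and the colour of `α z`, and for anchored
  -- points neither depends on `α`.
  have hEZ : ∀ α : ℚ ≃o ℚ, (∀ z ∈ Z, colour g (α z) = colour g z) → ∀ z ∈ Z, E α z = E 1 z := by
    intro α hα z hz
    change u (t (α z)) z (colour g (α z)) = u (t z) z (colour g z)
    rw [hA.map_eq h α hα hz, hα z hz]
  -- embed the base itself
  choose! ζ hζZ v hv i hi using hlink
  have hζ : ∀ d ∈ K, Hull g (ζ d) d := fun d hd => by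
    have := (hull_of_mem_uIcc (hv d hd)).trans (Hull.zpow g (v d) (i d))
    rwa [hi d hd g fun _ _ => rfl] at this
  have hζlt : ∀ x ∈ K, ∀ y ∈ K, x < y → ζ x ≠ ζ y → ζ x < ζ y := by
    intro x hx y hy hxy hne
    by_contra hlt
    have hlt' := lt_of_le_of_ne (not_lt.1 hlt) hne.symm
    exact absurd hxy (Hull.lt_of_not_hull (fun hh => hne
      (hR.eq_of_hull (hζZ y hy) (hζZ x hx) hh).symm) hlt' (hζ y hy) (hζ x hx)).not_gt
  have hZD : Z ⊆ D := hZK.trans hKD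
  obtain ⟨β, hβ1, hβ2, -, hβ4⟩ := exists_embedding_of_colour_map g g K ∅ ∅ (fun d => E 1 (ζ d))
    (by
      intro x hx y hy hxy
      by_cases hne : ζ x = ζ y
      · rw [hne]
      · exact (hEmono 1 _ (hZD (hζZ x hx)) _ (hZD (hζZ y hy)) (hζlt x hx y hy hxy hne)).le)
    (fun x hx => (hE 1 _ (hZD (hζZ x hx))).2.trans (hζ x hx).symm.colour_eq)
    (by
      intro x hx y hy hxy hxe hye
      rw [((hζ x hx).symm).eq_of_fixed (colour_eq_eq.1 hxe),
        ((hζ y hy).symm).eq_of_fixed (colour_eq_eq.1 hye)]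
      exact hEmono 1 x (hKD hx) y (hKD hy) hxy)
    (by simp) (by simp) (by simp) (by simp) (by simp) (by simp)
  obtain ⟨ε, hε⟩ := exists_orderIso_extending _ β hβ1
  have hεK : ∀ d ∈ K, ε d = β d := fun d hd => hε d (Finset.mem_union_left _ hd)
  -- The guide factors through `ζ`, and a run meets `Z` at most once, so the hull receiving the run
  -- of `z` is that of `E 1 z`.
  have hεZ : ∀ z ∈ Z, Hull g (ε z) (E 1 z) := by
    intro z hz
    obtain ⟨b, hb, hrun, hh⟩ := hβ4 z (hZK hz)
    have hzb : z = ζ b := hR.eq_of_run hZK hz (hζZ b hb)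
      (hrun.trans hb (Run.of_hull (hζ b hb).symm))
    rw [hεK z (hZK hz)]
    rw [← hzb] at hh
    exact hh.symm
  -- Conjugation by `ε` puts `K` back in place: `g'` agrees with `g` on `K`, and the `g'`-hull of `z
  -- ∈ Z` contains `ε⁻¹ (E 1 z)`.
  let g' : ℚ ≃o ℚ := ε⁻¹ * g * ε
  have hg' : ∀ d ∈ K, g' d = g d := by
    intro d hd
    change ε.symm (g (ε d)) = g d
    rw [hεK d hd, hβ2 d hd, ← hε (g d) (Finset.mem_union_right _ (Finset.mem_image_of_mem _ hd)),
      ε.symm_apply_apply]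
  -- embed an extension of the base over the base
  have main : ∀ (p : Finset (ℚ × ℚ)) (α : ℚ ≃o ℚ), EmbedsVia g α p → graphOn g K ⊆ p →
      p.image Prod.fst ⊆ D → ∃ A : ℚ ≃o ℚ, EmbedsVia g' A p ∧ ∀ d ∈ K, A d = d := by
    intro p α hα hKp hpD
    let g₁ : ℚ ≃o ℚ := α⁻¹ * g * α
    have hg₁ : ∀ x ∈ p, g₁ x.1 = x.2 := fun x hx => hα.conj_apply hx
    have hg₁K : ∀ d ∈ K, g₁ d = g d := fun d hd => hg₁ (d, g d) (hKp (mem_graphOn.2 ⟨hd, rfl⟩))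
    have hKdom : K ⊆ p.image Prod.fst := fun d hd =>
      Finset.mem_image.2 ⟨(d, g d), hKp (mem_graphOn.2 ⟨hd, rfl⟩), rfl⟩
    have hcZ : ∀ z ∈ Z, colour g₁ z = colour g z := fun z hz => by
      rw [colour, colour, hg₁K z (hZK hz)]
    have hcα : ∀ z ∈ Z, colour g (α z) = colour g z := fun z hz => by
      rw [← hcZ z hz, colour_conj]
    have hR₁ : Reduced g₁ Z := by
      intro z hz z' hz' hlt hc hne
      rw [hcZ z hz, hcZ z' hz'] at hc
      rw [hcZ z hz] at hne
      obtain ⟨w, hw, h5, h6, h7⟩ := hR z hz z' hz' hlt hc hne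
      exact ⟨w, hw, h5, h6, by rwa [hcZ w hw, hcZ z hz]⟩
    let η : ℚ → ℚ := fun y => if hy : ∃ z ∈ Z, Hull g₁ z y then hy.choose else y
    have hηZ : ∀ z ∈ Z, ∀ y, Hull g₁ z y → η y = z := by
      intro z hz y hzy
      have hy : ∃ z ∈ Z, Hull g₁ z y := ⟨z, hz, hzy⟩
      have h5 : η y = hy.choose := dif_pos hy
      rw [h5]
      exact hR₁.eq_of_hull hy.choose_spec.1 hz (hy.choose_spec.2.trans hzy.symm)
    have hη : ∀ y, η y = y ∨ η y ∈ Z := by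
      intro y
      by_cases hy : ∃ z ∈ Z, Hull g₁ z y
      · obtain ⟨z, hz, hzy⟩ := hy
        exact Or.inr (hηZ z hz y hzy ▸ hz)
      · exact Or.inl (dif_neg hy)
    have hηh : ∀ y, Hull g₁ (η y) y := by
      intro y
      by_cases hy : ∃ z ∈ Z, Hull g₁ z y
      · obtain ⟨z, hz, hzy⟩ := hy
        rwa [hηZ z hz y hzy]
      · rw [show η y = y from dif_neg hy]
        exact Hull.refl _ _
    have hηmono : ∀ x y, x < y → η x ≤ η y := by
      intro x y hxy
      by_cases hh : Hull g₁ x y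
      · by_cases hx : ∃ z ∈ Z, Hull g₁ z x
        · obtain ⟨z, hz, hzx⟩ := hx
          rw [hηZ z hz x hzx, hηZ z hz y (hzx.trans hh)]
        · have hy : ¬ ∃ z ∈ Z, Hull g₁ z y := fun ⟨z, hz, hzy⟩ => hx ⟨z, hz, hzy.trans hh.symm⟩
          rw [show η x = x from dif_neg hx, show η y = y from dif_neg hy]
          exact hxy.le
      · exact (Hull.lt_of_not_hull hh hxy (hηh x).symm (hηh y).symm).le
    have hηD : ∀ y ∈ p.image Prod.fst, η y ∈ D := by
      intro y hy
      rcases hη y with h5 | h5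
      · rw [h5]; exact hpD hy
      · exact hZD h5
    have hEmono' : ∀ x ∈ D, ∀ y ∈ D, x ≤ y → E α x ≤ E α y := by
      intro x hx y hy hxy
      rcases hxy.eq_or_lt with rfl | hlt
      · exact le_rfl
      · exact (hEmono α x hx y hy hlt).le
    have hεε : ∀ x, ε (ε⁻¹ x) = x := fun x => ε.apply_symm_apply x
    have hηfix : ∀ y, colour g₁ y = .eq → η y = y := fun y hy =>
      ((hηh y).symm).eq_of_fixed (colour_eq_eq.1 hy)
    -- The guide sends `z ∈ Z` to `ε⁻¹ (E α z) = ε⁻¹ (E 1 z)`, a point of the `g'`-hull of `z`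
    -- whatever `α` is. This is the condition for keeping `K` fixed.
    obtain ⟨B, hB1, hB2, hB3, -⟩ := exists_embedding_of_colour_map g₁ g' (p.image Prod.fst) K Z
      (fun y => ε⁻¹ (E α (η y)))
      (fun x hx y hy hxy => ε⁻¹.monotone (hEmono' _ (hηD x hx) _ (hηD y hy) (hηmono x y hxy)))
      (by
        intro x hx
        rw [colour_conj, hεε, (hE α _ (hηD x hx)).2, ← colour_conj]
        exact (hηh x).symm.colour_eq)
      (by
        intro x hx y hy hxy hxe hye
        rw [hηfix x hxe, hηfix y hye]
        exact ε⁻¹.strictMono (hEmono α x (hpD hx) y (hpD hy) hxy))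
      hKdom hZK
      (fun z hz => by rw [hg₁K z (hZK hz), hg' z (hZK hz)])
      (fun d hd => ⟨ζ d, hζZ d hd, v d, by rw [hg' _ (hZK (hζZ d hd))]; exact hv d hd, i d,
        hi d hd g₁ hg₁K, hi d hd g' hg'⟩)
      hR₁
      (by
        intro z hz
        rw [hull_conj, hεε, hηZ z hz z (Hull.refl _ _), hEZ α hcα z hz]
        exact hεZ z hz)
    obtain ⟨A, hA⟩ := exists_orderIso_extending _ B hB1
    refine ⟨A, fun x hx => ?_, fun d hd => ?_⟩
    · have hx1 : x.1 ∈ p.image Prod.fst := Finset.mem_image_of_mem _ hx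
      rw [hA x.1 (Finset.mem_union_left _ hx1), hB2 x.1 hx1,
        hA x.2 (Finset.mem_union_right _ (Finset.mem_image.2 ⟨x.1, hx1, hg₁ x hx⟩)), hg₁ x hx]
    · rw [hA d (Finset.mem_union_left _ (hKdom hd)), hB3 d hd]
  obtain ⟨A₁, hA₁, hA₁K⟩ := main p₁ α₁ hα₁ hs₁
    (Finset.subset_union_left.trans Finset.subset_union_right)
  obtain ⟨A₂, hA₂, hA₂K⟩ := main p₂ α₂ hα₂ hs₂
    (Finset.subset_union_right.trans Finset.subset_union_right)
  have hvia : ∀ (A : ℚ ≃o ℚ) p, EmbedsVia g' A p → EmbedsVia g (ε * A) p := by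
    intro A p hAp x hx
    have := congrArg ε (hAp x hx)
    exact (ε.apply_symm_apply _).symm.trans this
  refine ⟨ε * A₁, ε * A₂, hvia _ _ hA₁, hvia _ _ hA₂, ?_⟩
  have hfix : ∀ (A : ℚ ≃o ℚ) p, EmbedsVia g' A p → graphOn g K ⊆ p → (∀ d ∈ K, A d = d) →
      ∀ x ∈ support (graphOn g K), A x = x := by
    rintro A p hAp hKp hAK x (⟨y, hy⟩ | ⟨y, hy⟩)
    · exact hAK x (mem_graphOn.1 hy).1
    · have h5 := hAp _ (hKp hy)
      obtain ⟨h6, h7⟩ := mem_graphOn.1 hy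
      dsimp only at h5 h6 h7
      rw [hAK y h6, hg' y h6, h7] at h5
      exact h5.symm
  intro x hx
  change ε (A₁ x) = ε (A₂ x)
  rw [hfix A₁ p₁ hA₁ hs₁ hA₁K x hx, hfix A₂ p₂ hA₂ hs₂ hA₂K x hx]

/-- Every finite partial map that embeds in `g` extends to an amalgamation base that embeds in `g`. -/
theorem exists_isBase (g : ℚ ≃o ℚ) (r : Finset (ℚ × ℚ)) (hr : Embeds g r) :
    ∃ R, r ⊆ R ∧ Embeds g R ∧ IsBase g R := by
  classical
  obtain ⟨α₀, hα₀⟩ := hr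
  obtain ⟨m, t, h⟩ := exists_cutting (colour g)
  let D := r.image fun x => α₀ x.1
  obtain ⟨Z, e, hA, hR, heZ, hmono, hcol, hfix⟩ := exists_anchored_reduced g h D
  -- Moves `r` inside `g` so that each point of its domain lies in the hull of a point of `Z`.
  obtain ⟨β, hβ1, hβ2, -, hβ4⟩ := exists_embedding_of_colour_map g g D ∅ ∅ e hmono hcol hfix
    (by simp) (by simp) (by simp) (by simp) (by simp) (by simp)
  obtain ⟨α₁, hα₁⟩ := exists_orderIso_extending _ β hβ1
  have hD : ∀ x ∈ r, α₀ x.1 ∈ D := fun x hx => Finset.mem_image_of_mem (fun x => α₀ x.1) hx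
  have ha : EmbedsVia g (α₁ * α₀) r := by
    intro x hx
    change g (α₁ (α₀ x.1)) = α₁ (α₀ x.2)
    rw [hα₁ _ (Finset.mem_union_left _ (hD x hx)), hβ2 _ (hD x hx), ← hα₀ x hx,
      hα₁ _ (Finset.mem_union_right _ (Finset.mem_image_of_mem _ (hD x hx)))]
  set a := α₁ * α₀ with ha_def
  -- the points of `r` are generated from fundamental intervals of points of `Z`
  have hgen : ∀ x ∈ r, ∃ z ∈ Z, ∃ u ∈ Set.uIcc z (g z), ∃ i : ℤ, (g ^ i) u = a x.1 := by
    intro x hx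
    obtain ⟨b, hb, -, hh⟩ := hβ4 _ (hD x hx)
    rw [← hα₁ _ (Finset.mem_union_left _ (hD x hx))] at hh
    obtain ⟨i, u, hu, hi⟩ := hh.exists_zpow
    exact ⟨e b, heZ b hb, u, hu, i, hi⟩
  choose! z hzZ u hu i hi using hgen
  obtain ⟨N, hN⟩ : ∃ N : ℤ, 0 ≤ N ∧ ∀ x ∈ r, |i x| ≤ N :=
    ⟨∑ x ∈ r, |i x|, Finset.sum_nonneg fun x _ => abs_nonneg _,
      fun x hx => Finset.single_le_sum (f := fun x => |i x|) (fun x _ => abs_nonneg _) hx⟩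
  let Y : Finset ℚ := Z ∪ r.image u
  -- With the full window of exponents, the chain from `y` to `g ^ j y` stays in `K`, so every `f`
  -- that agrees with `g` on `K` reproduces it.
  let K : Finset ℚ := (Y ×ˢ Finset.Icc (-N) N).image fun s => (g ^ s.2) s.1
  have hYK : ∀ y ∈ Y, ∀ j : ℤ, |j| ≤ N → (g ^ j) y ∈ K := fun y hy j hj =>
    Finset.mem_image.2 ⟨(y, j), Finset.mem_product.2 ⟨hy, Finset.mem_Icc.2 (abs_le.1 hj)⟩, rfl⟩
  have hY : ∀ y ∈ Y, ∃ z ∈ Z, y ∈ Set.uIcc z (g z) := by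
    intro y hy
    rcases Finset.mem_union.1 hy with hy | hy
    · exact ⟨y, hy, Set.left_mem_uIcc⟩
    · obtain ⟨x, hx, rfl⟩ := Finset.mem_image.1 hy
      exact ⟨z x, hzZ x hx, hu x hx⟩
  have hbase : IsBase g (graphOn g K) := by
    refine isBase_graphOn g h hA hR ?_ ?_
    · intro w hw
      exact hYK w (Finset.mem_union_left _ hw) 0 (by simpa using hN.1)
    · intro d hd
      obtain ⟨⟨y, j⟩, hs, rfl⟩ := Finset.mem_image.1 hd
      obtain ⟨hy, hj⟩ := Finset.mem_product.1 hs
      rw [Finset.mem_Icc] at hj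
      obtain ⟨w, hw, hyw⟩ := hY y hy
      refine ⟨w, hw, y, hyw, j, fun f hf => ?_⟩
      refine int_induction_of_abs_le (P := fun j => (f ^ j) y = (g ^ j) y) (N := N) rfl ?_ j
        (abs_le.2 hj)
      intro l hl1 hl2
      have := hf _ (hYK y hy l (abs_le.2 ⟨hl1, hl2.le⟩))
      rw [zpow_succ_apply, zpow_succ_apply, ← this, f.injective.eq_iff]
  refine ⟨translate a⁻¹ (graphOn g K), ?_, ⟨a, ?_⟩, hbase.translate _⟩
  · rw [← translate_subset_iff]
    intro y hy
    obtain ⟨x, hx, rfl⟩ := mem_translate.1 hy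
    refine mem_graphOn.2 ⟨?_, ha x hx⟩
    change a x.1 ∈ K
    rw [← hi x hx]
    exact hYK _ (Finset.mem_union_right _ (Finset.mem_image_of_mem _ hx)) _ (hN.2 x hx)
  · rw [embedsVia_translate, mul_inv_cancel]
    exact fun x hx => (mem_graphOn.1 hx).2

end Rationals

/-! ### Representatives of the cycles of a permutation -/

section CycleReps

variable {α : Type} (σ : Equiv.Perm α)

/-- A representative of the cycle of `a`. -/
noncomputable def cycleRep (a : α) : α :=
  (Quotient.mk (Equiv.Perm.SameCycle.setoid σ) a).out

theorem cycleRep_sameCycle (a : α) : σ.SameCycle (cycleRep σ a) a :=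
  Quotient.exact (s := Equiv.Perm.SameCycle.setoid σ) (Quotient.out_eq _)

variable {σ}

theorem cycleRep_eq {a b : α} (h : σ.SameCycle a b) : cycleRep σ a = cycleRep σ b := by
  unfold cycleRep
  rw [Quotient.sound (s := Equiv.Perm.SameCycle.setoid σ) h]

theorem cycleRep_cycleRep (a : α) : cycleRep σ (cycleRep σ a) = cycleRep σ a :=
  cycleRep_eq (cycleRep_sameCycle σ a)

theorem cycleRep_pow_apply (s : ℕ) (a : α) : cycleRep σ ((σ ^ s) a) = cycleRep σ a :=
  (cycleRep_eq ⟨s, by simp⟩).symm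

theorem minimalPeriod_perm_pos [Finite α] (a : α) : 0 < Function.minimalPeriod σ a :=
  Function.minimalPeriod_pos_of_mem_periodicPts (Function.Injective.mem_periodicPts σ.injective a)

theorem pow_minimalPeriod_apply (a : α) : (σ ^ Function.minimalPeriod σ a) a = a := by
  rw [← Equiv.Perm.iterate_eq_pow]
  exact Function.iterate_minimalPeriod

theorem exists_pow_cycleRep [Finite α] (a : α) :
    ∃ s < Function.minimalPeriod σ (cycleRep σ a), (σ ^ s) (cycleRep σ a) = a := by
  obtain ⟨i, hi⟩ := (cycleRep_sameCycle σ a).exists_nat_pow_eq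
  refine ⟨i % Function.minimalPeriod σ (cycleRep σ a), Nat.mod_lt _ (minimalPeriod_perm_pos _), ?_⟩
  rw [← Equiv.Perm.iterate_eq_pow, Function.iterate_mod_minimalPeriod_eq, Equiv.Perm.iterate_eq_pow, hi]

theorem eq_of_pow_eq {b b' : α} (hb : cycleRep σ b = b) (hb' : cycleRep σ b' = b') {s s' : ℕ}
    (hs : s < Function.minimalPeriod σ b) (hs' : s' < Function.minimalPeriod σ b')
    (h : (σ ^ s) b = (σ ^ s') b') : b = b' ∧ s = s' := by
  have hbb : b = b' := by
    rw [← hb, ← hb', ← cycleRep_pow_apply s b, h, cycleRep_pow_apply]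
  subst hbb
  refine ⟨rfl, Function.iterate_injOn_Iio_minimalPeriod (f := σ) (x := b) hs hs' ?_⟩
  dsimp only
  rw [Equiv.Perm.iterate_eq_pow, Equiv.Perm.iterate_eq_pow, h]

theorem minimalPeriod_conj (τ : Equiv.Perm α) (a : α) :
    Function.minimalPeriod (τ⁻¹ * σ * τ : Equiv.Perm α) a = Function.minimalPeriod σ (τ a) := by
  rw [Function.minimalPeriod_eq_minimalPeriod_iff]
  intro k
  have h1 : ((τ⁻¹ * σ * τ) ^ k : Equiv.Perm α) = τ⁻¹ * σ ^ k * τ := by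
    have := conj_pow (i := k) (a := τ⁻¹) (b := σ)
    rwa [inv_inv] at this
  unfold Function.IsPeriodicPt Function.IsFixedPt
  rw [Equiv.Perm.iterate_eq_pow, Equiv.Perm.iterate_eq_pow, h1]
  simp only [Equiv.Perm.mul_apply]
  exact Equiv.Perm.inv_eq_iff_eq.trans eq_comm |>.trans eq_comm

end CycleReps

/-! ### Conjugation, joint embedding, pinning and iterates -/

section General

variable {M : Type} [PartialOrder M]

theorem pow_succ_apply' (γ : M ≃o M) (s : ℕ) (x : M) : (γ ^ (s + 1)) x = γ ((γ ^ s) x) := by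
  rw [pow_succ']; rfl

theorem pow_add_apply (γ : M ≃o M) (s t : ℕ) (x : M) : (γ ^ (s + t)) x = (γ ^ s) ((γ ^ t) x) := by
  rw [pow_add]; rfl

theorem embeds_conj {g α : M ≃o M} {p : Finset (M × M)} :
    Embeds (α⁻¹ * g * α) p ↔ Embeds g p := by
  have key : ∀ (g α : M ≃o M), Embeds (α⁻¹ * g * α) p → Embeds g p := by
    rintro g α ⟨β, hβ⟩
    refine ⟨α * β, fun x hx => ?_⟩
    have := congrArg α (hβ x hx)
    exact (α.apply_symm_apply _).symm.trans this
  refine ⟨key g α, fun h => key _ α⁻¹ ?_⟩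
  convert h using 1
  group

theorem IsBase.conj {g : M ≃o M} {q : Finset (M × M)} (h : IsBase g q) (α : M ≃o M) :
    IsBase (α⁻¹ * g * α) q := by
  intro p₁ p₂ h₁ h₂ hs₁ hs₂
  obtain ⟨β₁, β₂, hβ₁, hβ₂, hβ⟩ := h p₁ p₂ (embeds_conj.1 h₁) (embeds_conj.1 h₂) hs₁ hs₂
  have key : ∀ β p, EmbedsVia g β p → EmbedsVia (α⁻¹ * g * α) (α⁻¹ * β) p := by
    intro β p hp x hx
    change α.symm (g (α (α.symm (β x.1)))) = α.symm (β x.2)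
    rw [α.apply_symm_apply, hp x hx]
  refine ⟨α⁻¹ * β₁, α⁻¹ * β₂, key _ _ hβ₁, key _ _ hβ₂, fun x hx => ?_⟩
  exact congrArg α.symm (hβ x hx)

/-- Joint embedding: both maps have translates inside the single graph of `g`, and their relative
position there supplies `α`. -/
theorem Embeds.exists_union [DecidableEq M] {g : M ≃o M} {p q : Finset (M × M)} (hp : Embeds g p)
    (hq : Embeds g q) : ∃ α : M ≃o M, Embeds g (p ∪ PosetAut.translate α q) := by
  obtain ⟨β₁, hβ₁⟩ := hp
  obtain ⟨β₂, hβ₂⟩ := hq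
  refine ⟨β₁⁻¹ * β₂, β₁, fun x hx => ?_⟩
  rcases Finset.mem_union.1 hx with hx | hx
  · exact hβ₁ x hx
  · refine embedsVia_translate.2 ?_ x hx
    rwa [mul_inv_cancel_left]

/-- A finite partial map that embeds in `g` can be extended so that it embeds in one of finitely many
given automorphisms only if everything that embeds in `g` does. -/
theorem exists_pinning [DecidableEq M] {ι : Type} (h : ι → M ≃o M) (g : M ≃o M) (s : Finset ι)
    (r : Finset (M × M)) (hr : Embeds g r) : ∃ r', r ⊆ r' ∧ Embeds g r' ∧
      ∀ i ∈ s, Embeds (h i) r' → ∀ p, Embeds g p → Embeds (h i) p := by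
  classical
  induction s using Finset.induction_on with
  | empty => exact ⟨r, subset_rfl, hr, by simp⟩
  | insert i s _ ih =>
    obtain ⟨r', h1, h2, h3⟩ := ih
    by_cases hi : ∀ p, Embeds g p → Embeds (h i) p
    · refine ⟨r', h1, h2, fun j hj => ?_⟩
      rcases Finset.mem_insert.1 hj with rfl | hj
      · exact fun _ => hi
      · exact h3 j hj
    · push Not at hi
      -- Some `p` embeds in `g` but not in `h i`; adjoining a translate of it to `r'` makes the
      -- embedding in `h i` impossible.
      obtain ⟨p, hp, hpi⟩ := hi
      obtain ⟨α, hα⟩ := h2.exists_union hp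
      refine ⟨_, h1.trans Finset.subset_union_left, hα, fun j hj hj' => ?_⟩
      rcases Finset.mem_insert.1 hj with rfl | hj
      · refine absurd ?_ hpi
        have := (hj'.mono Finset.subset_union_right).translate α⁻¹
        rwa [← translate_mul, inv_mul_cancel, translate_one] at this
      · exact h3 j hj (hj'.mono Finset.subset_union_left)

/-- Inside an automorphism, an iterate of `q` can only follow the orbit of `γ`, so it is defined
exactly as long as the pairs of that orbit lie in `q`. -/
theorem iter_iff {γ : M ≃o M} {q : Finset (M × M)} (hq : ∀ z ∈ q, γ z.1 = z.2) (j : ℕ) :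
    ∀ x w : M, iter q j x w ↔ w = (γ ^ j) x ∧ ∀ l < j, ((γ ^ l) x, (γ ^ (l + 1)) x) ∈ q := by
  induction j with
  | zero => intro x w; simp [iter, eq_comm]
  | succ j ih =>
    intro x w
    have hpow : ∀ l : ℕ, (γ ^ (l + 1)) x = (γ ^ l) (γ x) := fun l => by
      rw [pow_add_apply, pow_one]
    constructor
    · rintro ⟨z, hz, hw⟩
      obtain rfl : γ x = z := hq _ hz
      rw [ih] at hw
      refine ⟨by rw [hpow, hw.1], fun l hl => ?_⟩
      cases l with
      | zero => simpa using hz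
      | succ l =>
        rw [hpow, hpow]
        exact hw.2 l (by omega)
    · rintro ⟨h1, h2⟩
      refine ⟨γ x, by simpa using h2 0 (by omega), (ih _ _).2 ⟨by rw [h1, hpow], fun l hl => ?_⟩⟩
      rw [← hpow, ← hpow]
      exact h2 (l + 1) (by omega)

end General

/-! ### Automorphisms of the copies and their return maps -/

section Copies

variable {n : ℕ}

theorem copiesQ_ext {x y : CopiesQ n} (h1 : x.1 = y.1) (h2 : x.2 = y.2) : x = y := by
  obtain ⟨a, q⟩ := x
  obtain ⟨b, r⟩ := y
  dsimp only at h1 h2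
  rw [h1, h2]

theorem fst_apply (γ : CopiesQ n ≃o CopiesQ n) (x : CopiesQ n) : (γ x).1 = inducedPerm γ x.1 :=
  fst_apply_eq γ rfl

theorem inducedPerm_mul (α β : CopiesQ n ≃o CopiesQ n) :
    inducedPerm (α * β) = inducedPerm α * inducedPerm β := by
  ext1 a
  exact fst_apply α (β ⟨a, 0⟩)

theorem inducedPerm_one : inducedPerm (1 : CopiesQ n ≃o CopiesQ n) = 1 := by
  ext1 a
  rfl

theorem inducedPerm_inv (α : CopiesQ n ≃o CopiesQ n) : inducedPerm α⁻¹ = (inducedPerm α)⁻¹ := by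
  rw [eq_inv_iff_mul_eq_one, ← inducedPerm_mul, inv_mul_cancel, inducedPerm_one]

theorem inducedPerm_pow (α : CopiesQ n ≃o CopiesQ n) (s : ℕ) :
    inducedPerm (α ^ s) = inducedPerm α ^ s := by
  induction s with
  | zero => rw [pow_zero, pow_zero, inducedPerm_one]
  | succ s ih => rw [pow_succ, pow_succ, inducedPerm_mul, ih]

/-- The isomorphism that `γ` induces on the copy `a`. -/
def fiberMap (γ : CopiesQ n ≃o CopiesQ n) (a : Fin n) : ℚ ≃o ℚ where
  toFun x := (γ ⟨a, x⟩).2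
  invFun y := (γ.symm ⟨inducedPerm γ a, y⟩).2
  left_inv x := by
    have h : (⟨inducedPerm γ a, (γ ⟨a, x⟩).2⟩ : CopiesQ n) = γ ⟨a, x⟩ :=
      copiesQ_ext (fst_apply γ ⟨a, x⟩).symm rfl
    dsimp only
    rw [h, γ.symm_apply_apply]
  right_inv y := by
    have h : (⟨a, (γ.symm ⟨inducedPerm γ a, y⟩).2⟩ : CopiesQ n) = γ.symm ⟨inducedPerm γ a, y⟩ := by
      refine copiesQ_ext ?_ rfl
      apply (inducedPerm γ).injective
      rw [← fst_apply γ, ← fst_apply γ, γ.apply_symm_apply, fst_apply]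
    dsimp only
    rw [h, γ.apply_symm_apply]
  map_rel_iff' {x y} := by
    have h : ∀ x, γ ⟨a, x⟩ = ⟨inducedPerm γ a, (γ ⟨a, x⟩).2⟩ := fun x =>
      copiesQ_ext (fst_apply γ ⟨a, x⟩) rfl
    change (γ ⟨a, x⟩).2 ≤ (γ ⟨a, y⟩).2 ↔ x ≤ y
    rw [← Sigma.mk_le_mk_iff (α := fun _ : Fin n => ℚ) (i := inducedPerm γ a), ← h, ← h, γ.le_iff_le, Sigma.mk_le_mk_iff]

theorem apply_mk (γ : CopiesQ n ≃o CopiesQ n) (a : Fin n) (x : ℚ) :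
    γ ⟨a, x⟩ = ⟨inducedPerm γ a, fiberMap γ a x⟩ :=
  copiesQ_ext (fst_apply γ ⟨a, x⟩) rfl

theorem fiberMap_mul (α β : CopiesQ n ≃o CopiesQ n) (a : Fin n) :
    fiberMap (α * β) a = fiberMap α (inducedPerm β a) * fiberMap β a := by
  ext x
  change (α (β ⟨a, x⟩)).2 = _
  rw [apply_mk β, apply_mk α]
  rfl

theorem fiberMap_one (a : Fin n) : fiberMap (1 : CopiesQ n ≃o CopiesQ n) a = 1 := by
  ext x
  rfl

/-- The automorphism that acts on each copy separately. -/
def fiberwise (φ : Fin n → ℚ ≃o ℚ) : CopiesQ n ≃o CopiesQ n where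
  toFun x := ⟨x.1, φ x.1 x.2⟩
  invFun x := ⟨x.1, (φ x.1).symm x.2⟩
  left_inv x := copiesQ_ext rfl ((φ x.1).symm_apply_apply _)
  right_inv x := copiesQ_ext rfl ((φ x.1).apply_symm_apply _)
  map_rel_iff' {x y} := by
    obtain ⟨a, x⟩ := x
    obtain ⟨b, y⟩ := y
    by_cases hab : a = b
    · subst hab
      change (⟨a, φ a x⟩ : CopiesQ n) ≤ ⟨a, φ a y⟩ ↔ _
      rw [Sigma.mk_le_mk_iff, Sigma.mk_le_mk_iff, (φ a).le_iff_le]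
    · have h : ∀ u v : CopiesQ n, u ≤ v → u.1 = v.1 := by
        rintro _ _ ⟨_, _, _, _⟩
        rfl
      exact ⟨fun h' => absurd (h _ _ h') hab, fun h' => absurd (h _ _ h') hab⟩

theorem fiberwise_mk (φ : Fin n → ℚ ≃o ℚ) (a : Fin n) (x : ℚ) :
    fiberwise φ ⟨a, x⟩ = ⟨a, φ a x⟩ := rfl

/-- The length of the cycle of the copy `a`. -/
noncomputable def period (γ : CopiesQ n ≃o CopiesQ n) (a : Fin n) : ℕ :=
  Function.minimalPeriod (inducedPerm γ) a

/-- The return map of `γ` on the copy `a`. -/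
noncomputable def returnMap (γ : CopiesQ n ≃o CopiesQ n) (a : Fin n) : ℚ ≃o ℚ :=
  fiberMap (γ ^ period γ a) a

theorem period_pos (γ : CopiesQ n ≃o CopiesQ n) (a : Fin n) : 0 < period γ a :=
  minimalPeriod_perm_pos a

theorem pow_apply_mk (γ : CopiesQ n ≃o CopiesQ n) (s : ℕ) (a : Fin n) (x : ℚ) :
    (γ ^ s) ⟨a, x⟩ = ⟨(inducedPerm γ ^ s) a, fiberMap (γ ^ s) a x⟩ := by
  rw [apply_mk, inducedPerm_pow]

theorem pow_period_apply (γ : CopiesQ n ≃o CopiesQ n) (a : Fin n) (x : ℚ) :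
    (γ ^ period γ a) ⟨a, x⟩ = ⟨a, returnMap γ a x⟩ := by
  rw [pow_apply_mk]
  exact copiesQ_ext (pow_minimalPeriod_apply a) rfl

theorem inducedPerm_conj (γ δ : CopiesQ n ≃o CopiesQ n) :
    inducedPerm (δ⁻¹ * γ * δ) = (inducedPerm δ)⁻¹ * inducedPerm γ * inducedPerm δ := by
  rw [inducedPerm_mul, inducedPerm_mul, inducedPerm_inv]

theorem returnMap_conj (γ δ : CopiesQ n ≃o CopiesQ n) (a : Fin n) :
    returnMap (δ⁻¹ * γ * δ) a =
      (fiberMap δ a)⁻¹ * returnMap γ (inducedPerm δ a) * fiberMap δ a := by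
  have hk : period (δ⁻¹ * γ * δ) a = period γ (inducedPerm δ a) := by
    unfold period
    rw [inducedPerm_conj, minimalPeriod_conj]
  have hp : (δ⁻¹ * γ * δ) ^ period γ (inducedPerm δ a) =
      δ⁻¹ * γ ^ period γ (inducedPerm δ a) * δ := by
    have := conj_pow (i := period γ (inducedPerm δ a)) (a := δ⁻¹) (b := γ)
    rwa [inv_inv] at this
  have hfix : inducedPerm (γ ^ period γ (inducedPerm δ a)) (inducedPerm δ a) = inducedPerm δ a := by
    rw [inducedPerm_pow]
    exact pow_minimalPeriod_apply _
  have hinv : fiberMap δ⁻¹ (inducedPerm δ a) = (fiberMap δ a)⁻¹ := by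
    rw [eq_inv_iff_mul_eq_one, ← fiberMap_mul, inv_mul_cancel, fiberMap_one]
  unfold returnMap
  rw [hk, hp, fiberMap_mul, fiberMap_mul, hfix, hinv]

theorem embeds_returnMap_conj {γ δ : CopiesQ n ≃o CopiesQ n} {a : Fin n} {r : Finset (ℚ × ℚ)} :
    Embeds (returnMap (δ⁻¹ * γ * δ) a) r ↔ Embeds (returnMap γ (inducedPerm δ a)) r := by
  rw [returnMap_conj, embeds_conj]

/-- Conjugating `γ` by itself changes nothing, so the return maps on consecutive copies of a cycle
are conjugate. -/
theorem embeds_returnMap_sameCycle {γ : CopiesQ n ≃o CopiesQ n} {a b : Fin n}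
    (h : (inducedPerm γ).SameCycle a b) {r : Finset (ℚ × ℚ)} :
    Embeds (returnMap γ a) r ↔ Embeds (returnMap γ b) r := by
  obtain ⟨i, rfl⟩ := h.exists_nat_pow_eq
  induction i with
  | zero => rfl
  | succ i ih =>
    rw [ih ⟨i, by simp⟩, pow_succ']
    have := embeds_returnMap_conj (γ := γ) (δ := γ) (a := (inducedPerm γ ^ i) a) (r := r)
    rwa [inv_mul_cancel, one_mul] at this

/-- Every point is reached in exactly one way from a representative copy. -/
theorem exists_coordinates (γ : CopiesQ n ≃o CopiesQ n) (x : CopiesQ n) :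
    ∃ b, cycleRep (inducedPerm γ) b = b ∧ ∃ s < period γ b, ∃ y : ℚ, x = (γ ^ s) ⟨b, y⟩ := by
  obtain ⟨s, hs, h⟩ := exists_pow_cycleRep (σ := inducedPerm γ) x.1
  refine ⟨_, cycleRep_cycleRep x.1, s, hs, ((γ ^ s).symm x).2, ?_⟩
  rw [← OrderIso.symm_apply_eq]
  refine copiesQ_ext ?_ rfl
  apply (inducedPerm (γ ^ s)).injective
  rw [← fst_apply, OrderIso.apply_symm_apply, inducedPerm_pow, h]

theorem coordinates_unique {γ : CopiesQ n ≃o CopiesQ n} {b b' : Fin n}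
    (hb : cycleRep (inducedPerm γ) b = b) (hb' : cycleRep (inducedPerm γ) b' = b') {s s' : ℕ}
    (hs : s < period γ b) (hs' : s' < period γ b') {y y' : ℚ}
    (h : (γ ^ s) ⟨b, y⟩ = (γ ^ s') ⟨b', y'⟩) : b = b' ∧ s = s' ∧ y = y' := by
  have h1 := congrArg Sigma.fst h
  rw [pow_apply_mk, pow_apply_mk] at h1
  obtain ⟨rfl, rfl⟩ := eq_of_pow_eq hb hb' hs hs' h1
  have h2 := (γ ^ s).injective h
  refine ⟨rfl, rfl, ?_⟩
  injection h2 with _ h3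

/-- Maps between the representative copies extend along the cycles. -/
theorem exists_glued {γ γ' : CopiesQ n ≃o CopiesQ n} (hγ : inducedPerm γ = inducedPerm γ')
    (A : Fin n → ℚ ≃o ℚ) : ∃ β : CopiesQ n ≃o CopiesQ n,
      ∀ b, cycleRep (inducedPerm γ) b = b → ∀ s < period γ b, ∀ y : ℚ,
        β ((γ ^ s) ⟨b, y⟩) = (γ' ^ s) ⟨b, A b y⟩ := by
  choose s hs hsa using fun a => exists_pow_cycleRep (σ := inducedPerm γ) a
  refine ⟨fiberwise fun a => fiberMap (γ' ^ s a) (cycleRep (inducedPerm γ) a) *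
    A (cycleRep (inducedPerm γ) a) * (fiberMap (γ ^ s a) (cycleRep (inducedPerm γ) a))⁻¹, ?_⟩
  intro b hb i hi y
  rw [pow_apply_mk, pow_apply_mk, fiberwise_mk, hγ]
  have h1 : cycleRep (inducedPerm γ) ((inducedPerm γ ^ i) b) = b := by rw [cycleRep_pow_apply, hb]
  have h2 : s ((inducedPerm γ ^ i) b) = i := by
    have h3 := hs ((inducedPerm γ ^ i) b)
    have h4 := hsa ((inducedPerm γ ^ i) b)
    rw [h1] at h3 h4
    exact (eq_of_pow_eq hb hb h3 hi h4).2
  rw [← hγ, h1, h2]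
  refine copiesQ_ext rfl ?_
  change fiberMap (γ' ^ i) b (A b ((fiberMap (γ ^ i) b)⁻¹ (fiberMap (γ ^ i) b y))) = _
  rw [show (fiberMap (γ ^ i) b)⁻¹ (fiberMap (γ ^ i) b y) = y from OrderIso.symm_apply_apply _ _]

/-- The return maps on the representative copies can be replaced by given ones. -/
theorem exists_modified (γ : CopiesQ n ≃o CopiesQ n) (g : Fin n → ℚ ≃o ℚ) :
    ∃ γ' : CopiesQ n ≃o CopiesQ n, inducedPerm γ' = inducedPerm γ ∧
      ∀ b, cycleRep (inducedPerm γ) b = b → returnMap γ' b = g b ∧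
        ∀ s < period γ b, ∀ y : ℚ, (γ' ^ s) ⟨b, y⟩ = (γ ^ s) ⟨b, y⟩ := by
  classical
  -- The correction acts only on arrival in a representative copy, that is, in the last step of a
  -- cycle; the earlier steps are those of `γ`.
  let φ : Fin n → ℚ ≃o ℚ := fun a =>
    if cycleRep (inducedPerm γ) a = a then g a * (returnMap γ a)⁻¹ else 1
  have hperm : inducedPerm (fiberwise φ * γ) = inducedPerm γ := by
    ext1 a
    rfl
  have hper : ∀ b, period (fiberwise φ * γ) b = period γ b := fun b => by
    unfold period
    rw [hperm]
  have hstep : ∀ b, cycleRep (inducedPerm γ) b = b → ∀ s < period γ b, ∀ y : ℚ,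
      ((fiberwise φ * γ) ^ s) ⟨b, y⟩ = (γ ^ s) ⟨b, y⟩ := by
    intro b hb s
    induction s with
    | zero => intros; rfl
    | succ s ih =>
      intro hs y
      rw [pow_succ_apply', ih (by omega) y]
      change fiberwise φ (γ _) = _
      rw [← pow_succ_apply', pow_apply_mk, fiberwise_mk]
      have h1 : ¬ cycleRep (inducedPerm γ) ((inducedPerm γ ^ (s + 1)) b) =
          (inducedPerm γ ^ (s + 1)) b := by
        rw [cycleRep_pow_apply, hb]
        intro h
        have := (eq_of_pow_eq (σ := inducedPerm γ) (s := 0) hb hb (period_pos γ b) hs (by simpa using h)).2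
        omega
      have h2 : φ ((inducedPerm γ ^ (s + 1)) b) = 1 := if_neg h1
      rw [h2]
      rfl
  refine ⟨fiberwise φ * γ, hperm, fun b hb => ⟨?_, hstep b hb⟩⟩
  ext y
  have h1 := pow_period_apply (fiberwise φ * γ) b y
  rw [hper] at h1
  obtain ⟨k, hk⟩ : ∃ k, period γ b = k + 1 := ⟨period γ b - 1, by have := period_pos γ b; omega⟩
  rw [hk, pow_succ_apply', hstep b hb k (by omega) y] at h1
  have h2 : fiberwise φ (γ ((γ ^ k) ⟨b, y⟩)) = ⟨b, returnMap (fiberwise φ * γ) b y⟩ := h1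
  rw [← pow_succ_apply', ← hk, pow_period_apply, fiberwise_mk] at h2
  have h3 : φ b = g b * (returnMap γ b)⁻¹ := if_pos hb
  rw [h3] at h2
  injection h2 with _ h4
  rw [← h4]
  change g b ((returnMap γ b)⁻¹ (returnMap γ b y)) = g b y
  rw [show (returnMap γ b)⁻¹ (returnMap γ b y) = y from OrderIso.symm_apply_apply _ _]

end Copies

/-! ### Symmetric amalgamation bases for the copies -/

section Copies

variable {n : ℕ}

/-- The points of a finite partial map of the rationals. -/
def points (r : Finset (ℚ × ℚ)) : Finset ℚ := r.image Prod.fst ∪ r.image Prod.snd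

theorem mem_points_iff {r : Finset (ℚ × ℚ)} {x : ℚ} : x ∈ points r ↔ x ∈ support r := by
  simp [points, support]

theorem fst_mem_points {r : Finset (ℚ × ℚ)} {x : ℚ × ℚ} (h : x ∈ r) : x.1 ∈ points r :=
  Finset.mem_union_left _ (Finset.mem_image_of_mem _ h)

theorem snd_mem_points {r : Finset (ℚ × ℚ)} {x : ℚ × ℚ} (h : x ∈ r) : x.2 ∈ points r :=
  Finset.mem_union_right _ (Finset.mem_image_of_mem _ h)

open Classical in
/-- The restriction of `γ` whose first `period - 1` steps along each cycle are defined on all points of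
the partial return map `R`, and whose last step follows `R`. -/
noncomputable def cycleExtension (γ : CopiesQ n ≃o CopiesQ n) (R : Fin n → Finset (ℚ × ℚ)) :
    Finset (CopiesQ n × CopiesQ n) :=
  (Finset.univ.filter fun b => cycleRep (inducedPerm γ) b = b).biUnion fun b =>
    ((points (R b) ×ˢ Finset.range (period γ b)).filter fun u =>
      u.2 + 1 < period γ b ∨ ∃ w, (u.1, w) ∈ R b).image fun u =>
        ((γ ^ u.2) ⟨b, u.1⟩, (γ ^ (u.2 + 1)) ⟨b, u.1⟩)

variable {γ : CopiesQ n ≃o CopiesQ n} {R : Fin n → Finset (ℚ × ℚ)}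

theorem mem_cycleExtension {z : CopiesQ n × CopiesQ n} : z ∈ cycleExtension γ R ↔
    ∃ b, cycleRep (inducedPerm γ) b = b ∧ ∃ y ∈ points (R b), ∃ s < period γ b,
      (s + 1 < period γ b ∨ ∃ w, (y, w) ∈ R b) ∧
        z = ((γ ^ s) ⟨b, y⟩, (γ ^ (s + 1)) ⟨b, y⟩) := by
  classical
  simp only [cycleExtension, Finset.mem_biUnion, Finset.mem_filter, Finset.mem_univ, true_and,
    Finset.mem_image, Finset.mem_product, Finset.mem_range, Prod.exists]
  constructor
  · rintro ⟨b, hb, y, s, ⟨⟨hy, hs⟩, h⟩, rfl⟩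
    exact ⟨b, hb, y, hy, s, hs, h, rfl⟩
  · rintro ⟨b, hb, y, hy, s, hs, h, rfl⟩
    exact ⟨b, hb, y, s, ⟨⟨hy, hs⟩, h⟩, rfl⟩

theorem apply_of_mem_cycleExtension {z : CopiesQ n × CopiesQ n} (hz : z ∈ cycleExtension γ R) :
    γ z.1 = z.2 := by
  obtain ⟨b, -, y, -, s, -, -, rfl⟩ := mem_cycleExtension.1 hz
  exact (pow_succ_apply' γ s _).symm

theorem pair_mem_cycleExtension {b : Fin n} (hb : cycleRep (inducedPerm γ) b = b) {y : ℚ}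
    (hy : y ∈ points (R b)) {s : ℕ} (hs : s < period γ b) :
    ((γ ^ s) ⟨b, y⟩, (γ ^ (s + 1)) ⟨b, y⟩) ∈ cycleExtension γ R ↔
      s + 1 < period γ b ∨ ∃ w, (y, w) ∈ R b := by
  rw [mem_cycleExtension]
  constructor
  · rintro ⟨b', hb', y', hy', s', hs', h, heq⟩
    obtain ⟨rfl, rfl, rfl⟩ := coordinates_unique hb hb' hs hs' (congrArg Prod.fst heq)
    exact h
  · exact fun h => ⟨b, hb, y, hy, s, hs, h, rfl⟩

theorem mem_support_cycleExtension
    (hR : ∀ b, cycleRep (inducedPerm γ) b = b → ∀ x ∈ R b, returnMap γ b x.1 = x.2)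
    {x : CopiesQ n} : x ∈ support (cycleExtension γ R) ↔
      ∃ b, cycleRep (inducedPerm γ) b = b ∧ ∃ s < period γ b, ∃ y ∈ points (R b),
        x = (γ ^ s) ⟨b, y⟩ := by
  constructor
  · rintro (⟨w, hw⟩ | ⟨w, hw⟩)
    · obtain ⟨b, hb, y, hy, s, hs, -, heq⟩ := mem_cycleExtension.1 hw
      exact ⟨b, hb, s, hs, y, hy, congrArg Prod.fst heq⟩
    · obtain ⟨b, hb, y, hy, s, hs, h, heq⟩ := mem_cycleExtension.1 hw
      have hx : x = (γ ^ (s + 1)) ⟨b, y⟩ := congrArg Prod.snd heq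
      by_cases hs' : s + 1 < period γ b
      · exact ⟨b, hb, s + 1, hs', y, hy, hx⟩
      · obtain ⟨v, hv⟩ := h.resolve_left hs'
        have h1 : s + 1 = period γ b := by omega
        refine ⟨b, hb, 0, period_pos γ b, v, snd_mem_points hv, ?_⟩
        rw [hx, h1, pow_period_apply, hR b hb _ hv]
        rfl
  · rintro ⟨b, hb, s, hs, y, hy, rfl⟩
    by_cases hs' : s + 1 < period γ b
    · exact Or.inl ⟨_, (pair_mem_cycleExtension hb hy hs).2 (Or.inl hs')⟩
    · rcases Finset.mem_union.1 hy with h | h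
      · obtain ⟨u, hu, rfl⟩ := Finset.mem_image.1 h
        exact Or.inl ⟨_, (pair_mem_cycleExtension hb hy hs).2 (Or.inr ⟨u.2, hu⟩)⟩
      · obtain ⟨u, hu, rfl⟩ := Finset.mem_image.1 h
        cases s with
        -- Here the cycle has length one, so the range point `y` has no earlier copy to be reached
        -- from; it is reached by `R b` itself.
        | zero =>
          have h1 : period γ b = 1 := by have := period_pos γ b; omega
          have h2 := (pair_mem_cycleExtension hb (fst_mem_points hu) (period_pos γ b)).2
            (Or.inr ⟨u.2, hu⟩)
          rw [show (0 : ℕ) + 1 = period γ b by omega, pow_period_apply, hR b hb u hu] at h2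
          exact Or.inr ⟨_, h2⟩
        | succ s =>
          exact Or.inr ⟨_, (pair_mem_cycleExtension hb hy (by omega)).2 (Or.inl hs)⟩

theorem mem_supportAt_cycleExtension
    (hR : ∀ b, cycleRep (inducedPerm γ) b = b → ∀ x ∈ R b, returnMap γ b x.1 = x.2)
    {b : Fin n} (hb : cycleRep (inducedPerm γ) b = b) {i : ℕ} (hi : i < period γ b)
    {x : CopiesQ n} : x ∈ supportAt (cycleExtension γ R) ((inducedPerm γ ^ i) b) ↔
      ∃ y ∈ points (R b), x = (γ ^ i) ⟨b, y⟩ := by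
  constructor
  · rintro ⟨hx, hx'⟩
    obtain ⟨b', hb', s, hs, y, hy, rfl⟩ := (mem_support_cycleExtension hR).1 hx
    rw [pow_apply_mk] at hx'
    obtain ⟨rfl, rfl⟩ := eq_of_pow_eq hb' hb hs hi hx'
    exact ⟨y, hy, rfl⟩
  · rintro ⟨y, hy, rfl⟩
    refine ⟨(mem_support_cycleExtension hR).2 ⟨b, hb, i, hi, y, hy, rfl⟩, ?_⟩
    rw [pow_apply_mk]

/-- A full turn passes the last step of the cycle once, and only there can it be undefined, so the
condition is that `y` lies in the domain of `R b`. It does not depend on `i`, which gives the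
symmetry. -/
theorem iter_cycleExtension
    (hR : ∀ b, cycleRep (inducedPerm γ) b = b → ∀ x ∈ R b, returnMap γ b x.1 = x.2)
    {b : Fin n} (hb : cycleRep (inducedPerm γ) b = b) {y : ℚ} (hy : y ∈ points (R b)) {i : ℕ}
    (hi : i < period γ b) {w : CopiesQ n} :
    iter (cycleExtension γ R) (period γ b) ((γ ^ i) ⟨b, y⟩) w ↔
      w = (γ ^ (period γ b + i)) ⟨b, y⟩ ∧ ∃ v, (y, v) ∈ R b := by
  rw [iter_iff (γ := γ) (fun z hz => apply_of_mem_cycleExtension hz)]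
  simp only [← pow_add_apply]
  refine and_congr_right fun _ => ⟨fun h => ?_, fun h l hl => ?_⟩
  · have h1 := h (period γ b - 1 - i) (by omega)
    rw [show period γ b - 1 - i + 1 + i = period γ b - 1 - i + i + 1 by omega,
      pair_mem_cycleExtension hb hy (by omega)] at h1
    exact h1.resolve_left (by omega)
  · rw [show l + 1 + i = l + i + 1 by omega]
    by_cases hl' : l + i < period γ b
    · exact (pair_mem_cycleExtension hb hy hl').2 (Or.inr h)
    · obtain ⟨v, hv⟩ := h
      have h1 : ∀ j, (γ ^ (j + period γ b)) ⟨b, y⟩ = (γ ^ j) ⟨b, v⟩ := fun j => by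
        rw [pow_add_apply, pow_period_apply, hR b hb _ hv]
      have h2 := h1 (l + i - period γ b)
      have h3 := h1 (l + i - period γ b + 1)
      rw [show l + i - period γ b + period γ b = l + i by omega] at h2
      rw [show l + i - period γ b + 1 + period γ b = l + i + 1 by omega] at h3
      rw [h2, h3]
      exact (pair_mem_cycleExtension hb (snd_mem_points hv) (by omega)).2 (Or.inl (by omega))

theorem isSymmetricFor_cycleExtension
    (hR : ∀ b, cycleRep (inducedPerm γ) b = b → ∀ x ∈ R b, returnMap γ b x.1 = x.2) :
    IsSymmetricFor (inducedPerm γ) (cycleExtension γ R) := by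
  intro a
  refine ⟨cycleRep (inducedPerm γ) a, (cycleRep_sameCycle _ a).symm, ?_⟩
  set b := cycleRep (inducedPerm γ) a with hb_def
  have hb : cycleRep (inducedPerm γ) b = b := cycleRep_cycleRep a
  change ∀ i < period γ b, IterIsIso _ (period γ b) i b _
  intro i hi
  have hmem0 : ∀ x, x ∈ supportAt (cycleExtension γ R) b ↔ ∃ y ∈ points (R b), x = ⟨b, y⟩ :=
    fun x => mem_supportAt_cycleExtension hR hb (period_pos γ b)
  have hmemi : ∀ x, x ∈ supportAt (cycleExtension γ R) ((inducedPerm γ ^ i) b) ↔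
      ∃ y ∈ points (R b), x = (γ ^ i) ⟨b, y⟩ := fun x => mem_supportAt_cycleExtension hR hb hi
  let φ : supportAt (cycleExtension γ R) b ≃o
      supportAt (cycleExtension γ R) ((inducedPerm γ ^ i) b) :=
    { toFun := fun x => ⟨(γ ^ i) x.1, by
        obtain ⟨y, hy, hx⟩ := (hmem0 _).1 x.2
        exact (hmemi _).2 ⟨y, hy, by rw [hx]⟩⟩
      invFun := fun x => ⟨(γ ^ i).symm x.1, by
        obtain ⟨y, hy, hx⟩ := (hmemi _).1 x.2
        exact (hmem0 _).2 ⟨y, hy, by rw [hx, OrderIso.symm_apply_apply]⟩⟩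
      left_inv := fun x => Subtype.ext ((γ ^ i).symm_apply_apply _)
      right_inv := fun x => Subtype.ext ((γ ^ i).apply_symm_apply _)
      map_rel_iff' := (γ ^ i).le_iff_le }
  have hφ : ∀ x, (φ x : CopiesQ n) = (γ ^ i) x.1 := fun _ => rfl
  refine ⟨φ, fun x => ?_, fun x y => ?_⟩
  · rw [iter_iff (γ := γ) (fun z hz => apply_of_mem_cycleExtension hz)]
    refine ⟨rfl, fun l hl => ?_⟩
    obtain ⟨y, hy, hx⟩ := (hmem0 _).1 x.2
    rw [hx]
    exact (pair_mem_cycleExtension hb hy (by omega)).2 (Or.inl (by omega))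
  · obtain ⟨u, hu, hx⟩ := (hmem0 _).1 x.2
    obtain ⟨v, hv, hy⟩ := (hmem0 _).1 y.2
    rw [hφ, hφ, hx, hy]
    have h1 := iter_cycleExtension hR hb hu (period_pos γ b) (w := ⟨b, v⟩)
    have h2 := iter_cycleExtension hR hb hu hi (w := (γ ^ i) ⟨b, v⟩)
    rw [add_comm, pow_add_apply, (γ ^ i).injective.eq_iff] at h2
    rw [h2]
    exact h1

/-- An automorphism extending `cycleExtension γ R` agrees with `γ` along the cycles. -/
theorem pow_eq_of_extends {δ : CopiesQ n ≃o CopiesQ n}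
    (hδ : ∀ z ∈ cycleExtension γ R, δ z.1 = z.2) {b : Fin n}
    (hb : cycleRep (inducedPerm γ) b = b) {y : ℚ} (hy : y ∈ points (R b)) {s : ℕ}
    (hs : s < period γ b) : (δ ^ s) ⟨b, y⟩ = (γ ^ s) ⟨b, y⟩ := by
  induction s with
  | zero => rfl
  | succ s ih =>
    rw [pow_succ_apply', ih (by omega)]
    exact hδ _ ((pair_mem_cycleExtension hb hy (by omega)).2 (Or.inl hs))

/-- Since `R b` is nonempty, every copy contains the first entry of some pair, and the permutation
can be read off these pairs. -/
theorem inducedPerm_eq_of_extends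
    (hne : ∀ b, cycleRep (inducedPerm γ) b = b → (R b).Nonempty) {δ : CopiesQ n ≃o CopiesQ n}
    (hδ : ∀ z ∈ cycleExtension γ R, δ z.1 = z.2) : inducedPerm δ = inducedPerm γ := by
  ext1 a
  obtain ⟨s, hs, hsa⟩ := exists_pow_cycleRep (σ := inducedPerm γ) a
  set b := cycleRep (inducedPerm γ) a
  have hb : cycleRep (inducedPerm γ) b = b := cycleRep_cycleRep a
  obtain ⟨x, hx⟩ := hne b hb
  have h1 := hδ _ ((pair_mem_cycleExtension (s := s) hb (fst_mem_points hx) hs).2 (Or.inr ⟨x.2, hx⟩))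
  have h2 := congrArg Sigma.fst h1
  dsimp only at h2
  rw [fst_apply, pow_succ_apply', fst_apply γ, pow_apply_mk, hsa] at h2
  exact h2

theorem returnMap_eq_of_extends
    (hR : ∀ b, cycleRep (inducedPerm γ) b = b → ∀ x ∈ R b, returnMap γ b x.1 = x.2)
    (hne : ∀ b, cycleRep (inducedPerm γ) b = b → (R b).Nonempty) {δ : CopiesQ n ≃o CopiesQ n}
    (hδ : ∀ z ∈ cycleExtension γ R, δ z.1 = z.2) {b : Fin n}
    (hb : cycleRep (inducedPerm γ) b = b) {x : ℚ × ℚ} (hx : x ∈ R b) :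
    returnMap δ b x.1 = x.2 := by
  have hper : period δ b = period γ b := by
    unfold period
    rw [inducedPerm_eq_of_extends hne hδ]
  obtain ⟨k, hk⟩ : ∃ k, period γ b = k + 1 := ⟨period γ b - 1, by have := period_pos γ b; omega⟩
  have h1 := pow_period_apply δ b x.1
  have h2 := hδ _ ((pair_mem_cycleExtension (s := k) hb (fst_mem_points hx) (by omega)).2
    (Or.inr ⟨x.2, hx⟩))
  dsimp only at h2
  rw [hper, hk, pow_succ_apply', pow_eq_of_extends hδ hb (fst_mem_points hx) (by omega), h2, ← hk,
    pow_period_apply, hR b hb x hx] at h1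
  injection h1 with _ h3
  exact h3.symm

/-- If the partial return maps `R b` are amalgamation bases that distinguish the cycles, then
`cycleExtension γ R` is an amalgamation base. -/
theorem isBase_cycleExtension
    (hR : ∀ b, cycleRep (inducedPerm γ) b = b → ∀ x ∈ R b, returnMap γ b x.1 = x.2)
    (hne : ∀ b, cycleRep (inducedPerm γ) b = b → (R b).Nonempty)
    (hbase : ∀ b, cycleRep (inducedPerm γ) b = b → IsBase (returnMap γ b) (R b))
    (hpin : ∀ b, cycleRep (inducedPerm γ) b = b → ∀ a, Embeds (returnMap γ a) (R b) →
      ∀ p, Embeds (returnMap γ b) p → Embeds (returnMap γ a) p) :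
    IsBase γ (cycleExtension γ R) := by
  classical
  have main : ∀ (p : Finset (CopiesQ n × CopiesQ n)), Embeds γ p → cycleExtension γ R ⊆ p →
      ∃ r : Fin n → Finset (ℚ × ℚ), (∀ b, cycleRep (inducedPerm γ) b = b →
        R b ⊆ r b ∧ Embeds (returnMap γ b) (r b)) ∧
      ∀ A : Fin n → ℚ ≃o ℚ, (∀ b, cycleRep (inducedPerm γ) b = b →
        EmbedsVia (returnMap γ b) (A b) (r b)) →
        ∃ β : CopiesQ n ≃o CopiesQ n, EmbedsVia γ β p ∧ ∀ b, cycleRep (inducedPerm γ) b = b →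
          ∀ s < period γ b, ∀ y ∈ points (R b), β ((γ ^ s) ⟨b, y⟩) = (γ ^ s) ⟨b, A b y⟩ := by
    rintro p ⟨δ, hδ⟩ hsub
    let γ₁ : CopiesQ n ≃o CopiesQ n := δ⁻¹ * γ * δ
    have hγ₁ : ∀ x ∈ p, γ₁ x.1 = x.2 := fun x hx => hδ.conj_apply hx
    have hγ₁q : ∀ z ∈ cycleExtension γ R, γ₁ z.1 = z.2 := fun z hz => hγ₁ z (hsub hz)
    have hperm : inducedPerm γ₁ = inducedPerm γ := inducedPerm_eq_of_extends hne hγ₁q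
    have hper : ∀ b, period γ₁ b = period γ b := fun b => by
      unfold period
      rw [hperm]
    have hcomm : ∀ a, inducedPerm γ (inducedPerm δ a) = inducedPerm δ (inducedPerm γ a) := by
      intro a
      have h1 := inducedPerm_conj γ δ
      rw [show inducedPerm (δ⁻¹ * γ * δ) = inducedPerm γ from hperm] at h1
      have h2 := congrArg (fun σ : Equiv.Perm (Fin n) => inducedPerm δ (σ a)) h1
      simpa using h2.symm
    have hcomm' : ∀ (i : ℕ) a, (inducedPerm γ ^ i) (inducedPerm δ a) =
        inducedPerm δ ((inducedPerm γ ^ i) a) := by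
      intro i
      induction i with
      | zero => intros; rfl
      | succ i ih =>
        intro a
        rw [pow_succ', Equiv.Perm.mul_apply, Equiv.Perm.mul_apply, ih, hcomm]
    -- the return maps of `γ₁` have the same finite parts as those of `γ`
    have hstep : ∀ a q, Embeds (returnMap γ a) q → Embeds (returnMap γ (inducedPerm δ a)) q := by
      intro a q hq
      set b := cycleRep (inducedPerm γ) a
      have hb : cycleRep (inducedPerm γ) b = b := cycleRep_cycleRep a
      have hsc : (inducedPerm γ).SameCycle b a := cycleRep_sameCycle _ a
      have hsc' : (inducedPerm γ).SameCycle (inducedPerm δ b) (inducedPerm δ a) := by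
        obtain ⟨i, hi⟩ := hsc.exists_nat_pow_eq
        exact ⟨i, by rw [zpow_natCast, hcomm', hi]⟩
      rw [← embeds_returnMap_sameCycle hsc']
      -- `R b` is part of the return map of `γ₁` on `b`, a conjugate of that of `γ` on the copy to
      -- which `δ` carries `b`; so pinning applies to that copy.
      refine hpin b hb _ ?_ q ((embeds_returnMap_sameCycle hsc).2 hq)
      rw [← embeds_returnMap_conj]
      exact ⟨1, fun x hx => returnMap_eq_of_extends hR hne hγ₁q hb hx⟩
    have hiter : ∀ (j : ℕ) a q, Embeds (returnMap γ a) q →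
        Embeds (returnMap γ ((inducedPerm δ ^ j) a)) q := by
      intro j
      induction j with
      | zero => exact fun _ _ h => h
      | succ j ih =>
        intro a q hq
        rw [pow_succ', Equiv.Perm.mul_apply]
        exact hstep _ q (ih a q hq)
    -- The permutation induced by `δ` has finite order, so the inclusions proved by `hstep` lead
    -- round to the starting copy.
    have htrans : ∀ b q, Embeds (returnMap γ₁ b) q → Embeds (returnMap γ b) q := by
      intro b q hq
      have h1 := hiter (orderOf (inducedPerm δ) - 1) _ q (embeds_returnMap_conj.1 hq)
      have hpos := orderOf_pos (inducedPerm δ)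
      rwa [← Equiv.Perm.mul_apply, ← pow_succ, Nat.sub_add_cancel hpos, pow_orderOf_eq_one,
        Equiv.Perm.one_apply] at h1
    -- All that `p` requires of the return maps of `γ₁`: the base together with the coordinates of
    -- the points of `p`. Coordinates computed with a wrong `s` only add further pairs of the return
    -- map.
    let r : Fin n → Finset (ℚ × ℚ) := fun b => R b ∪ graphOn (returnMap γ₁ b)
      ((p ×ˢ Finset.range (period γ b)).image fun u => ((γ₁ ^ u.2).symm u.1.1).2)
    refine ⟨r, fun b hb => ⟨Finset.subset_union_left, htrans b _ ⟨1, fun x hx => ?_⟩⟩, ?_⟩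
    · rcases Finset.mem_union.1 hx with hx | hx
      · exact returnMap_eq_of_extends hR hne hγ₁q hb hx
      · exact (mem_graphOn.1 hx).2
    · intro A hA
      obtain ⟨β, hβ⟩ := exists_glued hperm A
      rw [hperm] at hβ
      refine ⟨β, fun x hx => ?_, fun b hb s hs y hy => ?_⟩
      · obtain ⟨b, hb, s, hs, y, hxy⟩ := exists_coordinates γ₁ x.1
        rw [hperm] at hb
        have hyr : (y, returnMap γ₁ b y) ∈ r b := by
          refine Finset.mem_union_right _ (mem_graphOn.2 ⟨?_, rfl⟩)
          refine Finset.mem_image.2 ⟨(x, s), Finset.mem_product.2 ⟨hx, Finset.mem_range.2 ?_⟩, ?_⟩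
          · rwa [← hper]
          · dsimp only
            rw [hxy, OrderIso.symm_apply_apply]
        rw [← hγ₁ x hx, hxy, ← pow_succ_apply', hβ b hb s hs, ← pow_succ_apply']
        by_cases hs' : s + 1 < period γ₁ b
        · rw [hβ b hb _ hs']
        · have h1 : s + 1 = period γ₁ b := by omega
          have h2 := hβ b hb 0 (period_pos γ₁ b) (returnMap γ₁ b y)
          rw [h1, pow_period_apply, hper, pow_period_apply, hA b hb _ hyr]
          exact h2.symm
      · rw [← pow_eq_of_extends hγ₁q hb hy hs]
        exact hβ b hb s (by rwa [hper]) y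
  intro p₁ p₂ hp₁ hp₂ hs₁ hs₂
  obtain ⟨r₁, hr₁, h₁⟩ := main p₁ hp₁ hs₁
  obtain ⟨r₂, hr₂, h₂⟩ := main p₂ hp₂ hs₂
  have hA : ∀ b, ∃ A : (ℚ ≃o ℚ) × (ℚ ≃o ℚ), cycleRep (inducedPerm γ) b = b →
      EmbedsVia (returnMap γ b) A.1 (r₁ b) ∧ EmbedsVia (returnMap γ b) A.2 (r₂ b) ∧
        ∀ x ∈ support (R b), A.1 x = A.2 x := by
    intro b
    by_cases hb : cycleRep (inducedPerm γ) b = b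
    · obtain ⟨α₁, α₂, h⟩ := hbase b hb _ _ (hr₁ b hb).2 (hr₂ b hb).2 (hr₁ b hb).1 (hr₂ b hb).1
      exact ⟨(α₁, α₂), fun _ => h⟩
    · exact ⟨1, fun h => absurd h hb⟩
  choose A hA using hA
  obtain ⟨β₁, hβ₁, hβ₁'⟩ := h₁ (fun b => (A b).1) fun b hb => (hA b hb).1
  obtain ⟨β₂, hβ₂, hβ₂'⟩ := h₂ (fun b => (A b).2) fun b hb => (hA b hb).2.1
  refine ⟨β₁, β₂, hβ₁, hβ₂, fun x hx => ?_⟩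
  obtain ⟨b, hb, s, hs, y, hy, rfl⟩ := (mem_support_cycleExtension hR).1 hx
  rw [hβ₁' b hb s hs y hy, hβ₂' b hb s hs y hy, (hA b hb).2.2 y (mem_points_iff.1 hy)]

/-- Automorphisms with the same permutation of the copies and conjugate return maps are conjugate. -/
theorem exists_conj_of_returnMap {γ γ' : CopiesQ n ≃o CopiesQ n}
    (hperm : inducedPerm γ = inducedPerm γ') (A : Fin n → ℚ ≃o ℚ)
    (hA : ∀ b, cycleRep (inducedPerm γ) b = b → ∀ y, A b (returnMap γ b y) = returnMap γ' b (A b y)) :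
    ∃ β : CopiesQ n ≃o CopiesQ n, γ = β⁻¹ * γ' * β := by
  obtain ⟨β, hβ⟩ := exists_glued hperm A
  refine ⟨β, ?_⟩
  rw [mul_assoc, eq_inv_mul_iff_mul_eq]
  refine RelIso.ext fun x => ?_
  change β (γ x) = γ' (β x)
  have hper : ∀ b, period γ b = period γ' b := fun b => by
    unfold period
    rw [hperm]
  obtain ⟨b, hb, s, hs, y, rfl⟩ := exists_coordinates γ x
  rw [← pow_succ_apply', hβ b hb s hs, ← pow_succ_apply']
  by_cases hs' : s + 1 < period γ b
  · rw [hβ b hb _ hs']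
  · have h1 : s + 1 = period γ b := by omega
    have h2 := hβ b hb 0 (period_pos γ b) (returnMap γ b y)
    rw [h1, pow_period_apply, hper, pow_period_apply, ← hA b hb]
    exact h2

/-- Every finite part of an automorphism extends to a symmetric amalgamation base. -/
theorem exists_symmetric_isBase (γ₀ : CopiesQ n ≃o CopiesQ n) (p : Finset (CopiesQ n × CopiesQ n))
    (hp : ∀ x ∈ p, γ₀ x.1 = x.2) : ∃ (β γ : CopiesQ n ≃o CopiesQ n)
      (q : Finset (CopiesQ n × CopiesQ n)), γ = β⁻¹ * γ₀ * β ∧ p ⊆ q ∧ (∀ x ∈ q, γ x.1 = x.2) ∧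
        IsSymmetricFor (inducedPerm γ) q ∧ IsBase γ q := by
  classical
  -- the finite parts of the return maps needed for `p`
  let r : Fin n → Finset (ℚ × ℚ) := fun b => graphOn (returnMap γ₀ b) (insert 0
    ((p ×ˢ Finset.range (period γ₀ b)).image fun u => ((γ₀ ^ u.2).symm u.1.1).2))
  have hr : ∀ b, Embeds (returnMap γ₀ b) (r b) := fun b => ⟨1, fun x hx => (mem_graphOn.1 hx).2⟩
  have hex : ∀ b, ∃ R, r b ⊆ R ∧ Embeds (returnMap γ₀ b) R ∧ IsBase (returnMap γ₀ b) R ∧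
      ∀ a, Embeds (returnMap γ₀ a) R → ∀ p, Embeds (returnMap γ₀ b) p → Embeds (returnMap γ₀ a) p := by
    intro b
    obtain ⟨r', h1, h2, h3⟩ := exists_pinning (returnMap γ₀) (returnMap γ₀ b) Finset.univ (r b) (hr b)
    obtain ⟨R, h4, h5, h6⟩ := exists_isBase (returnMap γ₀ b) r' h2
    exact ⟨R, h1.trans h4, h5, h6, fun a ha => h3 a (Finset.mem_univ a) (ha.mono h4)⟩
  choose R hrR hRe hRb hRpin using hex
  choose A hA using hRe
  -- `R b` is only a translate of a part of the return map of `γ₀`, so that map is replaced by a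
  -- conjugate containing `R b`. The result `γ` is conjugate to `γ₀` and still extends `p`, as `R b`
  -- contains all that `p` uses.
  obtain ⟨γ, hperm, hγ⟩ := exists_modified γ₀ fun b => (A b)⁻¹ * returnMap γ₀ b * A b
  have hper : ∀ b, period γ b = period γ₀ b := fun b => by
    unfold period
    rw [hperm]
  have hret : ∀ b, cycleRep (inducedPerm γ) b = b →
      returnMap γ b = (A b)⁻¹ * returnMap γ₀ b * A b := fun b hb => (hγ b (hperm ▸ hb)).1
  have hemb : ∀ a q, Embeds (returnMap γ a) q ↔ Embeds (returnMap γ₀ a) q := by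
    intro a q
    have hsc : (inducedPerm γ₀).SameCycle (cycleRep (inducedPerm γ) a) a := by
      rw [hperm]
      exact cycleRep_sameCycle _ a
    rw [← embeds_returnMap_sameCycle (cycleRep_sameCycle (inducedPerm γ) a), hret _ (cycleRep_cycleRep a),
      embeds_conj, embeds_returnMap_sameCycle hsc]
  obtain ⟨β, hβ⟩ := exists_conj_of_returnMap hperm A fun b hb y => by
    rw [hret b hb]
    exact (A b).apply_symm_apply _
  have hR : ∀ b, cycleRep (inducedPerm γ) b = b → ∀ x ∈ R b, returnMap γ b x.1 = x.2 := by
    intro b hb x hx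
    rw [hret b hb]
    exact (hA b).conj_apply hx
  refine ⟨β, γ, cycleExtension γ R, hβ, ?_, fun x hx => apply_of_mem_cycleExtension hx,
    isSymmetricFor_cycleExtension hR, isBase_cycleExtension hR ?_ ?_ ?_⟩
  · intro x hx
    obtain ⟨b, hb, s, hs, y, hxy⟩ := exists_coordinates γ₀ x.1
    have hyR : (y, returnMap γ₀ b y) ∈ R b := by
      refine hrR b (mem_graphOn.2 ⟨Finset.mem_insert_of_mem ?_, rfl⟩)
      refine Finset.mem_image.2 ⟨(x, s), Finset.mem_product.2 ⟨hx, Finset.mem_range.2 hs⟩, ?_⟩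
      dsimp only
      rw [hxy, OrderIso.symm_apply_apply]
    have hb' : cycleRep (inducedPerm γ) b = b := by rwa [hperm]
    have hpow := (hγ b hb).2
    have hx1 : x.1 = (γ ^ s) ⟨b, y⟩ := by rw [hxy, hpow s hs]
    have hx2 : x.2 = (γ ^ (s + 1)) ⟨b, y⟩ := by
      rw [← hp x hx, hxy, ← pow_succ_apply']
      by_cases hs' : s + 1 < period γ₀ b
      · rw [hpow _ hs']
      · have h1 : s + 1 = period γ₀ b := by omega
        rw [h1, pow_period_apply, ← hper, pow_period_apply, hR b hb' _ hyR]
    rw [show x = (x.1, x.2) from rfl, hx1, hx2]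
    exact (pair_mem_cycleExtension hb' (fst_mem_points hyR) (by rwa [hper])).2 (Or.inr ⟨_, hyR⟩)
  · intro b _
    -- The point `0` was inserted in `r b` to make `R b` nonempty.
    exact ⟨(0, returnMap γ₀ b 0), hrR b (mem_graphOn.2 ⟨Finset.mem_insert_self _ _, rfl⟩)⟩
  · intro b hb
    rw [hret b hb]
    exact (hRb b).conj _
  · intro b _ a ha q hq
    rw [hemb] at ha hq ⊢
    exact hRpin b a ha q hq

end Copies

/-! ### The topology of the automorphism group and closures of conjugacy classes -/

section Topology

variable {M : Type} [PartialOrder M]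

theorem Extends.mono {γ : M ≃o M} {p q : Finset (M × M)} (h : Extends γ q) (hpq : p ⊆ q) :
    Extends γ p := fun x hx => h x (hpq hx)

theorem extends_conj {γ α : M ≃o M} {p : Finset (M × M)} :
    Extends (α⁻¹ * γ * α) p ↔ EmbedsVia γ α p := by
  refine forall₂_congr fun x _ => ?_
  exact α.symm_apply_eq

theorem extends_translate {γ α : M ≃o M} {p : Finset (M × M)} :
    Extends γ (translate α p) ↔ EmbedsVia γ α p := by
  have := embedsVia_translate (g := γ) (α := α) (β := 1) (p := p)
  rwa [one_mul] at this

theorem Extends.union [DecidableEq M] {γ : M ≃o M} {p q : Finset (M × M)} (hp : Extends γ p)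
    (hq : Extends γ q) : Extends γ (p ∪ q) := by
  intro x hx
  rcases Finset.mem_union.1 hx with h | h
  · exact hp x h
  · exact hq x h

theorem embeds_iff_exists_conj {ρ : M ≃o M} {p : Finset (M × M)} :
    Embeds ρ p ↔ ∃ γ ∈ conjugatesOf ρ, Extends γ p := by
  constructor
  · rintro ⟨α, hα⟩
    exact ⟨α⁻¹ * ρ * α, isConj_iff.2 ⟨α⁻¹, by rw [inv_inv]⟩, extends_conj.2 hα⟩
  · rintro ⟨γ, hγ, h⟩
    obtain ⟨c, rfl⟩ := isConj_iff.1 hγ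
    refine ⟨c⁻¹, extends_conj.1 ?_⟩
    rwa [inv_inv]

theorem isOpen_setOf_apply_eq (x y : M) : IsOpen {γ : M ≃o M | γ x = y} := by
  let _ : TopologicalSpace M := ⊥
  have : DiscreteTopology M := ⟨rfl⟩
  exact isOpen_induced ((isOpen_discrete {y}).preimage (continuous_apply (A := fun _ : M => M) x))

theorem isOpen_setOf_extends (p : Finset (M × M)) : IsOpen {γ : M ≃o M | Extends γ p} := by
  have : {γ : M ≃o M | Extends γ p} = ⋂ x ∈ p, {γ : M ≃o M | γ x.1 = x.2} := by
    ext γ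
    simp [Extends]
  rw [this]
  exact isOpen_biInter_finset fun x _ => isOpen_setOf_apply_eq x.1 x.2

theorem exists_extends_subset {U : Set (M ≃o M)} (hU : IsOpen U) {γ : M ≃o M} (hγ : γ ∈ U) :
    ∃ p : Finset (M × M), Extends γ p ∧ {δ : M ≃o M | Extends δ p} ⊆ U := by
  classical
  let _ : TopologicalSpace M := ⊥
  obtain ⟨V, hV, rfl⟩ := isOpen_induced_iff.1 hU
  obtain ⟨I, u, hu, hI⟩ := isOpen_pi_iff.1 hV _ hγ
  refine ⟨I.image fun x => (x, γ x), fun x hx => ?_, fun δ hδ => hI fun x hx => ?_⟩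
  · obtain ⟨y, _, rfl⟩ := Finset.mem_image.1 hx
    rfl
  · have : δ x = γ x := hδ (x, γ x) (Finset.mem_image_of_mem _ hx)
    change δ x ∈ u x
    rw [this]
    exact (hu x hx).2

/-- The automorphisms extending a given finite map form a basic open set, and such a set meets the
conjugacy class iff the map embeds in `ρ`. -/
theorem mem_conjClosure_iff {ρ γ : M ≃o M} :
    γ ∈ conjClosure ρ ↔ ∀ p, Extends γ p → Embeds ρ p := by
  unfold conjClosure
  rw [mem_closure_iff]
  constructor
  · intro h p hp
    obtain ⟨δ, hδ, hδ'⟩ := h _ (isOpen_setOf_extends p) hp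
    exact embeds_iff_exists_conj.2 ⟨δ, hδ', hδ⟩
  · intro h U hU hγ
    obtain ⟨p, hp, hpU⟩ := exists_extends_subset hU hγ
    obtain ⟨δ, hδ, hδ'⟩ := embeds_iff_exists_conj.1 (h p hp)
    exact ⟨δ, hpU hδ', hδ⟩

theorem mem_partialIsos_iff {ρ : M ≃o M} {p : Finset (M × M)} : p ∈ partialIsos ρ ↔ Embeds ρ p := by
  constructor
  · rintro ⟨_, γ, hγ, h⟩
    exact mem_conjClosure_iff.1 hγ p h
  · intro h
    obtain ⟨γ, hγ, hp⟩ := embeds_iff_exists_conj.1 h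
    refine ⟨fun x hx y hy => ?_, γ, subset_closure hγ, hp⟩
    rw [← hp x hx, ← hp y hy, γ.le_iff_le]

theorem conj_mem_conjClosure {ρ γ : M ≃o M} (h : γ ∈ conjClosure ρ) (α : M ≃o M) :
    α⁻¹ * γ * α ∈ conjClosure ρ := by
  rw [mem_conjClosure_iff] at h ⊢
  intro p hp
  have := (h _ (extends_translate.2 (extends_conj.1 hp))).translate α⁻¹
  rwa [← translate_mul, inv_mul_cancel, translate_one] at this

/-- The automorphisms in the closure of the conjugacy class which extend a member of a dense set of
finite partial isomorphisms form a comeagre set. -/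
theorem eventually_extends (ρ : M ≃o M) (Q : Finset (M × M) → Prop)
    (hQ : ∀ p, Embeds ρ p → ∃ q, p ⊆ q ∧ Embeds ρ q ∧ Q q) :
    ∀ᶠ γ : conjClosure ρ in residual (conjClosure ρ), ∃ q, Q q ∧ Extends (γ : M ≃o M) q := by
  refine residual_of_dense_open ?_ ?_
  · have : {γ : conjClosure ρ | ∃ q, Q q ∧ Extends (γ : M ≃o M) q} =
        ⋃ q ∈ {q | Q q}, Subtype.val ⁻¹' {γ : M ≃o M | Extends γ q} := by
      ext γ
      simp
    change IsOpen {γ : conjClosure ρ | ∃ q, Q q ∧ Extends (γ : M ≃o M) q}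
    rw [this]
    exact isOpen_biUnion fun q _ => (isOpen_setOf_extends q).preimage continuous_subtype_val
  · intro γ
    rw [mem_closure_iff]
    intro U hU hγ
    obtain ⟨V, hV, rfl⟩ := isOpen_induced_iff.1 hU
    obtain ⟨p, hp, hpV⟩ := exists_extends_subset hV hγ
    obtain ⟨q, hpq, hq, hQq⟩ := hQ p (mem_conjClosure_iff.1 γ.2 p hp)
    obtain ⟨δ, hδ, hδ'⟩ := embeds_iff_exists_conj.1 hq
    exact ⟨⟨δ, subset_closure hδ⟩, hpV (hδ'.mono hpq), q, hQq, hδ'⟩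

/-- Automorphisms are not closed among all self-maps, as surjectivity may be lost in a limit.
Recording the inverse as well gives a closed embedding. -/
instance [Countable M] : PolishSpace (M ≃o M) := by
  let _ : TopologicalSpace M := ⊥
  have : DiscreteTopology M := ⟨rfl⟩
  have : PolishSpace M := inferInstance
  let e : (M ≃o M) → (M → M) × (M → M) := fun γ => (γ, γ.symm)
  have he : Topology.IsClosedEmbedding e := by
    refine ⟨⟨⟨le_antisymm ?_ ?_⟩, ?_⟩, ?_⟩
    · refine continuous_iff_le_induced.1 (Continuous.prodMk continuous_induced_dom ?_)
      refine continuous_pi fun x => ?_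
      rw [continuous_discrete_rng]
      intro y
      convert isOpen_setOf_apply_eq y x using 1
      ext γ
      exact γ.symm_apply_eq.trans eq_comm
    · have h : (fun γ : M ≃o M => (γ : M → M)) = Prod.fst ∘ e := rfl
      change _ ≤ TopologicalSpace.induced (fun γ : M ≃o M => (γ : M → M)) _
      rw [h, ← induced_compose]
      exact induced_mono (continuous_iff_le_induced.1 continuous_fst)
    · intro γ δ h
      exact DFunLike.coe_injective (congrArg Prod.fst h)
    · have : Set.range e = {f | ∀ x, f.1 (f.2 x) = x} ∩ {f | ∀ x, f.2 (f.1 x) = x} ∩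
          {f | ∀ x y, f.1 x ≤ f.1 y ↔ x ≤ y} := by
        ext f
        constructor
        · rintro ⟨γ, rfl⟩
          exact ⟨⟨γ.apply_symm_apply, γ.symm_apply_apply⟩, fun _ _ => γ.le_iff_le⟩
        · rintro ⟨⟨h1, h2⟩, h3⟩
          exact ⟨⟨⟨f.1, f.2, h2, h1⟩, fun {a b} => h3 a b⟩, rfl⟩
      rw [this]
      have h1 : ∀ x, Continuous fun f : (M → M) × (M → M) => f.1 x := fun x =>
        (continuous_apply x).comp continuous_fst
      have h2 : ∀ x, Continuous fun f : (M → M) × (M → M) => f.2 x := fun x =>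
        (continuous_apply x).comp continuous_snd
      have hcomp : ∀ u v : (M → M) × (M → M) → M → M, (∀ x, Continuous fun f => u f x) →
          (∀ x, Continuous fun f => v f x) → IsClosed {f | ∀ x, v f (u f x) = x} := by
        intro u v hu hv
        have : {f | ∀ x, v f (u f x) = x} = ⋂ x, ⋂ y, {f | u f x = y → v f y = x} := by
          ext f
          simp
        rw [this]
        refine isClosed_iInter fun x => isClosed_iInter fun y => isClosed_imp ?_ ?_
        · exact (isOpen_discrete {y}).preimage (hu x)
        · exact (isClosed_discrete {x}).preimage (hv y)
      refine ((?_ : IsClosed _).inter ?_).inter ?_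
      · exact hcomp Prod.snd Prod.fst h2 h1
      · exact hcomp Prod.fst Prod.snd h1 h2
      · simp only [Set.ofPred_forall]
        refine isClosed_iInter fun x => isClosed_iInter fun y => ?_
        exact (isClosed_discrete {z : M × M | z.1 ≤ z.2 ↔ x ≤ y}).preimage ((h1 x).prodMk (h1 y))
  exact he.polishSpace

end Topology

/-! ### Saturated automorphisms and genericity -/

section Generic

variable {M : Type} [PartialOrder M]

theorem translate_congr {α β : M ≃o M} {p : Finset (M × M)} (h : ∀ x ∈ support p, α x = β x) :
    translate α p = translate β p := by
  ext y
  rw [mem_translate, mem_translate]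
  refine exists_congr fun x => and_congr_right fun hx => ?_
  rw [h x.1 (Or.inl ⟨x.2, hx⟩), h x.2 (Or.inr ⟨x.1, hx⟩)]

theorem support_mono {N : Type} {p q : Finset (N × N)} (h : p ⊆ q) : support p ⊆ support q := by
  rintro x (⟨y, hy⟩ | ⟨y, hy⟩)
  · exact Or.inl ⟨y, h hy⟩
  · exact Or.inr ⟨y, h hy⟩

/-- The finite partial isomorphisms contained in `γ` extend to members of `F` contained in `γ`, and
every extension in `F` of a member of `F` contained in `γ` has a translate over it contained in `γ`. -/
structure IsSaturatedFor (F : Set (Finset (M × M))) (γ : M ≃o M) : Prop where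
  exists_extends : ∀ p, Extends γ p → ∃ q ∈ F, p ⊆ q ∧ Extends γ q
  exists_embedsVia : ∀ q ∈ F, ∃ α, EmbedsVia γ α q
  exists_fixing : ∀ p ∈ F, ∀ q ∈ F, p ⊆ q → Extends γ p →
    ∃ α : M ≃o M, (∀ x ∈ support p, α x = x) ∧ EmbedsVia γ α q

variable {F : Set (Finset (M × M))} {γ δ : M ≃o M}

/-- One step of the back-and-forth construction. -/
theorem IsSaturatedFor.exists_forth (hF : IsInvariant F) (hγ : IsSaturatedFor F γ)
    (hδ : IsSaturatedFor F δ) {p : Finset (M × M)} (hp : p ∈ F) (hpγ : Extends γ p) {α : M ≃o M}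
    (hα : EmbedsVia δ α p) (x : M) : ∃ q ∈ F, p ⊆ q ∧ (x, γ x) ∈ q ∧ Extends γ q ∧
      ∃ β, EmbedsVia δ β q ∧ ∀ y ∈ support p, β y = α y := by
  classical
  obtain ⟨q, hq, hpq, hqγ⟩ := hγ.exists_extends (p ∪ {(x, γ x)})
    (hpγ.union fun y hy => by rw [Finset.mem_singleton.1 hy])
  have hpq' : p ⊆ q := Finset.subset_union_left.trans hpq
  obtain ⟨η, hη, hη'⟩ := hδ.exists_fixing _ (hF p hp α) _ (hF q hq α) (translate_mono α hpq')
    (extends_translate.2 hα)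
  exact ⟨q, hq, hpq', hpq (Finset.mem_union_right _ (Finset.mem_singleton_self _)), hqγ, η * α,
    embedsVia_translate.1 hη', fun y hy => hη _ (mem_support_translate.2 hy)⟩

/-- The forth step with `γ` and `δ` exchanged and `α` inverted, translated back by the automorphism
found there. -/
theorem IsSaturatedFor.exists_back (hF : IsInvariant F) (hγ : IsSaturatedFor F γ)
    (hδ : IsSaturatedFor F δ) {p : Finset (M × M)} (hp : p ∈ F) (hpγ : Extends γ p) {α : M ≃o M}
    (hα : EmbedsVia δ α p) (x : M) : ∃ q ∈ F, p ⊆ q ∧ Extends γ q ∧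
      ∃ β, EmbedsVia δ β q ∧ (∀ y ∈ support p, β y = α y) ∧ ∃ y ∈ support q, β y = x := by
  have hp' : translate α⁻¹ (translate α p) = p := by
    rw [← translate_mul, inv_mul_cancel, translate_one]
  have hα' : EmbedsVia γ α⁻¹ (translate α p) := by
    rw [embedsVia_translate, inv_mul_cancel]
    exact hpγ
  obtain ⟨q, hq, hpq, hxq, hqδ, β, hβ, hβ'⟩ := hδ.exists_forth hF hγ (hF p hp α)
    (extends_translate.2 hα) hα' x
  refine ⟨translate β q, hF q hq β, ?_, extends_translate.2 hβ, β⁻¹, ?_, fun y hy => ?_, β x,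
    mem_support_translate.2 (Or.inl ⟨_, hxq⟩), β.symm_apply_apply x⟩
  · rw [← hp', ← translate_congr hβ']
    exact translate_mono β hpq
  · rw [embedsVia_translate, inv_mul_cancel]
    exact hqδ
  · have h : β (α y) = y := by
      rw [hβ' _ (mem_support_translate.2 hy)]
      exact α.symm_apply_apply y
    exact β.symm_apply_eq.2 h.symm

theorem IsSaturatedFor.isConj [Countable M] (hF : IsInvariant F) (hγ : IsSaturatedFor F γ)
    (hδ : IsSaturatedFor F δ) : IsConj γ δ := by
  classical
  let S := {s : Finset (M × M) × (M ≃o M) // s.1 ∈ F ∧ Extends γ s.1 ∧ EmbedsVia δ s.2 s.1}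
  -- Only the values of the automorphism on the support of the finite map count as constructed;
  -- elsewhere it may change.
  let _ : Preorder S :=
    { le := fun s t => s.1.1 ⊆ t.1.1 ∧ ∀ x ∈ support s.1.1, t.1.2 x = s.1.2 x
      le_refl := fun s => ⟨subset_rfl, fun _ _ => rfl⟩
      le_trans := fun s t u h h' => ⟨h.1.trans h'.1, fun x hx =>
        (h'.2 x (support_mono h.1 hx)).trans (h.2 x hx)⟩ }
  obtain ⟨p₀, hp₀, _, hp₀γ⟩ := hγ.exists_extends ∅ (by simp [Extends])
  obtain ⟨α₀, hα₀⟩ := hδ.exists_embedsVia p₀ hp₀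
  let _ : Encodable (M ⊕ M) := Encodable.ofCountable _
  let D : M ⊕ M → Order.Cofinal S := Sum.elim
    (fun x => ⟨{s | (x, γ x) ∈ s.1.1}, fun s => by
      obtain ⟨q, hq, hpq, hx, hqγ, β, hβ, hβ'⟩ := hγ.exists_forth hF hδ s.2.1 s.2.2.1 s.2.2.2 x
      exact ⟨⟨(q, β), hq, hqγ, hβ⟩, hx, hpq, hβ'⟩⟩)
    (fun x => ⟨{s | ∃ y ∈ support s.1.1, s.1.2 y = x}, fun s => by
      obtain ⟨q, hq, hpq, hqγ, β, hβ, hβ', hx⟩ := hγ.exists_back hF hδ s.2.1 s.2.2.1 s.2.2.2 x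
      exact ⟨⟨(q, β), hq, hqγ, hβ⟩, hx, hpq, hβ'⟩⟩)
  let I := Order.idealOfCofinals (⟨(p₀, α₀), hp₀, hp₀γ, hα₀⟩ : S) D
  have hforth : ∀ x, ∃ s ∈ I, (x, γ x) ∈ s.1.1 := fun x => by
    obtain ⟨s, h1, h2⟩ := Order.cofinal_meets_idealOfCofinals
      (⟨(p₀, α₀), hp₀, hp₀γ, hα₀⟩ : S) D (Sum.inl x)
    exact ⟨s, h2, h1⟩
  choose f hfI hf using hforth
  let θ : M → M := fun x => (f x).1.2 x
  have hθ : ∀ s ∈ I, ∀ x ∈ support s.1.1, s.1.2 x = θ x := by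
    intro s hs x hx
    obtain ⟨t, _, hst, hft⟩ := I.directed _ hs _ (hfI x)
    exact (hst.2 x hx).symm.trans (hft.2 x (Or.inl ⟨_, hf x⟩))
  have hle : ∀ x y, θ x ≤ θ y ↔ x ≤ y := by
    intro x y
    obtain ⟨t, ht, hxt, hyt⟩ := I.directed _ (hfI x) _ (hfI y)
    rw [← hθ t ht x (Or.inl ⟨_, hxt.1 (hf x)⟩), ← hθ t ht y (Or.inl ⟨_, hyt.1 (hf y)⟩),
      t.1.2.le_iff_le]
  have hsurj : Function.Surjective θ := by
    intro x
    obtain ⟨s, ⟨y, hy, hyx⟩, h2⟩ := Order.cofinal_meets_idealOfCofinals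
      (⟨(p₀, α₀), hp₀, hp₀γ, hα₀⟩ : S) D (Sum.inr x)
    exact ⟨y, (hθ s h2 y hy).symm.trans hyx⟩
  let e : M ≃o M := RelIso.ofSurjective (OrderEmbedding.ofMapLEIff θ hle) hsurj
  refine isConj_iff.2 ⟨e, ?_⟩
  rw [mul_inv_eq_iff_eq_mul]
  refine RelIso.ext fun x => ?_
  change θ (γ x) = δ (θ x)
  rw [← hθ _ (hfI x) (γ x) (Or.inr ⟨_, hf x⟩)]
  exact ((f x).2.2.2 _ (hf x)).symm

/-- Members of the closure of a conjugacy class are saturated for a cofinal invariant family with the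
amalgamation property, up to a meagre set. -/
theorem eventually_isSaturatedFor [Countable M] {ρ : M ≃o M}
    (hcof : IsCofinalIn F (partialIsos ρ)) (ham : HasAmalgamation F) :
    ∀ᶠ γ : conjClosure ρ in residual (conjClosure ρ), IsSaturatedFor F (γ : M ≃o M) := by
  classical
  have hemb : ∀ {q}, q ∈ F → Embeds ρ q := fun hq => mem_partialIsos_iff.1 (hcof.1 hq)
  have hcof' : ∀ {p}, Embeds ρ p → ∃ q ∈ F, p ⊆ q := fun hp =>
    hcof.2 _ (mem_partialIsos_iff.2 hp)
  have h1 : ∀ p, ∀ᶠ γ : conjClosure ρ in residual (conjClosure ρ),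
      Extends (γ : M ≃o M) p → ∃ q ∈ F, p ⊆ q ∧ Extends (γ : M ≃o M) q := by
    intro p
    -- The second alternative is needed for density: a map incompatible with `p` qualifies as it
    -- stands, and no member of `C_ρ` extends both.
    refine (eventually_extends ρ (fun q => (q ∈ F ∧ p ⊆ q) ∨ ¬ Embeds ρ (q ∪ p)) ?_).mono ?_
    · intro r hr
      by_cases h : Embeds ρ (r ∪ p)
      · obtain ⟨q, hq, hpq⟩ := hcof' h
        exact ⟨q, Finset.subset_union_left.trans hpq, hemb hq,
          Or.inl ⟨hq, Finset.subset_union_right.trans hpq⟩⟩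
      · exact ⟨r, subset_rfl, hr, Or.inr h⟩
    · rintro γ ⟨q, ⟨hq, hpq⟩ | h, hqγ⟩ hp
      · exact ⟨q, hq, hpq, hqγ⟩
      · exact absurd (mem_conjClosure_iff.1 γ.2 _ (hqγ.union hp)) h
  have h2 : ∀ q, ∀ᶠ γ : conjClosure ρ in residual (conjClosure ρ),
      q ∈ F → ∃ α, EmbedsVia (γ : M ≃o M) α q := by
    intro q
    by_cases hq : q ∈ F
    · refine (eventually_extends ρ (fun s => ∃ α, translate α q ⊆ s) ?_).mono ?_
      · intro r hr
        obtain ⟨α, hα⟩ := hr.exists_union (hemb hq)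
        exact ⟨_, Finset.subset_union_left, hα, α, Finset.subset_union_right⟩
      · rintro γ ⟨s, ⟨α, hα⟩, hs⟩ _
        exact ⟨α, extends_translate.1 (hs.mono hα)⟩
    · exact Filter.Eventually.of_forall fun _ h => absurd h hq
  have h3 : ∀ p q, ∀ᶠ γ : conjClosure ρ in residual (conjClosure ρ), p ∈ F → q ∈ F → p ⊆ q →
      Extends (γ : M ≃o M) p →
        ∃ α : M ≃o M, (∀ x ∈ support p, α x = x) ∧ EmbedsVia (γ : M ≃o M) α q := by
    intro p q
    by_cases hpq : p ∈ F ∧ q ∈ F ∧ p ⊆ q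
    · refine (eventually_extends ρ (fun s => (∃ α : M ≃o M, (∀ x ∈ support p, α x = x) ∧
        translate α q ⊆ s) ∨ ¬ Embeds ρ (s ∪ p)) ?_).mono ?_
      · intro r hr
        by_cases h : Embeds ρ (r ∪ p)
        · obtain ⟨p₁, hp₁, hrp⟩ := hcof' h
          -- Amalgamation over `p`, of an extension of the given condition `r` with the prescribed
          -- extension `q`, gives density.
          obtain ⟨p₃, hp₃, α, hα, hs, hs'⟩ := ham p hpq.1 p₁ hp₁ q hpq.2.1
            (Finset.subset_union_right.trans hrp) hpq.2.2
          exact ⟨p₃, (Finset.subset_union_left.trans hrp).trans hs, hemb hp₃, Or.inl ⟨α, hα, hs'⟩⟩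
        · exact ⟨r, subset_rfl, hr, Or.inr h⟩
      · rintro γ ⟨s, ⟨α, hα, hs⟩ | h, hsγ⟩ _ _ _ hp
        · exact ⟨α, hα, extends_translate.1 (hsγ.mono hs)⟩
        · exact absurd (mem_conjClosure_iff.1 γ.2 _ (hsγ.union hp)) h
    · exact Filter.Eventually.of_forall fun _ h h' h'' => absurd ⟨h, h', h''⟩ hpq
  have h3' := fun p => eventually_countable_forall.2 (h3 p)
  filter_upwards [eventually_countable_forall.2 h1, eventually_countable_forall.2 h2,
    eventually_countable_forall.2 h3'] with γ h1 h2 h3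
  exact ⟨h1, h2, fun p hp q => h3 p q hp⟩

/-- `C_ρ` is closed in a Polish space, so by Baire's theorem the comeagre set of saturated
automorphisms is nonempty; it lies within one conjugacy class. -/
theorem exists_isGenericIn [Countable M] {ρ : M ≃o M} (hF : IsInvariant F)
    (hcof : IsCofinalIn F (partialIsos ρ)) (ham : HasAmalgamation F) :
    ∃ γ ∈ conjClosure ρ, IsGenericIn γ (conjClosure ρ) := by
  have h := eventually_isSaturatedFor hcof ham
  have hclosed : IsClosed (conjClosure ρ) := isClosed_closure
  have : PolishSpace (conjClosure ρ) := hclosed.polishSpace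
  have : Nonempty (conjClosure ρ) := ⟨⟨ρ, subset_closure (IsConj.refl ρ)⟩⟩
  obtain ⟨γ, hγ⟩ := (dense_of_mem_residual h).nonempty
  refine ⟨γ, γ.2, ?_⟩
  unfold IsGenericIn
  filter_upwards [h] with δ hδ
  exact IsSaturatedFor.isConj hF hγ hδ

end Generic

/-! ### The family of symmetric amalgamation bases -/

section Copies

variable {n : ℕ}

theorem iter_translate {M : Type} [PartialOrder M] (α : M ≃o M) (p : Finset (M × M)) (i : ℕ) :
    ∀ x y : M, iter (translate α p) i (α x) (α y) ↔ iter p i x y := by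
  induction i with
  | zero => exact fun x y => α.injective.eq_iff
  | succ i ih =>
    intro x y
    constructor
    · rintro ⟨z, hz, h⟩
      obtain ⟨w, hw, hw'⟩ := mem_translate.1 hz
      rw [Prod.mk.injEq, α.injective.eq_iff] at hw'
      obtain ⟨rfl, rfl⟩ := hw'
      exact ⟨w.2, hw, (ih _ _).1 h⟩
    · rintro ⟨z, hz, h⟩
      exact ⟨α z, map_mem_translate hz, (ih _ _).2 h⟩

/-- An automorphism carries the part of `p` in a copy onto the part of its translate in the image of
that copy. -/
def supportAtIso (α : CopiesQ n ≃o CopiesQ n) (p : Finset (CopiesQ n × CopiesQ n)) {a b : Fin n}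
    (h : inducedPerm α a = b) : supportAt p a ≃o supportAt (translate α p) b where
  toEquiv := α.toEquiv.subtypeEquiv fun x => by
    refine and_congr mem_support_translate.symm ?_
    change _ ↔ (α x).1 = b
    rw [fst_apply, ← h, (inducedPerm α).injective.eq_iff]
  map_rel_iff' := α.le_iff_le

theorem IterIsIso.translate {p : Finset (CopiesQ n × CopiesQ n)} {k i : ℕ} {a b : Fin n}
    (h : IterIsIso p k i a b) (α : CopiesQ n ≃o CopiesQ n) {a' b' : Fin n}
    (ha : inducedPerm α a = a') (hb : inducedPerm α b = b') :
    IterIsIso (translate α p) k i a' b' := by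
  obtain ⟨φ, hφ, hφ'⟩ := h
  refine ⟨((supportAtIso α p ha).symm.trans φ).trans (supportAtIso α p hb), ?_, ?_⟩
  · intro x
    obtain ⟨x, rfl⟩ := (supportAtIso α p ha).surjective x
    simp only [OrderIso.trans_apply, OrderIso.symm_apply_apply]
    exact (iter_translate α p i _ _).2 (hφ x)
  · intro x y
    obtain ⟨x, rfl⟩ := (supportAtIso α p ha).surjective x
    obtain ⟨y, rfl⟩ := (supportAtIso α p ha).surjective y
    simp only [OrderIso.trans_apply, OrderIso.symm_apply_apply]
    exact (iter_translate α p k _ _).trans ((hφ' x y).trans (iter_translate α p k _ _).symm)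

theorem IsSymmetricFor.translate {σ : Equiv.Perm (Fin n)} {p : Finset (CopiesQ n × CopiesQ n)}
    (h : IsSymmetricFor σ p) (α : CopiesQ n ≃o CopiesQ n) :
    IsSymmetricFor (inducedPerm α * σ * (inducedPerm α)⁻¹) (translate α p) := by
  intro a
  obtain ⟨b, hab, hb⟩ := h ((inducedPerm α)⁻¹ a)
  have hinv : ∀ b, (inducedPerm α)⁻¹ (inducedPerm α b) = b := (inducedPerm α).symm_apply_apply
  have hper : Function.minimalPeriod (inducedPerm α * σ * (inducedPerm α)⁻¹ : Equiv.Perm (Fin n))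
      (inducedPerm α b) = Function.minimalPeriod σ b := by
    have := minimalPeriod_conj (σ := σ) (inducedPerm α)⁻¹ (inducedPerm α b)
    rwa [inv_inv, hinv] at this
  refine ⟨inducedPerm α b, ?_, fun i hi => ?_⟩
  · rw [Equiv.Perm.sameCycle_conj, hinv]
    exact hab
  · rw [hper] at hi ⊢
    refine (hb i hi).translate α rfl ?_
    rw [conj_pow, Equiv.Perm.mul_apply, Equiv.Perm.mul_apply, hinv]

theorem translate_mem_symmetricPartialIsos {ρ : CopiesQ n ≃o CopiesQ n}
    {p : Finset (CopiesQ n × CopiesQ n)} (h : p ∈ symmetricPartialIsos ρ)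
    (α : CopiesQ n ≃o CopiesQ n) : translate α p ∈ symmetricPartialIsos ρ := by
  obtain ⟨hp, γ, hγ, hpγ, hs⟩ := h
  have hmem : translate α p ∈ partialIsos ρ :=
    mem_partialIsos_iff.2 ((mem_partialIsos_iff.1 ⟨hp, γ, hγ, hpγ⟩).translate α)
  refine ⟨hmem.1, (α⁻¹)⁻¹ * γ * α⁻¹, conj_mem_conjClosure hγ α⁻¹, ?_, ?_⟩
  · rw [extends_conj, embedsVia_translate, inv_mul_cancel]
    exact hpγ
  · rw [inducedPerm_conj, inducedPerm_inv, inv_inv]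
    exact hs.translate α

/-- The symmetric partial isomorphisms which are amalgamation bases. -/
def symmetricBases (ρ : CopiesQ n ≃o CopiesQ n) : Set (Finset (CopiesQ n × CopiesQ n)) :=
  {q | q ∈ symmetricPartialIsos ρ ∧ IsBase ρ q}

theorem isInvariant_symmetricBases (ρ : CopiesQ n ≃o CopiesQ n) : IsInvariant (symmetricBases ρ) :=
  fun _ hp α => ⟨translate_mem_symmetricPartialIsos hp.1 α, hp.2.translate α⟩

theorem symmetricPartialIsos_subset (ρ : CopiesQ n ≃o CopiesQ n) :
    symmetricPartialIsos ρ ⊆ partialIsos ρ :=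
  fun _ ⟨hp, γ, hγ, hpγ, _⟩ => ⟨hp, γ, hγ, hpγ⟩

theorem isCofinalIn_symmetricBases (ρ : CopiesQ n ≃o CopiesQ n) :
    IsCofinalIn (symmetricBases ρ) (partialIsos ρ) := by
  refine ⟨fun q hq => symmetricPartialIsos_subset ρ hq.1, fun p hp => ?_⟩
  obtain ⟨γ₀, hγ₀, hp⟩ := embeds_iff_exists_conj.1 (mem_partialIsos_iff.1 hp)
  obtain ⟨c, rfl⟩ := isConj_iff.1 hγ₀
  obtain ⟨β, γ, q, rfl, hpq, hqγ, hs, hb⟩ := exists_symmetric_isBase _ p hp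
  have hγ : β⁻¹ * (c * ρ * c⁻¹) * β ∈ conjClosure ρ :=
    subset_closure (isConj_iff.2 ⟨β⁻¹ * c, by group⟩)
  refine ⟨q, ⟨⟨?_, _, hγ, hqγ, hs⟩, ?_⟩, hpq⟩
  · intro x hx y hy
    rw [← hqγ x hx, ← hqγ y hy, OrderIso.le_iff_le]
  · convert hb.conj (β⁻¹ * c) using 1
    group

theorem hasAmalgamation_symmetricBases (ρ : CopiesQ n ≃o CopiesQ n) :
    HasAmalgamation (symmetricBases ρ) := by
  classical
  intro p₀ h₀ p₁ h₁ p₂ h₂ h₀₁ h₀₂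
  have hemb : ∀ {q}, q ∈ symmetricBases ρ → Embeds ρ q := fun hq =>
    mem_partialIsos_iff.1 (symmetricPartialIsos_subset ρ hq.1)
  obtain ⟨α₁, α₂, hα₁, hα₂, hα⟩ := h₀.2 p₁ p₂ (hemb h₁) (hemb h₂) h₀₁ h₀₂
  -- As `α₁` and `α₂` agree on the support of `p₀`, the map `α₁⁻¹ * α₂` fixes it, and `α₁` carries
  -- the whole union into `ρ`. Cofinality then returns to the family.
  have hu : Embeds ρ (p₁ ∪ translate (α₁⁻¹ * α₂) p₂) := by
    refine ⟨α₁, fun x hx => ?_⟩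
    rcases Finset.mem_union.1 hx with hx | hx
    · exact hα₁ x hx
    · refine embedsVia_translate.2 ?_ x hx
      rwa [mul_inv_cancel_left]
  obtain ⟨p₃, hp₃, hs⟩ := (isCofinalIn_symmetricBases ρ).2 _ (mem_partialIsos_iff.2 hu)
  refine ⟨p₃, hp₃, α₁⁻¹ * α₂, fun x hx => ?_, Finset.subset_union_left.trans hs,
    Finset.subset_union_right.trans hs⟩
  change α₁.symm (α₂ x) = x
  rw [← hα x hx, α₁.symm_apply_apply]

end Copies

end PosetAut

theorem theorem5p2 (n : ℕ) (ρ : CopiesQ n ≃o CopiesQ n) :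
    (∃ γ ∈ PosetAut.conjClosure ρ, PosetAut.IsGenericIn γ (PosetAut.conjClosure ρ)) ∧
    ∃ F : Set (Finset (CopiesQ n × CopiesQ n)),
      F ⊆ PosetAut.symmetricPartialIsos ρ ∧
      PosetAut.IsInvariant F ∧
      PosetAut.IsCofinalIn F (PosetAut.partialIsos ρ) ∧
      PosetAut.HasAmalgamation F :=
  ⟨PosetAut.exists_isGenericIn (PosetAut.isInvariant_symmetricBases ρ)
      (PosetAut.isCofinalIn_symmetricBases ρ) (PosetAut.hasAmalgamation_symmetricBases ρ),
    PosetAut.symmetricBases ρ, fun _ h => h.1, PosetAut.isInvariant_symmetricBases ρ,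
    PosetAut.isCofinalIn_symmetricBases ρ, PosetAut.hasAmalgamation_symmetricBases ρ⟩
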